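/- Let $L$ be a field, $\sigma$ an automorphism of $L$ of finite order $n$ with fixed field $K$, let $K'\le K$ be a subfield with $[K:K']<\infty$, and $\rho$ an automorphism of $L$ over $K'$. Let $R=L[x;\sigma]$ be the skew polynomial ring ($xa=a^{\sigma}x$ for $a\in L$). For a monic irreducible $F\in K[y]$ of degree $s$, with constant term $F_0$, put $E_F=K[y]/(F)$ and $R_F=R/RF(x^n)$; for $\eta\in L$ and $1\le k\le n$ put $$S_{n,s,k}(\eta,\rho,F)=\{a+RF(x^n): a=\textstyle\sum_i a_ix^i\in R,\ \deg a\le ks,\ a_{ks}=\eta a_0^{\rho}\}\subseteq R_F .$$ Say that the norm condition holds for $(k,\eta,F)$ if $N_{L:K'}(\eta)\,N_{K:K'}\big((-1)^{sk(n-1)}F_0^k\big)\neq 1$. 1. If the norm condition holds and $R_F\cong M_n(E_F)$ as $K$-algebras, then under every such isomorphism $S_{n,s,k}(\eta,\rho,F)$ becomes a $K'$-linear MRD code with minimum distance $d=n-k+1$; that is, a $K'$-subspace of $M_n(E_F)$ of dimension $n(n-d+1)[E_F:K']$ in which the least rank of a difference of two distinct elements is exactly $d$. 2. If $L$ is finite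 and $|K|=q$, then $R_F\cong M_n(E_F)$ whenever $F\ne y$ or $n=1$, and $|S_{n,s,k}(\eta,\rho,F)|=q^{nsk}$ whenever the norm condition holds. 3. Let $k=1$, let the norm condition hold, and identify $R_F$ with $M_n(E_F)$ by a $K$-algebra isomorphism. Then $S_{n,s,1}(\eta,\rho,F)$ defines semifields: it is the image of an injective $K'$-linear map $\psi:E_F^n\to M_n(E_F)$, and for each such $\psi$ the product $u\circ v=\psi(u)v$ makes $E_F^n$ a presemifield over $K'$ (a not necessarily associative division algebra, with $a\circ x=b$ and $y\circ a=b$ uniquely solvable for $a\neq0$), isotopic to a semifield over $K'$ (a presemifield with identity). 4. (Cyclic semifields.) For $f\in R$ irreducible of degree $s$ let $\mathbb S_f$ be the set of $a\in R$ with $\deg a<s$, with $a\circ b$ the remainder of $ab$ on right division by $f$. Let $k=1$, $\eta=0$; the norm condition then holds for every $F$. If $f$ is irreducible of degree $s=\deg F$ and a right divisor of $F(x^n)$, then under every $K$-algebra isomorphism $R_F\cong M_n(E_F)$ the set $S_{n,s,1}(0,\rho,F)$ is the spread set $\{b\mapsto a\circ b\}$ of $\mathbb S_f$, after an additive identification of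 $\mathbb S_f$ with $E_F^n$. If $L$ is finite, then for every irreducible $f\in R$ of degree $s$ there is a monic irreducible $F\neq y$ in $K[y]$ of degree $s$ such that $S_{n,s,1}(0,\rho,F)$ is, in this sense, the spread set of $\mathbb S_f$. 5. (Twisted Gabidulin codes.) Let $s=1$, $F=y-1$. Then $\sum a_ix^i\mapsto\big(b\mapsto\sum a_ib^{\sigma^i}\big)$ induces a $K$-algebra isomorphism $R_{y-1}\cong\mathrm{End}_K(L)$, which maps $S_{n,1,k}(\eta,\rho,y-1)$ onto the generalised twisted Gabidulin code $$\{f_0X+f_1X^{\sigma}+\cdots+f_{k-1}X^{\sigma^{k-1}}+\eta f_0^{\rho}X^{\sigma^k}:f_i\in L\},$$ and the norm condition reads $N_{L:K'}(\eta)\ne(-1)^{nk[K:K']}$. 6. (Generalised twisted fields.) In 5 with $k=1$, the image of $S_{n,1,1}(\eta,\rho,y-1)$ is the spread set $\{b\mapsto a\circ b:a\in L\}$ of the multiplication $a\circ b=ab-(-\eta)a^{\rho}b^{\sigma}$ on $L$, and the norm condition reads $N_{L:K'}(-\eta)\neq1$. Moreover every generalised twisted field arises: if $i,j\ge0$ and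 $c\in L$ with $N_{L:K}(c)\ne1$, let $\tau=\sigma^j$, let $K_1$ be its fixed field and $n_1$ its order; then the norm condition holds for $S_{n_1,1,1}(-c,\sigma^i,y-1)\subseteq L[x;\tau]/(x^{n_1}-1)\cong\mathrm{End}_{K_1}(L)$ (with $K$ and $K_1$ in the roles of $K'$ and $K$), and this set is the spread set of $a\circ b=ab-c\,a^{\sigma^i}b^{\sigma^j}$. -/

import Mathlib

open Polynomial

noncomputable section

namespace SkewMRD

/-! ### The skew polynomial ring `L[x;σ]` -/

section Ring

variable {K L : Type*} [Field K] [Field L] [Algebra K L]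

/-- A copy of the field `L` that remembers the automorphism `σ`; it is the coefficient ring of
`L[x;σ]`. -/
def Twist (_σ : L ≃ₐ[K] L) : Type _ := L

instance (σ : L ≃ₐ[K] L) : Field (Twist σ) := inferInstanceAs (Field L)

instance (σ : L ≃ₐ[K] L) : Algebra K (Twist σ) := inferInstanceAs (Algebra K L)

/-- `x` acts on the coefficients by `σ`, hence `x ^ m` acts by `σ ^ m`. -/
instance (σ : L ≃ₐ[K] L) : MulSemiringAction (Multiplicative ℕ) (Twist σ) where
  smul m a := ((σ ^ Multiplicative.toAdd m) (a : L) : L)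
  one_smul a := by
    change ((σ ^ 0) (a : L) : L) = a
    rw [pow_zero]; rfl
  mul_smul m m' a := by
    change ((σ ^ (Multiplicative.toAdd m + Multiplicative.toAdd m')) (a : L) : L) =
      (σ ^ Multiplicative.toAdd m) ((σ ^ Multiplicative.toAdd m') (a : L))
    rw [pow_add]; rfl
  smul_zero m := map_zero (σ ^ Multiplicative.toAdd m)
  smul_add m := map_add (σ ^ Multiplicative.toAdd m)
  smul_one m := map_one (σ ^ Multiplicative.toAdd m)
  smul_mul m := map_mul (σ ^ Multiplicative.toAdd m)

instance (σ : L ≃ₐ[K] L) : SMulCommClass (Multiplicative ℕ) K (Twist σ) where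
  smul_comm m c a := map_smul (σ ^ Multiplicative.toAdd m) c (a : L)

/-- The skew polynomial ring `R = L[x;σ]`, in which `x * a = σ a * x` for `a ∈ L`. -/
abbrev SkewPoly (σ : L ≃ₐ[K] L) : Type _ := SkewPolynomial (Twist σ)

/-- The coefficient of `x ^ i`, as an element of `L`. -/
def coeff {σ : L ≃ₐ[K] L} (p : SkewPoly σ) (i : ℕ) : L := SkewPolynomial.coeff p i

/-- The constant skew polynomial `a`. -/
def const (σ : L ≃ₐ[K] L) (a : L) : SkewPoly σ := SkewPolynomial.C (R := Twist σ) a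

theorem X_mul_const (σ : L ≃ₐ[K] L) (a : L) :
    (SkewPolynomial.X : SkewPoly σ) * const σ a = const σ (σ a) * SkewPolynomial.X := by
  have h : ∀ b : Twist σ, (SkewPolynomial.X : SkewPoly σ) * SkewPolynomial.C b =
      SkewPolynomial.C (SkewPolynomial.φ b) * SkewPolynomial.X := by
    intro b
    rw [← SkewPolynomial.monomial_zero_left, ← SkewPolynomial.monomial_zero_left,
      SkewPolynomial.X_mul_monomial, SkewPolynomial.monomial_mul_X]
  exact h a

/-- The element `F(x ^ n)` of `L[x;σ]`, where `n` is the order of `σ`. -/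
def evalXPow (σ : L ≃ₐ[K] L) (F : K[X]) : SkewPoly σ :=
  aeval ((SkewPolynomial.X : SkewPoly σ) ^ orderOf σ) F

theorem X_pow_mem_center (σ : L ≃ₐ[K] L) :
    (SkewPolynomial.X : SkewPoly σ) ^ orderOf σ ∈ Subalgebra.center K (SkewPoly σ) := by
  rw [Subalgebra.mem_center_iff]
  intro p
  rw [SkewPolynomial.X_pow_mul]
  have h : ∀ b : Twist σ, (⇑(SkewPolynomial.φ (R := Twist σ)))^[orderOf σ] b = b := by
    intro b
    rw [SkewPolynomial.φ_iterate_apply]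
    change ((σ ^ orderOf σ) (b : L) : L) = b
    rw [pow_orderOf_eq_one]; rfl
  simp only [h, SkewPolynomial.sum_monomial]

theorem evalXPow_mem_center (σ : L ≃ₐ[K] L) (F : K[X]) :
    evalXPow σ F ∈ Subalgebra.center K (SkewPoly σ) := by
  have h : Algebra.adjoin K {(SkewPolynomial.X : SkewPoly σ) ^ orderOf σ} ≤
      Subalgebra.center K (SkewPoly σ) :=
    Algebra.adjoin_le (Set.singleton_subset_iff.mpr (X_pow_mem_center σ))
  exact h (aeval_mem_adjoin_singleton K _)

/-- The ideal `R F(x ^ n)`: a left ideal by construction, and two-sided as `F(x ^ n)` is central. -/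
abbrev centralIdeal (σ : L ≃ₐ[K] L) (F : K[X]) : Ideal (SkewPoly σ) :=
  Ideal.span {evalXPow σ F}

instance (σ : L ≃ₐ[K] L) (F : K[X]) : (centralIdeal σ F).IsTwoSided where
  mul_mem_of_left {a} b ha := by
    obtain ⟨c, rfl⟩ := Ideal.mem_span_singleton'.mp ha
    rw [mul_assoc, ← Subalgebra.mem_center_iff.mp (evalXPow_mem_center σ F) b, ← mul_assoc]
    exact Ideal.mem_span_singleton'.mpr ⟨c * b, rfl⟩

/-- The quotient algebra `R_F = R / R F(x ^ n)`. -/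
abbrev RF (σ : L ≃ₐ[K] L) (F : K[X]) : Type _ := SkewPoly σ ⧸ centralIdeal σ F

/-- The class `a + R F(x ^ n)`. -/
def mk (σ : L ≃ₐ[K] L) (F : K[X]) (a : SkewPoly σ) : RF σ F :=
  Ideal.Quotient.mk (centralIdeal σ F) a

/-- The set `S_{n,s,k}(η,ρ,F)` in `R_F`, where `n` is the order of `σ` and `s = deg F`:
the classes of the `a` with `deg a ≤ k s` and `a_{k s} = η a_0 ^ ρ`. -/
def codeS {K' : Type*} [Field K'] [Algebra K' L] (σ : L ≃ₐ[K] L) (k : ℕ) (η : L)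
    (ρ : L ≃ₐ[K'] L) (F : K[X]) : Set (RF σ F) :=
  {u | ∃ a : SkewPoly σ, (∀ i, k * F.natDegree < i → coeff a i = 0) ∧
    coeff a (k * F.natDegree) = η * ρ (coeff a 0) ∧ u = mk σ F a}

/-- The condition `N_{L:K'}(η) N_{K:K'}((-1)^{s k (n-1)} F_0 ^ k) ≠ 1`. -/
def NormCond (K' : Type*) [Field K'] [Algebra K' K] [Algebra K' L] (σ : L ≃ₐ[K] L) (k : ℕ)
    (η : L) (F : K[X]) : Prop :=
  Algebra.norm K' η *
    Algebra.norm K' ((-1) ^ (F.natDegree * k * (orderOf σ - 1)) * F.coeff 0 ^ k : K) ≠ 1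

end Ring

/-! ### Rank-metric codes -/

section Codes

/-- `C` has minimum (rank) distance `d`: distinct elements are at distance at least `d`, with
equality for some pair. -/
def HasMinDistance {E : Type*} [CommRing E] {n : ℕ} (C : Set (Matrix (Fin n) (Fin n) E))
    (d : ℕ) : Prop :=
  (∀ A ∈ C, ∀ B ∈ C, A ≠ B → d ≤ (A - B).rank) ∧ ∃ A ∈ C, ∃ B ∈ C, A ≠ B ∧ (A - B).rank = d

/-- `C ⊆ M_n(E)` is a `K'`-linear maximum rank distance code with minimum distance `d`: a
`K'`-subspace of dimension `n (n - d + 1) [E : K']`, the value of the Singleton-like bound. -/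
structure IsLinearMRD (K' : Type*) [Field K'] {E : Type*} [CommRing E] [Algebra K' E] {n : ℕ}
    (C : Set (Matrix (Fin n) (Fin n) E)) (d : ℕ) : Prop where
  linear : ∃ W : Submodule K' (Matrix (Fin n) (Fin n) E), (W : Set _) = C ∧
    Module.finrank K' W = n * (n - d + 1) * Module.finrank K' E
  minDistance : HasMinDistance C d

end Codes

/-! ### Semifields -/

section Semifields

/-- A presemifield over `k`: a nonzero (nonassociative) division algebra over `k`. -/
structure IsPresemifield (k : Type*) [Field k] {V : Type*} [AddCommGroup V] [Module k V]
    (mul : V → V → V) : Prop where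
  nontrivial : Nontrivial V
  add_mul : ∀ a b c, mul (a + b) c = mul a c + mul b c
  mul_add : ∀ a b c, mul a (b + c) = mul a b + mul a c
  smul_mul : ∀ (t : k) a b, mul (t • a) b = t • mul a b
  mul_smul : ∀ (t : k) a b, mul a (t • b) = t • mul a b
  left_div : ∀ a, a ≠ 0 → ∀ b, ∃! x, mul a x = b
  right_div : ∀ a, a ≠ 0 → ∀ b, ∃! y, mul y a = b

/-- A semifield is a presemifield with a two-sided identity. -/
structure IsSemifield (k : Type*) [Field k] {V : Type*} [AddCommGroup V] [Module k V]
    (mul : V → V → V) : Prop extends IsPresemifield k mul where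
  exists_one : ∃ e, ∀ a, mul e a = a ∧ mul a e = a

/-- Isotopy: `A (a ∘ b) = B a ∘' C b` for invertible additive maps `A`, `B`, `C`. -/
def Isotopic {V V' : Type*} [AddCommGroup V] [AddCommGroup V'] (mul : V → V → V)
    (mul' : V' → V' → V') : Prop :=
  ∃ A B C : V ≃+ V', ∀ a b, A (mul a b) = mul' (B a) (C b)

/-- The subset `C` of `M_n(E)` defines semifields: it is a `K'`-subspace that can be parametrised
by `E ^ n`, and for every parametrisation `ψ` the product `u ∘ v = ψ(u) v` makes `E ^ n` a
presemifield over `K'`, isotopic to a semifield over `K'`. -/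
def DefinesSemifields (K' : Type*) [Field K'] {E : Type*} [CommRing E] [Algebra K' E] {n : ℕ}
    (C : Set (Matrix (Fin n) (Fin n) E)) : Prop :=
  (∃ ψ : (Fin n → E) →ₗ[K'] Matrix (Fin n) (Fin n) E, Function.Injective ψ ∧ Set.range ψ = C) ∧
  ∀ ψ : (Fin n → E) →ₗ[K'] Matrix (Fin n) (Fin n) E, Function.Injective ψ → Set.range ψ = C →
    IsPresemifield K' (fun u v => (ψ u).mulVec v) ∧
    ∃ mul' : (Fin n → E) → (Fin n → E) → (Fin n → E),
      IsSemifield K' mul' ∧ Isotopic (fun u v => (ψ u).mulVec v) mul'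

/-- `C ⊆ M_n(E)` is the spread set of `(V, mul)`, the set of its left multiplications `M_a`, after
an identification `B` of `V` with `E ^ n`. -/
def IsSpreadSetOf {E : Type*} [CommRing E] {n : ℕ} (C : Set (Matrix (Fin n) (Fin n) E))
    {V : Type*} [AddCommGroup V] (mul : V → V → V) : Prop :=
  ∃ B : V ≃+ (Fin n → E),
    (∀ a, ∃ M ∈ C, ∀ b, M.mulVec (B b) = B (mul a b)) ∧
    ∀ M ∈ C, ∃ a, ∀ b, M.mulVec (B b) = B (mul a b)

variable {K L : Type*} [Field K] [Field L] [Algebra K L]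

/-- Generalised twisted field multiplication `a ∘ b = a b - c a ^ α b ^ β`. -/
def twistedMul (α β : L → L) (c a b : L) : L := a * b - c * α a * β b

/-- The spread set in `End_K(L)` of a multiplication on `L`. -/
def spreadSetEnd (K : Type*) [Field K] [Algebra K L] (mul : L → L → L) :
    Set (Module.End K L) :=
  {g | ∃ a, ∀ b, g b = mul a b}

/-- The generalised twisted Gabidulin code
`{f_0 X + f_1 X ^ σ + ⋯ + f_{k-1} X ^ (σ ^ (k-1)) + η f_0 ^ ρ X ^ (σ ^ k)}` in `End_K(L)`. -/
def twistedGabidulin {K' : Type*} [Field K'] [Algebra K' L] (σ : L ≃ₐ[K] L) (k : ℕ) (η : L)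
    (ρ : L ≃ₐ[K'] L) : Set (Module.End K L) :=
  {g | ∃ c : ℕ → L, ∀ b,
    g b = (∑ i ∈ Finset.range k, c i * (σ ^ i) b) + η * ρ (c 0) * (σ ^ k) b}

/-- `Φ` is the correspondence `∑ a_i x ^ i ↦ ∑ a_i X ^ (σ ^ i)` between `R_{y-1}`, that is
`L[x;σ] / (x ^ n - 1)`, and `End_K(L)`. -/
def IsLinearizedCorrespondence (σ : L ≃ₐ[K] L)
    (Φ : RF σ (X - 1 : K[X]) ≃ₐ[K] Module.End K L) : Prop :=
  ∀ (a : SkewPoly σ) (b : L), Φ (mk σ _ a) b =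
    ∑ i ∈ SkewPolynomial.support a, coeff a i * (σ ^ i) b

/-- The skew polynomial `f` has degree exactly `s`. -/
def HasDegree {σ : L ≃ₐ[K] L} (f : SkewPoly σ) (s : ℕ) : Prop :=
  coeff f s ≠ 0 ∧ ∀ i, s < i → coeff f i = 0

/-- The skew polynomials of degree less than `s`. -/
def degLT (σ : L ≃ₐ[K] L) (s : ℕ) : AddSubgroup (SkewPoly σ) where
  carrier := {p | ∀ i, s ≤ i → coeff p i = 0}
  zero_mem' _ _ := rfl
  add_mem' {p q} hp hq i hi := by
    have h : coeff (p + q) i = coeff p i + coeff q i := SkewPolynomial.coeff_add p q i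
    rw [h, hp i hi, hq i hi, add_zero]
  neg_mem' {p} hp i hi := by
    have h : coeff (-p) i = -coeff p i := SkewPolynomial.coeff_neg p i
    rw [h, hp i hi, neg_zero]

theorem coeff_monomial_mul {σ : L ≃ₐ[K] L} (m : ℕ) (a : L) (f : SkewPoly σ) (i : ℕ) :
    coeff (SkewPolynomial.monomial (R := Twist σ) m a * f) (m + i) = a * (σ ^ m) (coeff f i) := by
  have h := SkewMonoidAlgebra.coeff_single_mul_aux (k := Twist σ) (G := Multiplicative ℕ) f
    (r := a) (x := Multiplicative.ofAdd m) (y := Multiplicative.ofAdd (m + i))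
    (z := Multiplicative.ofAdd i) (by
      intro c
      rw [ofAdd_add]
      exact mul_right_inj (Multiplicative.ofAdd m))
  exact h

/-- Right division with remainder by a skew polynomial of degree `s`. -/
theorem exists_remainder {σ : L ≃ₐ[K] L} {f : SkewPoly σ} {s : ℕ} (hf : HasDegree f s)
    (p : SkewPoly σ) : ∃ r : degLT σ s, p - r ∈ Ideal.span {f} := by
  suffices H : ∀ (N : ℕ) (p : SkewPoly σ), p ∈ degLT σ N →
      ∃ r : degLT σ s, p - r ∈ Ideal.span {f} by
    obtain ⟨N, hN⟩ := (SkewPolynomial.support p).bddAbove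
    refine H (N + 1) p fun i hi => ?_
    by_contra h
    have := hN (Finset.mem_coe.mpr (SkewPolynomial.mem_support_iff.mpr h))
    omega
  intro N
  induction N with
  | zero =>
    intro p hp
    exact ⟨⟨p, fun i _ => hp i (Nat.zero_le i)⟩, by simp⟩
  | succ N ih =>
    intro p hp
    by_cases hN : N < s
    · exact ⟨⟨p, fun i hi => hp i (by omega)⟩, by simp⟩
    · obtain ⟨m, rfl⟩ : ∃ m, N = m + s := ⟨N - s, by omega⟩
      have hlead : (σ ^ m) (coeff f s) ≠ 0 := (map_ne_zero (σ ^ m)).mpr hf.1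
      set c : L := coeff p (m + s) / (σ ^ m) (coeff f s) with hc
      set g : SkewPoly σ := SkewPolynomial.monomial (R := Twist σ) m c with hg
      obtain ⟨r, hr⟩ := ih (p - g * f) (by
        intro i hi
        have hsub : coeff (p - g * f) i = coeff p i - coeff (g * f) i :=
          SkewPolynomial.coeff_sub p (g * f) i
        obtain ⟨j, rfl⟩ : ∃ j, i = m + j := ⟨i - m, by omega⟩
        rw [hsub, hg, coeff_monomial_mul]
        rcases (show s = j ∨ s < j by omega) with rfl | hj
        · rw [hc, div_mul_cancel₀ _ hlead, sub_self]
        · rw [hf.2 j hj, hp (m + j) (by omega)]; simp)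
      refine ⟨r, ?_⟩
      have : p - (r : SkewPoly σ) = (p - g * f - r) + g * f := by abel
      rw [this]
      exact Ideal.add_mem _ hr (Ideal.mem_span_singleton'.mpr ⟨g, rfl⟩)

/-- The multiplication `a ∘ b = a b mod_r f` of the Petit (cyclic) semifield `𝕊_f` on the skew
polynomials of degree less than `s = deg f`, where `mod_r` is the remainder of right division. -/
def petitMul {σ : L ≃ₐ[K] L} {f : SkewPoly σ} {s : ℕ} (hf : HasDegree f s)
    (a b : degLT σ s) : degLT σ s :=
  (exists_remainder hf (a * b : SkewPoly σ)).choose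

theorem petitMul_spec {σ : L ≃ₐ[K] L} {f : SkewPoly σ} {s : ℕ} (hf : HasDegree f s)
    (a b : degLT σ s) :
    (a * b : SkewPoly σ) - petitMul hf a b ∈ Ideal.span {f} :=
  (exists_remainder hf (a * b : SkewPoly σ)).choose_spec

end Semifields

end SkewMRD

end

/-! The main tool is the reduced norm. The centre of `R` is `K[y]` with `y = x ^ n`, and `R` is
represented by `n × n` matrices over `L[y]` (`regRep`). The determinant of the image of `a` is fixed
by `σ`, so it is a polynomial `N(a) ∈ K[y]` (`redNorm`). If `deg a ≤ m`, then `deg N(a) ≤ m`, its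
coefficient at `y ^ m` is `(-1) ^ (m (n-1)) N_{L:K}(a_m)`, and its constant term is `N_{L:K}(a_0)`
(`coeff_redNorm`, `coeff_zero_redNorm`).

The reduced norm detects rank: if the matrix of `a` in `M_n(E_F)` has nullity at least `r`, then `F
^ r ∣ N(a)` (`pow_dvd_redNorm_of_rank`). Indeed, modulo an irreducible factor `G` of `F` over `L`
the regular representation factors through `R_F` and keeps the nullity, so `G ^ r` divides the
determinant; and `F` is squarefree over `L`. Now suppose `a ≠ 0` satisfies the code equations and
has nullity at least `k`. Then `deg N(a) ≤ k s` forces `N(a) = c F ^ k`. Hence `c = (-1) ^ (s k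
(n-1)) N(η a_0 ^ ρ)` and `N(a_0) = c F_0 ^ k`; taking norms to `K'` and cancelling `N_{L:K'}(a_0)`
contradicts the norm condition (`not_pow_dvd_redNorm`). So nonzero codewords have rank at least `n -
k + 1`. The code is parametrised injectively by `L ^ (k s)`, which gives its dimension, and the
Singleton argument `exists_rank_le` shows that the bound is attained. For `k = 1` all nonzero
codewords are invertible, which is the presemifield property; Kaplansky's trick supplies an
identity.

For finite `L` and `F ≠ y`, the algebra `R_F` is simple with centre `E_F`, so Wedderburn's theorems
and a dimension count make it `M_n(E_F)` (`nonempty_algEquiv_of_finite`).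

For the cyclic semifields, `R / R f` is an `M_n(E_F)`-module and so contains a copy of `E_F ^ n`
(`exists_equivariant_injective`). When `deg f = deg F` the dimensions agree, and remainders modulo
`f` identify `𝕊_f` with `E_F ^ n`. Conversely, for irreducible `f` the central elements in `R f`
form a nonzero prime ideal of `K[y]`, whose generator is the required `F`, except when `f` is a
constant times `x`.

For `F = y - 1`, `R` acts on `L` with `x` acting as `σ`, and Dedekind's independence of characters
makes the action of `R_F` faithful. -/

noncomputable section

namespace SkewMRD

/-! ### Coefficients of skew polynomials -/

section SkewPolyBasic

variable {K L : Type*} [Field K] [Field L] [Algebra K L] {σ : L ≃ₐ[K] L}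

/-- The monomial `a x ^ m`. -/
def mon (σ : L ≃ₐ[K] L) (m : ℕ) : L →ₗ[K] SkewPoly σ where
  toFun a := SkewPolynomial.monomial (R := Twist σ) m a
  map_add' a b := map_add (SkewPolynomial.monomial (R := Twist σ) m) a b
  map_smul' t a := (SkewPolynomial.smul_monomial (R := Twist σ) m t a).symm

theorem coeff_ext {p q : SkewPoly σ} (h : ∀ i, coeff p i = coeff q i) : p = q :=
  SkewPolynomial.ext h

@[simp] theorem coeff_zero (i : ℕ) : coeff (0 : SkewPoly σ) i = 0 := rfl

@[simp] theorem coeff_add (p q : SkewPoly σ) (i : ℕ) : coeff (p + q) i = coeff p i + coeff q i :=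
  SkewPolynomial.coeff_add p q i

@[simp] theorem coeff_neg (p : SkewPoly σ) (i : ℕ) : coeff (-p) i = -coeff p i :=
  SkewPolynomial.coeff_neg p i

@[simp] theorem coeff_sub (p q : SkewPoly σ) (i : ℕ) : coeff (p - q) i = coeff p i - coeff q i :=
  SkewPolynomial.coeff_sub p q i

@[simp] theorem coeff_smul (t : K) (p : SkewPoly σ) (i : ℕ) : coeff (t • p) i = t • coeff p i :=
  rfl

theorem coeff_sum {ι : Type*} (s : Finset ι) (f : ι → SkewPoly σ) (i : ℕ) :
    coeff (∑ j ∈ s, f j) i = ∑ j ∈ s, coeff (f j) i := by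
  classical
  induction s using Finset.induction_on with
  | empty => simp
  | insert a s ha ih => rw [Finset.sum_insert ha, Finset.sum_insert ha, coeff_add, ih]

theorem coeff_mon (m : ℕ) (a : L) (i : ℕ) : coeff (mon σ m a) i = if m = i then a else 0 :=
  SkewPolynomial.coeff_monomial (R := Twist σ)

theorem mon_zero (a : L) : mon σ 0 a = const σ a := rfl

theorem mon_one (m : ℕ) : mon σ m 1 = SkewPolynomial.X ^ m :=
  SkewPolynomial.monomial_one_right_eq_X_pow (R := Twist σ) m

theorem mon_mul_mon (m l : ℕ) (a b : L) :
    mon σ m a * mon σ l b = mon σ (m + l) (a * (σ ^ m) b) :=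
  SkewMonoidAlgebra.single_mul_single (k := Twist σ) (G := Multiplicative ℕ)
    (a₁ := Multiplicative.ofAdd m) (a₂ := Multiplicative.ofAdd l) (b₁ := a) (b₂ := b)

theorem const_mul_X_pow (m : ℕ) (a : L) : const σ a * SkewPolynomial.X ^ m = mon σ m a := by
  rw [← mon_one, ← mon_zero, mon_mul_mon]
  simp

theorem skew_induction {P : SkewPoly σ → Prop} (p : SkewPoly σ) (hm : ∀ m a, P (mon σ m a))
    (hadd : ∀ p q, P p → P q → P (p + q)) : P p := by
  induction p using SkewPolynomial.induction with
  | h0 => simpa using hm 0 0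
  | ha n r q _ _ hq => exact hadd _ _ (hm n r) hq

theorem coeff_mon_mul (m : ℕ) (a : L) (q : SkewPoly σ) (k : ℕ) :
    coeff (mon σ m a * q) k = if m ≤ k then a * (σ ^ m) (coeff q (k - m)) else 0 := by
  induction q using skew_induction with
  | hm l b =>
    rw [mon_mul_mon, coeff_mon, coeff_mon]
    split_ifs <;> first | rfl | omega | simp
  | hadd p q hp hq =>
    rw [mul_add, coeff_add, hp, hq, coeff_add]
    split_ifs
    · rw [map_add, mul_add]
    · simp

theorem coeff_mul (p q : SkewPoly σ) (k : ℕ) :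
    coeff (p * q) k = ∑ i ∈ Finset.range (k + 1), coeff p i * (σ ^ i) (coeff q (k - i)) := by
  induction p using skew_induction with
  | hm m a =>
    rw [coeff_mon_mul]
    simp only [coeff_mon, ite_mul, zero_mul]
    rw [Finset.sum_ite_eq]
    simp
  | hadd p p' hp hp' =>
    rw [add_mul, coeff_add, hp, hp', ← Finset.sum_add_distrib]
    simp only [coeff_add, add_mul]

theorem coeff_mul_zero (p q : SkewPoly σ) : coeff (p * q) 0 = coeff p 0 * coeff q 0 := by
  simp [coeff_mul]

theorem coeff_const_mul (a : L) (q : SkewPoly σ) (k : ℕ) :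
    coeff (const σ a * q) k = a * coeff q k := by
  rw [← mon_zero, coeff_mon_mul]; simp

theorem coeff_mul_const (p : SkewPoly σ) (a : L) (k : ℕ) :
    coeff (p * const σ a) k = coeff p k * (σ ^ k) a := by
  rw [coeff_mul, Finset.sum_eq_single_of_mem k (by simp)]
  · rw [← mon_zero, coeff_mon]; simp
  · intro i hi hik
    rw [← mon_zero, coeff_mon, if_neg]
    · simp
    · have := Finset.mem_range.mp hi; omega

theorem coeff_X_mul (q : SkewPoly σ) (k : ℕ) :
    coeff (SkewPolynomial.X * q) (k + 1) = σ (coeff q k) := by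
  rw [← pow_one SkewPolynomial.X, ← mon_one, coeff_mon_mul]
  simp

theorem coeff_mul_X (p : SkewPoly σ) (k : ℕ) :
    coeff (p * SkewPolynomial.X) (k + 1) = coeff p k := by
  rw [coeff_mul, Finset.sum_eq_single_of_mem k (by simp)]
  · rw [← pow_one SkewPolynomial.X, ← mon_one, coeff_mon]; simp
  · intro i hi hik
    rw [← pow_one SkewPolynomial.X, ← mon_one, coeff_mon, if_neg]
    · simp
    · have := Finset.mem_range.mp hi; omega

theorem coeff_mul_X_zero (p : SkewPoly σ) : coeff (p * SkewPolynomial.X) 0 = 0 := by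
  rw [coeff_mul_zero, ← pow_one SkewPolynomial.X, ← mon_one, coeff_mon]; simp

theorem coeff_X_mul_zero (p : SkewPoly σ) : coeff (SkewPolynomial.X * p) 0 = 0 := by
  rw [coeff_mul_zero, ← pow_one SkewPolynomial.X, ← mon_one, coeff_mon]; simp

theorem coeff_one (i : ℕ) : coeff (1 : SkewPoly σ) i = if i = 0 then 1 else 0 := by
  have := coeff_mon (σ := σ) 0 1 i
  rw [mon_one, pow_zero] at this
  rw [this]; simp [eq_comm]

theorem exists_mem_degLT (p : SkewPoly σ) : ∃ N, p ∈ degLT σ N := by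
  obtain ⟨N, hN⟩ := (SkewPolynomial.support p).bddAbove
  refine ⟨N + 1, fun i hi => ?_⟩
  by_contra h
  have := hN (Finset.mem_coe.mpr (SkewPolynomial.mem_support_iff.mpr h))
  omega

theorem degLT_mono {M N : ℕ} (h : M ≤ N) : degLT σ M ≤ degLT σ N :=
  fun _ hp i hi => hp i (h.trans hi)

theorem eq_zero_of_mem_degLT_zero {p : SkewPoly σ} (h : p ∈ degLT σ 0) : p = 0 :=
  coeff_ext fun i => h i (Nat.zero_le i)

theorem exists_hasDegree {p : SkewPoly σ} (hp : p ≠ 0) : ∃ m, HasDegree p m := by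
  classical
  have hex := exists_mem_degLT p
  have hpos : Nat.find hex ≠ 0 := fun h0 =>
    hp (eq_zero_of_mem_degLT_zero (h0 ▸ Nat.find_spec hex))
  obtain ⟨m, hm⟩ := Nat.exists_eq_succ_of_ne_zero hpos
  have hspec := Nat.find_spec hex
  rw [hm] at hspec
  refine ⟨m, fun h0 => Nat.find_min hex (m := m) (by omega) fun i hi => ?_, fun i hi => hspec i hi⟩
  rcases hi.eq_or_lt with rfl | hi
  · exact h0
  · exact hspec i hi

theorem HasDegree.ne_zero {p : SkewPoly σ} {m : ℕ} (h : HasDegree p m) : p ≠ 0 := by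
  rintro rfl
  exact h.1 rfl

theorem HasDegree.lt_of_mem {p : SkewPoly σ} {m N : ℕ} (h : HasDegree p m) (hN : p ∈ degLT σ N) :
    m < N := by
  by_contra hc
  exact h.1 (hN m (by omega))

theorem coeff_mul_add {p q : SkewPoly σ} {m l : ℕ} (hp : ∀ i, m < i → coeff p i = 0)
    (hq : ∀ i, l < i → coeff q i = 0) :
    coeff (p * q) (m + l) = coeff p m * (σ ^ m) (coeff q l) := by
  rw [coeff_mul, Finset.sum_eq_single_of_mem m (by simp)]
  · simp
  · intro i hi him
    rcases lt_or_gt_of_ne him with h | h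
    · rw [hq _ (by omega)]; simp
    · rw [hp i h, zero_mul]

theorem coeff_mul_eq_zero {p q : SkewPoly σ} {m l k : ℕ} (hp : ∀ i, m < i → coeff p i = 0)
    (hq : ∀ i, l < i → coeff q i = 0) (hk : m + l < k) : coeff (p * q) k = 0 := by
  rw [coeff_mul]
  refine Finset.sum_eq_zero fun i _ => ?_
  rcases le_or_gt i m with h | h
  · rw [hq _ (by omega)]; simp
  · rw [hp i h, zero_mul]

theorem HasDegree.mul {p q : SkewPoly σ} {m l : ℕ} (hp : HasDegree p m) (hq : HasDegree q l) :
    HasDegree (p * q) (m + l) := by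
  refine ⟨?_, fun i hi => coeff_mul_eq_zero hp.2 hq.2 hi⟩
  rw [coeff_mul_add hp.2 hq.2]
  exact mul_ne_zero hp.1 ((_root_.map_ne_zero _).mpr hq.1)

instance : NoZeroDivisors (SkewPoly σ) where
  eq_zero_or_eq_zero_of_mul_eq_zero {p q} h := by
    by_contra hc
    push Not at hc
    obtain ⟨m, hm⟩ := exists_hasDegree hc.1
    obtain ⟨l, hl⟩ := exists_hasDegree hc.2
    exact (hm.mul hl).ne_zero h

theorem mul_eq_zero_of_mem_degLT {f c : SkewPoly σ} {s : ℕ} (hf : HasDegree f s)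
    (h : c * f ∈ degLT σ s) : c = 0 := by
  by_contra hc
  obtain ⟨m, hm⟩ := exists_hasDegree hc
  have := (hm.mul hf).lt_of_mem h
  omega

theorem eq_zero_of_mem_span {f p : SkewPoly σ} {s : ℕ} (hf : HasDegree f s)
    (hp : p ∈ degLT σ s) (h : p ∈ Ideal.span {f}) : p = 0 := by
  obtain ⟨c, rfl⟩ := Ideal.mem_span_singleton'.mp h
  rw [mul_eq_zero_of_mem_degLT hf hp, zero_mul]

theorem const_mul (a b : L) : const σ (a * b) = const σ a * const σ b :=
  SkewPolynomial.C_mul (R := Twist σ)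

theorem const_one : const σ (1 : L) = 1 := rfl

theorem isUnit_const {a : L} (ha : a ≠ 0) : IsUnit (const σ a) :=
  ⟨⟨const σ a, const σ a⁻¹, by rw [← const_mul, mul_inv_cancel₀ ha, const_one],
    by rw [← const_mul, inv_mul_cancel₀ ha, const_one]⟩, rfl⟩

theorem eq_const_of_mem_degLT_one {p : SkewPoly σ} (h : p ∈ degLT σ 1) :
    p = const σ (coeff p 0) := by
  refine coeff_ext fun i => ?_
  rw [← mon_zero, coeff_mon]
  split_ifs with hi
  · rw [hi]
  · exact h i (by omega)

theorem HasDegree.isUnit {p : SkewPoly σ} (h : HasDegree p 0) : IsUnit p := by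
  rw [eq_const_of_mem_degLT_one (p := p) fun i hi => h.2 i hi]
  exact isUnit_const h.1

theorem HasDegree.eq_zero_of_isUnit {p : SkewPoly σ} {m : ℕ} (h : HasDegree p m)
    (hu : IsUnit p) : m = 0 := by
  obtain ⟨q, hq⟩ := hu.exists_right_inv
  have hq0 : q ≠ 0 := by
    rintro rfl
    rw [mul_zero] at hq
    have := congrArg (fun r => coeff r 0) hq
    simp [coeff_one] at this
  obtain ⟨l, hl⟩ := exists_hasDegree hq0
  have h1 := (h.mul hl).1
  rw [hq, coeff_one] at h1
  by_contra hm
  exact h1 (if_neg (by omega))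

/-- The skew polynomial `∑ i < N, v i x ^ i`. -/
def ofVec (σ : L ≃ₐ[K] L) (N : ℕ) : (Fin N → L) →ₗ[K] SkewPoly σ :=
  ∑ i : Fin N, mon σ i ∘ₗ LinearMap.proj i

theorem coeff_ofVec {N : ℕ} (v : Fin N → L) (i : ℕ) :
    coeff (ofVec σ N v) i = if h : i < N then v ⟨i, h⟩ else 0 := by
  simp only [ofVec, LinearMap.sum_apply, LinearMap.comp_apply, LinearMap.proj_apply, coeff_sum,
    coeff_mon]
  split_ifs with h
  · rw [Finset.sum_eq_single_of_mem ⟨i, h⟩ (Finset.mem_univ _)]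
    · simp
    · intro j _ hj
      rw [if_neg]
      rintro rfl
      exact hj rfl
  · refine Finset.sum_eq_zero fun j _ => if_neg ?_
    have := j.2
    omega

theorem ofVec_mem {N : ℕ} (v : Fin N → L) : ofVec σ N v ∈ degLT σ N := fun i hi => by
  rw [coeff_ofVec, dif_neg (by omega)]

theorem ofVec_injective (N : ℕ) : Function.Injective (ofVec σ N) := by
  intro v w h
  funext i
  have := congrArg (fun p => coeff p i) h
  simpa [coeff_ofVec] using this

theorem ofVec_coeff {N : ℕ} {p : SkewPoly σ} (hp : p ∈ degLT σ N) :
    ofVec σ N (fun i => coeff p i) = p := by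
  refine coeff_ext fun i => ?_
  rw [coeff_ofVec]
  split_ifs with h
  · rfl
  · exact (hp i (by omega)).symm

theorem eq_sum_mon {N : ℕ} {p : SkewPoly σ} (hp : p ∈ degLT σ N) :
    p = ∑ i ∈ Finset.range N, mon σ i (coeff p i) := by
  refine coeff_ext fun i => ?_
  simp only [coeff_sum, coeff_mon]
  rw [Finset.sum_ite_eq']
  split_ifs with h
  · rfl
  · exact hp i (by simpa using h)

end SkewPolyBasic

/-! ### The universal property, and division -/

section Lift

variable {K L : Type*} [Field K] [Field L] [Algebra K L] {σ : L ≃ₐ[K] L}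
variable {B : Type*} [Ring B] [Algebra K B]

/-- The commutation rule for `x` propagates to `x ^ m`; this is the compatibility that the universal
property of a skew monoid algebra asks for. -/
theorem pow_mul_semilinear (f : L →ₐ[K] B) (t : B) (h : ∀ a, t * f a = f (σ a) * t) (m : ℕ)
    (a : L) : f ((σ ^ m) a) * t ^ m = t ^ m * f a := by
  induction m with
  | zero => simp
  | succ m ih =>
    rw [pow_succ' t, mul_assoc, ← ih, ← mul_assoc, ← mul_assoc, h, pow_succ' σ]
    rfl

/-- The universal property of `L[x;σ]`. -/
def skewLift (f : L →ₐ[K] B) (t : B) (h : ∀ a, t * f a = f (σ a) * t) : SkewPoly σ →ₐ[K] B :=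
  SkewMonoidAlgebra.liftNCAlgHom (A := Twist σ) (G := Multiplicative ℕ)
    (show Twist σ →ₐ[K] B from f) (powersHom B t) (by
      intro x y
      exact pow_mul_semilinear f t h (Multiplicative.toAdd y) x)

variable {f : L →ₐ[K] B} {t : B} {h : ∀ a, t * f a = f (σ a) * t}

theorem skewLift_mon (m : ℕ) (a : L) : skewLift f t h (mon σ m a) = f a * t ^ m :=
  SkewMonoidAlgebra.liftNC_single (k := Twist σ) (G := Multiplicative ℕ)
    (show Twist σ →+ B from f.toRingHom.toAddMonoidHom) (powersHom B t) (Multiplicative.ofAdd m) a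

theorem skewLift_X : skewLift f t h SkewPolynomial.X = t := by
  rw [← pow_one SkewPolynomial.X, ← mon_one, skewLift_mon]; simp

theorem skewLift_eq_sum {N : ℕ} {p : SkewPoly σ} (hp : p ∈ degLT σ N) :
    skewLift f t h p = ∑ i ∈ Finset.range N, f (coeff p i) * t ^ i := by
  conv_lhs => rw [eq_sum_mon hp]
  rw [map_sum]
  simp only [skewLift_mon]

end Lift

/-! ### The fixed field, and the central polynomials `F(x ^ n)` -/

section FixedField

variable {K L : Type*} [Field K] [Field L] [Algebra K L] {σ : L ≃ₐ[K] L}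

/-- The hypothesis `hfix` is exactly Artin's setting for the cyclic group generated by `σ`: from it
come `[L : K] = n` and the norm as a product of conjugates. -/
theorem isGaloisGroup_zpowers (hfix : ∀ a : L, σ a = a ↔ a ∈ Set.range (algebraMap K L)) :
    IsGaloisGroup (Subgroup.zpowers σ) K L where
  faithful := inferInstance
  commutes := inferInstance
  isInvariant := ⟨fun a h => (hfix a).mp (h ⟨σ, Subgroup.mem_zpowers σ⟩)⟩

theorem finite_zpowers (hpos : 0 < orderOf σ) : Finite (Subgroup.zpowers σ) :=
  Nat.finite_of_card_ne_zero (by rw [Nat.card_zpowers]; exact hpos.ne')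

theorem finiteDimensional_of_fixed
    (hfix : ∀ a : L, σ a = a ↔ a ∈ Set.range (algebraMap K L)) (hpos : 0 < orderOf σ) :
    FiniteDimensional K L :=
  have := isGaloisGroup_zpowers hfix
  have := finite_zpowers hpos
  IsGaloisGroup.finiteDimensional (Subgroup.zpowers σ) K L

theorem finrank_of_fixed (hfix : ∀ a : L, σ a = a ↔ a ∈ Set.range (algebraMap K L)) :
    Module.finrank K L = orderOf σ := by
  have := isGaloisGroup_zpowers hfix
  rw [← IsGaloisGroup.card_eq_finrank (Subgroup.zpowers σ) K L, Nat.card_zpowers]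

theorem algebraMap_norm_eq_prod
    (hfix : ∀ a : L, σ a = a ↔ a ∈ Set.range (algebraMap K L)) (hpos : 0 < orderOf σ) (a : L) :
    algebraMap K L (Algebra.norm K a) = ∏ i : Fin (orderOf σ), (σ ^ (i : ℕ)) a := by
  have := isGaloisGroup_zpowers hfix
  have := finite_zpowers hpos
  have := finiteDimensional_of_fixed hfix hpos
  have : IsGalois K L := IsGaloisGroup.isGalois (Subgroup.zpowers σ) K L
  classical
  rw [Algebra.norm_eq_prod_automorphisms]
  refine (Function.Bijective.prod_comp (e := fun i : Fin (orderOf σ) => σ ^ (i : ℕ)) ?_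
    (fun g : L ≃ₐ[K] L => g a)).symm
  rw [Fintype.bijective_iff_injective_and_card]
  refine ⟨fun i j h => Fin.ext (pow_injOn_Iio_orderOf i.2 j.2 h), ?_⟩
  rw [Fintype.card_fin, ← Nat.card_eq_fintype_card, IsGalois.card_aut_eq_finrank,
    finrank_of_fixed hfix]

/-- Galois descent for polynomials, used both for the reduced norm and for products of conjugate
factors. -/
theorem map_mem_range_of_forall_coeff
    (hfix : ∀ a : L, σ a = a ↔ a ∈ Set.range (algebraMap K L)) {p : L[X]}
    (h : p.map (σ : L →+* L) = p) : ∃ q : K[X], q.map (algebraMap K L) = p := by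
  have : p ∈ Polynomial.lifts (algebraMap K L) := by
    rw [Polynomial.lifts_iff_coeff_lifts]
    intro i
    rw [← hfix]
    have := congrArg (fun r => r.coeff i) h
    rwa [Polynomial.coeff_map] at this
  obtain ⟨q, hq⟩ := this
  exact ⟨q, hq⟩

end FixedField

/-! ### Central polynomials in `x ^ n` and coordinates on the quotients -/

section Central

variable {K L : Type*} [Field K] [Field L] [Algebra K L] {σ : L ≃ₐ[K] L}

theorem algebraMap_eq_const (t : K) :
    algebraMap K (SkewPoly σ) t = const σ (algebraMap K L t) := by
  rw [Algebra.algebraMap_eq_smul_one, ← const_one, ← mon_zero, ← map_smul,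
    Algebra.algebraMap_eq_smul_one, mon_zero]

theorem evalXPow_monomial (m : ℕ) (t : K) :
    evalXPow σ (monomial m t) = mon σ (orderOf σ * m) (algebraMap K L t) := by
  rw [evalXPow, aeval_monomial, ← pow_mul, algebraMap_eq_const, const_mul_X_pow]

theorem coeff_evalXPow (hpos : 0 < orderOf σ) (F : K[X]) (i : ℕ) :
    coeff (evalXPow σ F) i =
      if orderOf σ ∣ i then algebraMap K L (F.coeff (i / orderOf σ)) else 0 := by
  induction F using Polynomial.induction_on' with
  | add p q hp hq =>
    have : evalXPow σ (p + q) = evalXPow σ p + evalXPow σ q := map_add _ _ _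
    rw [this, coeff_add, hp, hq]
    split_ifs <;> simp
  | monomial m t =>
    rw [evalXPow_monomial, coeff_mon, Polynomial.coeff_monomial]
    by_cases h : orderOf σ ∣ i
    · obtain ⟨j, rfl⟩ := h
      simp only [mul_eq_mul_left_iff, hpos.ne', or_false, dvd_mul_right, if_true,
        Nat.mul_div_cancel_left _ hpos]
      split_ifs <;> simp
    · rw [if_neg h, if_neg]
      rintro rfl
      exact h (dvd_mul_right _ _)

theorem coeff_evalXPow_zero (hpos : 0 < orderOf σ) (F : K[X]) :
    coeff (evalXPow σ F) 0 = algebraMap K L (F.coeff 0) := by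
  rw [coeff_evalXPow hpos]; simp

theorem coeff_evalXPow_mul (hpos : 0 < orderOf σ) (F : K[X]) (i : ℕ) :
    coeff (evalXPow σ F) (orderOf σ * i) = algebraMap K L (F.coeff i) := by
  rw [coeff_evalXPow hpos]; simp [hpos]

theorem coeff_evalXPow_eq_zero (hpos : 0 < orderOf σ) (F : K[X]) {i : ℕ}
    (hi : orderOf σ * F.natDegree < i) : coeff (evalXPow σ F) i = 0 := by
  rw [coeff_evalXPow hpos]
  split_ifs with h
  · obtain ⟨j, rfl⟩ := h
    rw [Nat.mul_div_cancel_left _ hpos, coeff_eq_zero_of_natDegree_lt, map_zero]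
    exact lt_of_mul_lt_mul_left hi (Nat.zero_le _)
  · rfl

theorem hasDegree_evalXPow (hpos : 0 < orderOf σ) {F : K[X]} (hF : F ≠ 0) :
    HasDegree (evalXPow σ F) (orderOf σ * F.natDegree) := by
  refine ⟨?_, fun i hi => coeff_evalXPow_eq_zero hpos F hi⟩
  rw [coeff_evalXPow_mul hpos]
  simpa using hF

theorem evalXPow_comm (F : K[X]) (p : SkewPoly σ) : evalXPow σ F * p = p * evalXPow σ F :=
  (Subalgebra.mem_center_iff.mp (evalXPow_mem_center σ F) p).symm

theorem evalXPow_mul (F G : K[X]) : evalXPow σ (F * G) = evalXPow σ F * evalXPow σ G :=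
  map_mul _ _ _

theorem evalXPow_ne_zero (hpos : 0 < orderOf σ) {F : K[X]} (hF : F ≠ 0) : evalXPow σ F ≠ 0 :=
  (hasDegree_evalXPow hpos hF).ne_zero

/-- The projection `R → R_F` as a `K`-algebra homomorphism. -/
def mkₐ (σ : L ≃ₐ[K] L) (F : K[X]) : SkewPoly σ →ₐ[K] RF σ F :=
  Ideal.Quotient.mkₐ K (centralIdeal σ F)

theorem mkₐ_apply (F : K[X]) (a : SkewPoly σ) : mkₐ σ F a = mk σ F a := rfl

theorem mk_surjective (F : K[X]) : Function.Surjective (mk σ F) :=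
  Ideal.Quotient.mk_surjective

theorem mk_eq_zero_iff {F : K[X]} {a : SkewPoly σ} :
    mk σ F a = 0 ↔ a ∈ Ideal.span {evalXPow σ F} :=
  Ideal.Quotient.eq_zero_iff_mem

theorem mk_eq_zero_iff' {F : K[X]} {a : SkewPoly σ} :
    mk σ F a = 0 ↔ ∃ c, a = c * evalXPow σ F := by
  rw [mk_eq_zero_iff, Ideal.mem_span_singleton']
  exact ⟨fun ⟨c, h⟩ => ⟨c, h.symm⟩, fun ⟨c, h⟩ => ⟨c, h.symm⟩⟩

/-- `F(x ^ n)` has degree `n s`, so division with remainder picks a unique representative of degree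
less than `n s` in each class. -/
theorem mk_ofVec_bijective (hpos : 0 < orderOf σ) {F : K[X]} (hF : F ≠ 0) :
    Function.Bijective (mkₐ σ F ∘ ofVec σ (orderOf σ * F.natDegree)) := by
  constructor
  · intro v w h
    have h1 : mk σ F (ofVec σ _ (v - w)) = 0 := by
      rw [map_sub]
      exact (map_sub (mkₐ σ F) _ _).trans (sub_eq_zero.mpr h)
    have h2 := eq_zero_of_mem_span (hasDegree_evalXPow hpos hF) (ofVec_mem _)
      (mk_eq_zero_iff.mp h1)
    exact sub_eq_zero.mp (ofVec_injective _ (h2.trans (map_zero _).symm))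
  · intro u
    obtain ⟨p, rfl⟩ := mk_surjective F u
    obtain ⟨r, hr⟩ := exists_remainder (hasDegree_evalXPow hpos hF) p
    refine ⟨fun i => coeff r.1 i, ?_⟩
    rw [Function.comp_apply, ofVec_coeff r.2]
    have : mk σ F (p - r) = 0 := mk_eq_zero_iff.mpr hr
    exact (sub_eq_zero.mp ((map_sub (mkₐ σ F) _ _).symm.trans this)).symm

/-- Coordinates on `R_F`. -/
def vecEquivRF (hpos : 0 < orderOf σ) {F : K[X]} (hF : F ≠ 0) :
    (Fin (orderOf σ * F.natDegree) → L) ≃ₗ[K] RF σ F :=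
  LinearEquiv.ofBijective ((mkₐ σ F).toLinearMap ∘ₗ ofVec σ _) (mk_ofVec_bijective hpos hF)

theorem finrank_RF (hfix : ∀ a : L, σ a = a ↔ a ∈ Set.range (algebraMap K L))
    (hpos : 0 < orderOf σ) {F : K[X]} (hF : F ≠ 0) :
    Module.finrank K (RF σ F) = orderOf σ * orderOf σ * F.natDegree := by
  have := finiteDimensional_of_fixed hfix hpos
  rw [← (vecEquivRF hpos hF).finrank_eq, Module.finrank_pi_fintype]
  simp [finrank_of_fixed hfix]
  ring

theorem finiteDimensional_RF (hfix : ∀ a : L, σ a = a ↔ a ∈ Set.range (algebraMap K L))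
    (hpos : 0 < orderOf σ) {F : K[X]} (hF : F ≠ 0) : FiniteDimensional K (RF σ F) :=
  have := finiteDimensional_of_fixed hfix hpos
  (vecEquivRF hpos hF).finiteDimensional

/-- The quotient `R / R f` has coordinates given by remainders. -/
def vecEquivQuot {f : SkewPoly σ} {s : ℕ} (hf : HasDegree f s) :
    (Fin s → L) ≃ₗ[K] SkewPoly σ ⧸ Submodule.span (SkewPoly σ) {f} :=
  LinearEquiv.ofBijective
    (((Submodule.span (SkewPoly σ) {f}).mkQ.restrictScalars K) ∘ₗ ofVec σ s) (by
      constructor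
      · rw [← LinearMap.ker_eq_bot, LinearMap.ker_eq_bot']
        intro v hv
        have h1 : ofVec σ s v ∈ Ideal.span {f} := (Submodule.Quotient.mk_eq_zero _).mp hv
        exact ofVec_injective _ ((eq_zero_of_mem_span hf (ofVec_mem v) h1).trans (map_zero _).symm)
      · intro u
        obtain ⟨p, rfl⟩ := Submodule.mkQ_surjective _ u
        obtain ⟨r, hr⟩ := exists_remainder hf p
        refine ⟨fun i => coeff r.1 i, ?_⟩
        rw [LinearMap.comp_apply, ofVec_coeff r.2]
        exact ((Submodule.Quotient.eq _).mpr hr).symm)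

end Central

/-! ### The reduced norm -/

section ReducedNorm

variable {K L : Type*} [Field K] [Field L] [Algebra K L] {σ : L ≃ₐ[K] L}

/-- The matrix of `x` in the regular representation of `L[x;σ]` over `L[y]`, where `y = x ^ n`. -/
def shiftMatrix (n : ℕ) (L : Type*) [Field L] : Matrix (Fin n) (Fin n) L[X] :=
  Matrix.of fun i l => if (i + 1 : ℕ) % n = l then X ^ ((i + 1 : ℕ) / n) else 0

/-- Multiplying by `x ^ m` moves the basis index from `i` to `i + m`; each passage beyond `n` is
absorbed into one factor `y = x ^ n`. -/
theorem shiftMatrix_pow (n m : ℕ) (i l : Fin n) :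
    (shiftMatrix n L ^ m) i l =
      if (i + m : ℕ) % n = l then (X : L[X]) ^ ((i + m : ℕ) / n) else 0 := by
  have hn : 0 < n := i.pos
  induction m generalizing l with
  | zero =>
    rw [pow_zero, Matrix.one_apply, add_zero, Nat.mod_eq_of_lt i.2, Nat.div_eq_of_lt i.2, pow_zero]
    simp [Fin.ext_iff]
  | succ m ih =>
    rw [pow_succ, Matrix.mul_apply,
      Finset.sum_eq_single_of_mem ⟨(i + m : ℕ) % n, Nat.mod_lt _ hn⟩ (Finset.mem_univ _)]
    · rw [ih]
      simp only [if_true, shiftMatrix, Matrix.of_apply]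
      have h1 : ((i + m : ℕ) % n + 1) % n = (i + (m + 1) : ℕ) % n := by
        rw [Nat.mod_add_mod, add_assoc]
      have h2 : (i + m : ℕ) / n + ((i + m : ℕ) % n + 1) / n = (i + (m + 1) : ℕ) / n := by
        conv_rhs => rw [← add_assoc, ← Nat.div_add_mod (i + m : ℕ) n, add_assoc,
          Nat.mul_add_div hn]
      rw [h1, mul_ite, mul_zero, ← pow_add, h2]
    · intro k _ hk
      rw [ih, if_neg, zero_mul]
      intro h
      exact hk (Fin.ext h.symm)

theorem shiftMatrix_pow_self (n : ℕ) :
    shiftMatrix n L ^ n = algebraMap L[X] (Matrix (Fin n) (Fin n) L[X]) X := by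
  ext1 i l
  rw [shiftMatrix_pow, Nat.add_mod_right, Nat.mod_eq_of_lt i.2, Nat.add_div_right _ i.pos,
    Nat.div_eq_of_lt i.2, Matrix.algebraMap_matrix_apply]
  simp [Fin.ext_iff]

/-- The diagonal matrix with entries `a, σ a, σ ^ 2 a, …`. -/
def diagMatrix (σ : L ≃ₐ[K] L) : L →ₐ[K] Matrix (Fin (orderOf σ)) (Fin (orderOf σ)) L[X] :=
  (Matrix.diagonalAlgHom K).comp (AlgHom.pi fun i =>
    (CAlgHom (R := K) (A := L)).comp ((σ ^ (i : ℕ) : L ≃ₐ[K] L) : L →ₐ[K] L))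

theorem diagMatrix_apply (a : L) :
    diagMatrix σ a = Matrix.diagonal fun i : Fin (orderOf σ) => (C ((σ ^ (i : ℕ)) a) : L[X]) :=
  rfl

theorem shiftMatrix_mul_diagMatrix (a : L) :
    shiftMatrix (orderOf σ) L * diagMatrix σ a =
      diagMatrix σ (σ a) * shiftMatrix (orderOf σ) L := by
  ext1 i l
  rw [diagMatrix_apply, diagMatrix_apply, Matrix.mul_diagonal, Matrix.diagonal_mul]
  simp only [shiftMatrix, Matrix.of_apply]
  split_ifs with h
  · rw [← h, pow_mod_orderOf, mul_comm, pow_succ]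
    rfl
  · simp

/-- The regular representation of `L[x;σ]` over `L[y]`, where `y = x ^ n`. -/
def regRep (σ : L ≃ₐ[K] L) : SkewPoly σ →ₐ[K] Matrix (Fin (orderOf σ)) (Fin (orderOf σ)) L[X] :=
  skewLift (diagMatrix σ) (shiftMatrix (orderOf σ) L) shiftMatrix_mul_diagMatrix

theorem regRep_evalXPow (F : K[X]) :
    regRep σ (evalXPow σ F) = algebraMap L[X] _ (F.map (algebraMap K L)) := by
  rw [evalXPow, ← aeval_algHom_apply, map_pow, regRep, skewLift_X, shiftMatrix_pow_self]
  have : algebraMap L[X] (Matrix (Fin (orderOf σ)) (Fin (orderOf σ)) L[X]) X =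
      (IsScalarTower.toAlgHom K L[X] (Matrix (Fin (orderOf σ)) (Fin (orderOf σ)) L[X])) X := rfl
  rw [this, aeval_algHom_apply]
  change algebraMap L[X] _ _ = _
  rfl

theorem regRep_apply {N : ℕ} {p : SkewPoly σ} (hp : p ∈ degLT σ N) (i l : Fin (orderOf σ)) :
    regRep σ p i l = ∑ j ∈ Finset.range N, C ((σ ^ (i : ℕ)) (coeff p j)) *
      if (i + j : ℕ) % orderOf σ = l then (X : L[X]) ^ ((i + j : ℕ) / orderOf σ) else 0 := by
  rw [regRep, skewLift_eq_sum hp, Matrix.sum_apply]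
  refine Finset.sum_congr rfl fun j _ => ?_
  rw [diagMatrix_apply, Matrix.diagonal_mul, shiftMatrix_pow]

/-- The `n`-th power of the matrix is the scalar `y`, of determinant `y ^ n ≠ 0`; hence the matrix
can be cancelled from determinant identities. -/
theorem det_shiftMatrix_ne_zero (n : ℕ) : (shiftMatrix n L).det ≠ 0 := by
  intro h
  have h1 := congrArg Matrix.det (shiftMatrix_pow_self (L := L) n)
  rcases n.eq_zero_or_pos with rfl | hn
  · simp at h
  · rw [Matrix.det_pow, h, zero_pow hn.ne', Algebra.algebraMap_eq_smul_one, Matrix.det_smul,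
      Matrix.det_one, mul_one, Fintype.card_fin] at h1
    exact pow_ne_zero _ X_ne_zero h1.symm

/-- Conjugation by `x` acts as `σ` on constants, and the shift matrix has entries fixed by `σ`; so
applying `σ` to the entries amounts to conjugating by the shift matrix. -/
theorem shiftMatrix_mul_regRep (p : SkewPoly σ) :
    shiftMatrix (orderOf σ) L * regRep σ p =
      (regRep σ p).map (Polynomial.map (σ : L →+* L)) * shiftMatrix (orderOf σ) L := by
  have hS : ∀ m, ((shiftMatrix (orderOf σ) L) ^ m).map (Polynomial.map (σ : L →+* L)) =
      shiftMatrix (orderOf σ) L ^ m := by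
    intro m
    ext1 i l
    rw [Matrix.map_apply, shiftMatrix_pow]
    split_ifs <;> simp
  induction p using skew_induction with
  | hm m a =>
    have hmul : (diagMatrix σ a * shiftMatrix (orderOf σ) L ^ m).map
        (Polynomial.map (σ : L →+* L)) =
        (diagMatrix σ a).map (Polynomial.map (σ : L →+* L)) *
          ((shiftMatrix (orderOf σ) L) ^ m).map (Polynomial.map (σ : L →+* L)) :=
      Matrix.map_mul (f := Polynomial.mapRingHom (σ : L →+* L))
    have hd : (diagMatrix σ a).map (Polynomial.map (σ : L →+* L)) = diagMatrix σ (σ a) := by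
      rw [diagMatrix_apply, diagMatrix_apply, Matrix.diagonal_map (Polynomial.map_zero _)]
      congr 1
      funext i
      rw [Polynomial.map_C]
      congr 1
      change σ ((σ ^ (i : ℕ)) a) = (σ ^ (i : ℕ)) (σ a)
      rw [← AlgEquiv.mul_apply, ← AlgEquiv.mul_apply, ← pow_succ, ← pow_succ']
    rw [regRep, skewLift_mon, hmul, hS, hd, ← mul_assoc, shiftMatrix_mul_diagMatrix, mul_assoc,
      mul_assoc, ← pow_succ, ← pow_succ']
  | hadd p q hp hq =>
    have : (regRep σ p + regRep σ q).map (Polynomial.map (σ : L →+* L)) =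
        (regRep σ p).map (Polynomial.map (σ : L →+* L)) +
          (regRep σ q).map (Polynomial.map (σ : L →+* L)) :=
      Matrix.map_add _ (fun _ _ => Polynomial.map_add _) _ _
    rw [map_add, mul_add, hp, hq, this, add_mul]

/-- By `shiftMatrix_mul_regRep` the determinant is unchanged when `σ` is applied to its
coefficients, so it descends to `K`. -/
theorem exists_map_eq_det_regRep
    (hfix : ∀ a : L, σ a = a ↔ a ∈ Set.range (algebraMap K L)) (p : SkewPoly σ) :
    ∃ q : K[X], q.map (algebraMap K L) = (regRep σ p).det := by
  refine map_mem_range_of_forall_coeff hfix ?_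
  have h := congrArg Matrix.det (shiftMatrix_mul_regRep p)
  rw [Matrix.det_mul, Matrix.det_mul, mul_comm] at h
  have h2 := mul_right_cancel₀ (det_shiftMatrix_ne_zero _) h
  have h3 : (regRep σ p).det.map (σ : L →+* L) =
      ((regRep σ p).map (Polynomial.map (σ : L →+* L))).det :=
    RingHom.map_det (Polynomial.mapRingHom (σ : L →+* L)) (regRep σ p)
  rw [h3, ← h2]

/-- The reduced norm of `L[x;σ]` over its center `K[y]`, `y = x ^ n`. -/
def redNorm (hfix : ∀ a : L, σ a = a ↔ a ∈ Set.range (algebraMap K L)) (p : SkewPoly σ) : K[X] :=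
  (exists_map_eq_det_regRep hfix p).choose

theorem map_redNorm (hfix : ∀ a : L, σ a = a ↔ a ∈ Set.range (algebraMap K L)) (p : SkewPoly σ) :
    (redNorm hfix p).map (algebraMap K L) = (regRep σ p).det :=
  (exists_map_eq_det_regRep hfix p).choose_spec

theorem coeff_det_of_natDegree_le {R : Type*} [CommRing R] {n : ℕ} (M : Matrix (Fin n) (Fin n) R[X])
    (m : ℕ) (h : ∀ i j, (M i j).natDegree ≤ m) :
    M.det.natDegree ≤ n * m ∧ M.det.coeff (n * m) = (M.map fun p => p.coeff m).det := by
  constructor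
  · rw [Matrix.det_apply]
    refine natDegree_sum_le_of_forall_le _ _ fun π _ => (natDegree_smul_le _ _).trans ?_
    refine (natDegree_prod_le _ _).trans ((Finset.sum_le_card_nsmul _ _ m fun i _ => h _ _).trans ?_)
    simp
  · rw [Matrix.det_apply, Matrix.det_apply, finsetSum_coeff]
    refine Finset.sum_congr rfl fun π _ => ?_
    rw [Polynomial.coeff_smul]
    congr 1
    have := coeff_prod_of_natDegree_le (s := Finset.univ) (fun i => M (π i) i) m
      (fun i _ => h _ _)
    rw [Finset.card_univ, Fintype.card_fin] at this
    exact this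

/-- The matrix `∑ a_j diag(σ ^ i) P ^ j z ^ j`, conjugate to the regular representation
over `z ^ n = y`. -/
def homogRep (p : SkewPoly σ) (N : ℕ) : Matrix (Fin (orderOf σ)) (Fin (orderOf σ)) L[X] :=
  Matrix.of fun i l => ∑ j ∈ Finset.range N, C ((σ ^ (i : ℕ)) (coeff p j)) *
    if (i + j : ℕ) % orderOf σ = l then (X : L[X]) ^ j else 0

/-- Put `y = z ^ n` and conjugate by `diag(z ^ i)`: the carries disappear and the term `a_j x ^ j`
contributes exactly `z ^ j`. All entries then have degree at most `deg a`, so the extreme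
coefficients of the determinant can be read off entrywise. -/
theorem det_homogRep {N : ℕ} {p : SkewPoly σ} (hp : p ∈ degLT σ N) :
    (homogRep p N).det = expand L (orderOf σ) (regRep σ p).det := by
  set T : Matrix (Fin (orderOf σ)) (Fin (orderOf σ)) L[X] :=
    Matrix.diagonal fun i => (X : L[X]) ^ (i : ℕ) with hT
  have hmul : T * homogRep p N = (regRep σ p).map (expand L (orderOf σ)) * T := by
    ext1 i l
    rw [hT, Matrix.mul_diagonal, Matrix.diagonal_mul, Matrix.map_apply, regRep_apply hp, map_sum,
      Finset.sum_mul, homogRep, Matrix.of_apply, Finset.mul_sum]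
    refine Finset.sum_congr rfl fun j _ => ?_
    rw [map_mul, expand_C]
    split_ifs with h
    · rw [map_pow, expand_X, mul_left_comm, mul_assoc]
      congr 1
      rw [← pow_mul, ← pow_add, ← pow_add, ← h, Nat.div_add_mod]
    · simp
  have h := congrArg Matrix.det hmul
  have hdet : T.det ≠ 0 := by
    rw [hT, Matrix.det_diagonal]
    exact Finset.prod_ne_zero_iff.mpr fun i _ => pow_ne_zero _ X_ne_zero
  have h3 : expand L (orderOf σ) (regRep σ p).det =
      ((regRep σ p).map (expand L (orderOf σ))).det :=
    AlgHom.map_det (expand L (orderOf σ)) (regRep σ p)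
  rw [Matrix.det_mul, Matrix.det_mul, mul_comm, ← h3] at h
  exact mul_right_cancel₀ hdet h

/-- The cyclic permutation matrix. -/
def cyclicMatrix (n : ℕ) (L : Type*) [Field L] : Matrix (Fin n) (Fin n) L :=
  Matrix.of fun i l => if (i + 1 : ℕ) % n = l then 1 else 0

theorem cyclicMatrix_pow (n m : ℕ) (i l : Fin n) :
    (cyclicMatrix n L ^ m) i l = if (i + m : ℕ) % n = l then 1 else 0 := by
  have h : cyclicMatrix n L = (evalRingHom (1 : L)).mapMatrix (shiftMatrix n L) := by
    ext1 i l
    simp only [cyclicMatrix, shiftMatrix, Matrix.of_apply, RingHom.mapMatrix_apply,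
      Matrix.map_apply]
    split_ifs <;> simp
  rw [h, ← map_pow, RingHom.mapMatrix_apply, Matrix.map_apply, shiftMatrix_pow]
  split_ifs <;> simp

/-- An `n`-cycle has sign `(-1) ^ (n - 1)`; this is the origin of the sign in the norm condition. -/
theorem det_cyclicMatrix (n : ℕ) : (cyclicMatrix n L).det = (-1) ^ (n - 1) := by
  have h : cyclicMatrix n L = (finRotate n).permMatrix L := by
    ext1 i l
    rcases n with _ | n
    · exact i.elim0
    · have : ((finRotate (n + 1) i : Fin (n + 1)) : ℕ) = (i + 1 : ℕ) % (n + 1) := by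
        rw [finRotate_apply, Fin.val_add]
        simp
      rw [cyclicMatrix, Matrix.of_apply, Equiv.Perm.permMatrix, Equiv.toPEquiv,
        PEquiv.toMatrix_apply]
      simp [Fin.ext_iff, Fin.val_add]
  rw [h, Matrix.det_permutation, sign_finRotate]
  simp

/-- In `homogRep` the coefficient of `z ^ m` is `diag(σ ^ i a_m) P ^ m` with `P` the cyclic
permutation matrix; its determinant is the coefficient of `z ^ (n m) = y ^ m`. -/
theorem redNorm_natDegree_le_and_coeff
    (hfix : ∀ a : L, σ a = a ↔ a ∈ Set.range (algebraMap K L)) (hpos : 0 < orderOf σ)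
    {p : SkewPoly σ} {m : ℕ} (hp : ∀ i, m < i → coeff p i = 0) :
    (redNorm hfix p).natDegree ≤ m ∧
    algebraMap K L ((redNorm hfix p).coeff m) =
      (-1) ^ (m * (orderOf σ - 1)) * ∏ i : Fin (orderOf σ), (σ ^ (i : ℕ)) (coeff p m) := by
  have hp' : p ∈ degLT σ (m + 1) := fun i hi => hp i (by omega)
  have hdeg : ∀ i j, (homogRep p (m + 1) i j).natDegree ≤ m := by
    intro i l
    rw [homogRep, Matrix.of_apply]
    refine natDegree_sum_le_of_forall_le _ _ fun j hj => ?_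
    refine (natDegree_C_mul_le _ _).trans ?_
    split_ifs
    · rw [natDegree_X_pow]
      have := Finset.mem_range.mp hj
      omega
    · simp
  obtain ⟨h1, h2⟩ := coeff_det_of_natDegree_le _ m hdeg
  rw [det_homogRep hp', ← map_redNorm hfix] at h1 h2
  rw [natDegree_expand, Polynomial.natDegree_map] at h1
  rw [mul_comm (orderOf σ), coeff_expand_mul hpos, Polynomial.coeff_map] at h2
  refine ⟨le_of_mul_le_mul_right (h1.trans_eq (mul_comm _ _)) hpos, h2.trans ?_⟩
  have h3 : ((homogRep p (m + 1)).map fun q => q.coeff m) =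
      Matrix.diagonal (fun i : Fin (orderOf σ) => (σ ^ (i : ℕ)) (coeff p m)) *
        cyclicMatrix (orderOf σ) L ^ m := by
    ext1 i l
    rw [Matrix.diagonal_mul, cyclicMatrix_pow, Matrix.map_apply, homogRep, Matrix.of_apply,
      finsetSum_coeff, Finset.sum_eq_single_of_mem m (by simp)]
    · rw [coeff_C_mul]
      split_ifs <;> simp
    · intro j _ hj
      rw [coeff_C_mul]
      split_ifs
      · rw [coeff_X_pow, if_neg hj.symm, mul_zero]
      · simp
  rw [h3, Matrix.det_mul, Matrix.det_diagonal, Matrix.det_pow, det_cyclicMatrix, mul_comm,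
    ← pow_mul, mul_comm m]

theorem redNorm_natDegree_le (hfix : ∀ a : L, σ a = a ↔ a ∈ Set.range (algebraMap K L))
    (hpos : 0 < orderOf σ) {p : SkewPoly σ} {m : ℕ} (hp : ∀ i, m < i → coeff p i = 0) :
    (redNorm hfix p).natDegree ≤ m :=
  (redNorm_natDegree_le_and_coeff hfix hpos hp).1

theorem coeff_redNorm (hfix : ∀ a : L, σ a = a ↔ a ∈ Set.range (algebraMap K L))
    (hpos : 0 < orderOf σ) {p : SkewPoly σ} {m : ℕ} (hp : ∀ i, m < i → coeff p i = 0) :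
    (redNorm hfix p).coeff m = (-1) ^ (m * (orderOf σ - 1)) * Algebra.norm K (coeff p m) := by
  refine (algebraMap K L).injective ?_
  rw [(redNorm_natDegree_le_and_coeff hfix hpos hp).2, map_mul,
    algebraMap_norm_eq_prod hfix hpos]
  simp

/-- At `z = 0` the matrix `homogRep` becomes `diag(σ ^ i a_0)`, whose determinant is the norm of
`a_0`. -/
theorem coeff_zero_redNorm (hfix : ∀ a : L, σ a = a ↔ a ∈ Set.range (algebraMap K L))
    (hpos : 0 < orderOf σ) (p : SkewPoly σ) :
    (redNorm hfix p).coeff 0 = Algebra.norm K (coeff p 0) := by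
  refine (algebraMap K L).injective ?_
  obtain ⟨N, hN⟩ := exists_mem_degLT p
  have hN := degLT_mono (Nat.le_succ N) hN
  have h := congrArg (fun q => q.coeff 0) (det_homogRep hN)
  simp only [← map_redNorm hfix] at h
  rw [← mul_zero (orderOf σ), coeff_expand_mul' hpos, Polynomial.coeff_map, mul_zero] at h
  rw [← h, algebraMap_norm_eq_prod hfix hpos, coeff_zero_eq_eval_zero, ← coe_evalRingHom,
    RingHom.map_det, ← Matrix.det_diagonal]
  congr 1
  ext1 i l
  rw [RingHom.mapMatrix_apply, Matrix.map_apply, homogRep, Matrix.of_apply, map_sum,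
    Finset.sum_eq_single_of_mem 0 (by simp)]
  · rw [add_zero, Nat.mod_eq_of_lt i.2, Matrix.diagonal_apply]
    simp only [Fin.ext_iff]
    split_ifs <;> simp
  · intro j _ hj
    rw [map_mul, coe_evalRingHom]
    split_ifs <;> simp [hj]

theorem redNorm_ne_zero (hfix : ∀ a : L, σ a = a ↔ a ∈ Set.range (algebraMap K L))
    (hpos : 0 < orderOf σ) {p : SkewPoly σ} (hp : p ≠ 0) : redNorm hfix p ≠ 0 := by
  have := finiteDimensional_of_fixed hfix hpos
  obtain ⟨m, hm⟩ := exists_hasDegree hp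
  intro h
  have h1 := coeff_redNorm hfix hpos hm.2
  rw [h, Polynomial.coeff_zero] at h1
  have := (mul_eq_zero.mp h1.symm).resolve_left (by simp)
  exact hm.1 (Algebra.norm_eq_zero_iff.mp this)

end ReducedNorm

/-! ### Matrix rings acting on modules -/

section MatrixModules

variable {E : Type*} [Field E] {n : ℕ}

/-- A left inverse of the map sending coefficients to the combination of the `k i` reads off
coordinates; each `N j` places the `j`-th coordinate in position `i₀`. -/
theorem exists_mulVec_eq_single (i₀ : Fin n) {r : ℕ} {k : Fin r → Fin n → E}
    (hk : LinearIndependent E k) :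
    ∃ N : Fin r → Matrix (Fin n) (Fin n) E,
      ∀ j i, (N j).mulVec (k i) = if j = i then Pi.single i₀ 1 else 0 := by
  obtain ⟨g, hg⟩ := (Fintype.linearCombination E k).exists_leftInverse_of_injective
    (LinearMap.ker_eq_bot.mpr (linearIndependent_iff_injective_fintypeLinearCombination.mp hk))
  refine ⟨fun j => LinearMap.toMatrix'
    (LinearMap.single E (fun _ : Fin n => E) i₀ ∘ₗ LinearMap.proj j ∘ₗ g), fun j i => ?_⟩
  have h1 : g (k i) = Pi.single i 1 := by
    have := LinearMap.congr_fun hg (Pi.single i 1)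
    simpa [Fintype.linearCombination_apply_single] using this
  rw [LinearMap.toMatrix'_mulVec, LinearMap.comp_apply, LinearMap.comp_apply, h1]
  simp only [LinearMap.proj_apply, Pi.single_apply, LinearMap.coe_single]
  split_ifs <;> simp

/-- The matrix whose column `i₀` is `v`, and whose other columns vanish. -/
def colMatrix (i₀ : Fin n) (v : Fin n → E) : Matrix (Fin n) (Fin n) E :=
  Matrix.vecMulVec v (Pi.single i₀ 1)

theorem mul_colMatrix (i₀ : Fin n) (A : Matrix (Fin n) (Fin n) E) (v : Fin n → E) :
    A * colMatrix i₀ v = colMatrix i₀ (A.mulVec v) :=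
  Matrix.mul_vecMulVec _ _ _

theorem colMatrix_zero (i₀ : Fin n) : colMatrix i₀ (0 : Fin n → E) = 0 :=
  Matrix.zero_vecMulVec _

theorem colMatrix_add (i₀ : Fin n) (v w : Fin n → E) :
    colMatrix i₀ (v + w) = colMatrix i₀ v + colMatrix i₀ w :=
  Matrix.add_vecMulVec _ _ _

theorem colMatrix_single_ne_zero (i₀ : Fin n) :
    colMatrix i₀ (Pi.single i₀ 1 : Fin n → E) ≠ 0 := by
  intro h
  have := congrFun (congrFun h i₀) i₀
  simp [colMatrix, Matrix.vecMulVec_apply] at this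

/-- `T` is only a ring homomorphism, so kernel vectors have to be carried as matrices. If `A v = 0`,
then `A` kills the matrix with single nonzero column `v`, hence `T A` kills the image under `T` of
that matrix, applied to any `w`. Independence survives because the matrices `N j` of
`exists_mulVec_eq_single` separate the columns. -/
theorem exists_linearIndependent_ker {Ω : Type*} [Field Ω] {m : ℕ}
    (T : Matrix (Fin n) (Fin n) E →+* Matrix (Fin m) (Fin m) Ω) (hn : 0 < n) (hm : 0 < m)
    (A : Matrix (Fin n) (Fin n) E) {r : ℕ} (hr : A.rank + r ≤ n) :
    ∃ u : Fin r → Fin m → Ω, LinearIndependent Ω u ∧ ∀ i, (T A).mulVec (u i) = 0 := by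
  have : NeZero n := ⟨hn.ne'⟩
  have : NeZero m := ⟨hm.ne'⟩
  set i₀ : Fin n := 0
  have hker : r ≤ Module.finrank E (LinearMap.ker A.mulVecLin) := by
    have := A.mulVecLin.finrank_range_add_finrank_ker
    rw [Module.finrank_fin_fun] at this
    have h2 : A.rank = Module.finrank E (LinearMap.range A.mulVecLin) := rfl
    omega
  obtain ⟨k', hk'⟩ := exists_linearIndependent_of_le_finrank hker
  set k : Fin r → Fin n → E := fun i => (k' i : Fin n → E)
  have hk : LinearIndependent E k :=
    hk'.map' (LinearMap.ker A.mulVecLin).subtype (Submodule.ker_subtype _)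
  have hAk : ∀ i, A.mulVec (k i) = 0 := fun i => LinearMap.mem_ker.mp (k' i).2
  obtain ⟨N, hN⟩ := exists_mulVec_eq_single i₀ hk
  set e := colMatrix i₀ (Pi.single i₀ 1 : Fin n → E)
  have hTe : T e ≠ 0 := fun h =>
    colMatrix_single_ne_zero i₀ ((map_eq_zero_iff T T.injective).mp h)
  -- A full matrix ring over a field is simple, so `T` is injective and `T e` moves some vector.
  obtain ⟨w, hw⟩ : ∃ w, (T e).mulVec w ≠ 0 := by
    by_contra hc
    push Not at hc
    exact hTe (Matrix.ext_of_mulVec_single fun i => by rw [hc, Matrix.zero_mulVec])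
  refine ⟨fun i => (T (colMatrix i₀ (k i))).mulVec w, ?_, fun i => ?_⟩
  · rw [Fintype.linearIndependent_iff]
    intro c hc j
    have h1 := congrArg (fun v => (T (N j)).mulVec v) hc
    simp only [Matrix.mulVec_sum, Matrix.mulVec_smul, Matrix.mulVec_mulVec, ← map_mul,
      mul_colMatrix, hN, Matrix.mulVec_zero] at h1
    rw [Finset.sum_eq_single_of_mem j (Finset.mem_univ _)] at h1
    · rw [if_pos rfl] at h1
      exact (smul_eq_zero.mp h1).resolve_right hw
    · intro i _ hi
      rw [if_neg hi.symm, colMatrix_zero, map_zero, Matrix.zero_mulVec, smul_zero]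
  · rw [Matrix.mulVec_mulVec, ← map_mul, mul_colMatrix, hAk, colMatrix_zero, map_zero,
      Matrix.zero_mulVec]

theorem pow_dvd_det_of_dvd_column {R : Type*} [CommRing R] (g : R) (M : Matrix (Fin n) (Fin n) R)
    (s : Finset (Fin n)) (h : ∀ j ∈ s, ∀ i, g ∣ M i j) : g ^ s.card ∣ M.det := by
  rw [Matrix.det_apply]
  refine Finset.dvd_sum fun π _ => ?_
  rw [Units.smul_def, zsmul_eq_mul]
  refine Dvd.dvd.mul_left ?_ _
  rw [← Finset.prod_const]
  exact (Finset.prod_dvd_prod_of_dvd _ _ fun j hj => h j hj _).trans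
    (Finset.prod_dvd_prod_of_subset _ _ _ (Finset.subset_univ _))

theorem exists_isUnit_det_of_linearIndependent {r : ℕ} {u : Fin r → Fin n → E}
    (hu : LinearIndependent E u) :
    ∃ (U : Matrix (Fin n) (Fin n) E) (ι : Fin r → Fin n), Function.Injective ι ∧ U.det ≠ 0 ∧
      ∀ i j, U j (ι i) = u i j := by
  classical
  set b := Module.Basis.extend hu.linearIndepOn_id with hb
  have : Fintype (hu.linearIndepOn_id.extend (Set.subset_univ _)) :=
    FiniteDimensional.fintypeBasisIndex b
  have hcard : Fintype.card (hu.linearIndepOn_id.extend (Set.subset_univ _)) = n := by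
    rw [← Module.finrank_eq_card_basis b, Module.finrank_fin_fun]
  let e := Fintype.equivFinOfCardEq hcard
  refine ⟨(Pi.basisFun E (Fin n)).toMatrix (b.reindex e),
    fun i => e ⟨u i, hu.linearIndepOn_id.subset_extend _ (Set.mem_range_self i)⟩,
    fun i j h => hu.injective (Subtype.ext_iff.mp (e.injective h)), ?_, fun i j => ?_⟩
  · exact ((Pi.basisFun E (Fin n)).isUnit_det (b.reindex e)).ne_zero
  · rw [Module.Basis.toMatrix_apply, Module.Basis.reindex_apply, Equiv.symm_apply_apply]
    rw [hb, Module.Basis.extend_apply_self]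
    simp

/-- Complete the kernel vectors to an invertible matrix over `Ω` and lift it to `V`. Then `r`
columns of `M * V` are divisible by `g`, while `det V` is not, so the whole power of the prime `g`
falls on `det M`. -/
theorem pow_dvd_det_of_ker {A : Type*} [CommRing A] [IsDomain A] {g : A} (hg : Prime g)
    {Ω : Type*} [Field Ω] (π : A →+* Ω) (hπ : Function.Surjective π) (hker : ∀ a, π a = 0 ↔ g ∣ a)
    (M : Matrix (Fin n) (Fin n) A) {r : ℕ} {u : Fin r → Fin n → Ω} (hu : LinearIndependent Ω u)
    (hMu : ∀ i, (M.map π).mulVec (u i) = 0) : g ^ r ∣ M.det := by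
  classical
  obtain ⟨U, ι, hι, hdet, hU⟩ := exists_isUnit_det_of_linearIndependent hu
  set V : Matrix (Fin n) (Fin n) A := U.map (Function.surjInv hπ) with hV
  have hVU : V.map π = U := by
    ext1 i j
    simp [hV, Function.surjInv_eq hπ]
  have h1 : g ^ r ∣ (M * V).det := by
    have := pow_dvd_det_of_dvd_column g (M * V) (Finset.univ.image ι) (by
      intro j hj i
      obtain ⟨l, _, rfl⟩ := Finset.mem_image.mp hj
      rw [← hker, ← Matrix.map_apply (f := π), Matrix.map_mul, hVU]
      have := congrFun (hMu l) i
      rw [Matrix.mul_apply]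
      simpa [Matrix.mulVec, dotProduct, hU] using this)
    rwa [Finset.card_image_of_injective _ hι, Finset.card_univ, Fintype.card_fin] at this
  rw [Matrix.det_mul] at h1
  refine hg.pow_dvd_of_dvd_mul_right r ?_ h1
  rw [← hker, RingHom.map_det, RingHom.mapMatrix_apply, hVU]
  exact hdet

end MatrixModules

/-! ### Irreducible polynomials over `K` are squarefree over `L` -/

section Squarefree

variable {K L : Type*} [Field K] [Field L] [Algebra K L] {σ : L ≃ₐ[K] L}

/-- `F` may be inseparable, so derivatives are of no use. Instead, the product of the distinct
`σ`-conjugates of `G` is fixed by `σ`, descends to a nonunit monic divisor of `F`, and therefore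
equals `F`; distinct conjugates are coprime. -/
theorem not_sq_dvd_map (hfix : ∀ a : L, σ a = a ↔ a ∈ Set.range (algebraMap K L))
    (hpos : 0 < orderOf σ) {F : K[X]} (hF : Irreducible F) (hFm : F.Monic) {G : L[X]}
    (hG : Irreducible G) (hGm : G.Monic) (hGF : G ∣ F.map (algebraMap K L)) :
    ¬ G * G ∣ F.map (algebraMap K L) := by
  classical
  set f : L[X] ≃+* L[X] := Polynomial.mapEquiv (σ : L ≃+* L) with hf
  have hfF : f (F.map (algebraMap K L)) = F.map (algebraMap K L) := by
    rw [hf, Polynomial.mapEquiv_apply, Polynomial.map_map]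
    congr 1
    ext a
    simp
  have hfFm : ∀ m : ℕ, (f ^ m) (F.map (algebraMap K L)) = F.map (algebraMap K L) := by
    intro m
    induction m with
    | zero => rfl
    | succ m ih =>
      rw [pow_succ]
      change (f ^ m) (f _) = _
      rw [hfF, ih]
  have hfn : ∀ (m : ℕ) (p : L[X]) (j : ℕ), ((f ^ m) p).coeff j = (σ ^ m) (p.coeff j) := by
    intro m
    induction m with
    | zero => intro p j; rfl
    | succ m ih =>
      intro p j
      rw [pow_succ, pow_succ]
      change ((f ^ m) (f p)).coeff j = (σ ^ m) (σ (p.coeff j))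
      rw [ih, hf, Polynomial.mapEquiv_apply, Polynomial.coeff_map]
      rfl
  -- As a finite set this lists each conjugate once, even when the orbit of `G` is shorter than
  -- `orderOf σ`.
  set S : Finset L[X] := (Finset.range (orderOf σ)).image fun i => (f ^ i) G with hS
  have hSmem : ∀ m, (f ^ m) G ∈ S := by
    intro m
    refine Finset.mem_image.mpr ⟨m % orderOf σ, Finset.mem_range.mpr (Nat.mod_lt _ hpos), ?_⟩
    refine Polynomial.ext fun j => ?_
    rw [hfn, hfn, pow_mod_orderOf]
  have hSprop : ∀ H ∈ S, Irreducible H ∧ H.Monic ∧ H ∣ F.map (algebraMap K L) := by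
    intro H hH
    obtain ⟨m, _, rfl⟩ := Finset.mem_image.mp hH
    refine ⟨(MulEquiv.irreducible_iff (f ^ m)).mpr hG, ?_, ?_⟩
    · have hdeg : ((f ^ m) G).natDegree = G.natDegree := by
        refine natDegree_eq_of_le_of_coeff_ne_zero ?_ ?_
        · rw [natDegree_le_iff_coeff_eq_zero]
          intro N hN
          rw [hfn, coeff_eq_zero_of_natDegree_lt hN, map_zero]
        · rw [hfn, coeff_natDegree, hGm.leadingCoeff, map_one]
          exact one_ne_zero
      rw [Monic, leadingCoeff, hdeg, hfn, coeff_natDegree, hGm.leadingCoeff, map_one]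
    · have := map_dvd (f ^ m) hGF
      rwa [hfFm] at this
  have hcop : ∀ H ∈ S, ∀ H' ∈ S, H ≠ H' → IsCoprime H H' := by
    intro H hH H' hH' hne
    refine ((hSprop H hH).1.coprime_iff_not_dvd).mpr fun hd => hne ?_
    exact eq_of_monic_of_associated (hSprop H hH).2.1 (hSprop H' hH').2.1
      ((hSprop H hH).1.associated_of_dvd (hSprop H' hH').1 hd)
  set P := ∏ H ∈ S, H with hP
  have hPF : P ∣ F.map (algebraMap K L) :=
    Finset.prod_dvd_of_coprime (fun H hH H' hH' hne => hcop H hH H' hH' hne)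
      fun H hH => (hSprop H hH).2.2
  have hfS : S.image f = S := by
    refine Finset.eq_of_subset_of_card_le (fun H hH => ?_)
      (Finset.card_image_of_injective _ f.injective).ge
    obtain ⟨H', hH', rfl⟩ := Finset.mem_image.mp hH
    obtain ⟨m, _, rfl⟩ := Finset.mem_image.mp hH'
    have := hSmem (m + 1)
    rwa [pow_succ'] at this
  have hfP : P.map (σ : L →+* L) = P := by
    change f P = P
    rw [hP, map_prod, ← Finset.prod_image (s := S) (g := f) (f := fun H => H)
      (fun _ _ _ _ h => f.injective h), hfS]
  obtain ⟨h, hh⟩ := map_mem_range_of_forall_coeff hfix hfP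
  have hPm : P.Monic := monic_prod_of_monic _ _ fun H hH => (hSprop H hH).2.1
  have hhm : h.Monic := by
    rw [← hh] at hPm
    exact monic_of_injective (algebraMap K L).injective hPm
  have hGS : G ∈ S := hSmem 0
  have hGP : G ∣ P := Finset.dvd_prod_of_mem (fun H => H) hGS
  have hhF : h ∣ F := by
    rw [← hh] at hPF
    exact (Polynomial.map_dvd_map _ (algebraMap K L).injective hhm).mp hPF
  have hhu : ¬ IsUnit h := fun hu => by
    have : h = 1 := hhm.eq_one_of_isUnit hu
    rw [this, Polynomial.map_one] at hh
    rw [← hh] at hGP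
    exact hG.not_isUnit (isUnit_of_dvd_one hGP)
  have hFh : F = h := by
    obtain ⟨c, hc⟩ := hhF
    have hcu := (hF.isUnit_or_isUnit hc).resolve_left hhu
    exact eq_of_monic_of_associated hFm hhm ⟨hcu.unit⁻¹, by
      rw [hc, mul_assoc]; simp⟩
  rw [hFh, hh, hP, ← Finset.mul_prod_erase S (fun H => H) hGS]
  intro hd
  have hd' := (mul_dvd_mul_iff_left hG.ne_zero).mp hd
  obtain ⟨H, hH, hGH⟩ := (hG.prime.dvd_finsetProd_iff _).mp hd'
  have hH' := Finset.mem_erase.mp hH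
  exact hG.not_isUnit ((hcop G hGS H hH'.2 hH'.1.symm).isUnit_of_dvd' dvd_rfl hGH)

/-- If `F ∤ q`, a Bézout relation over `K` would persist over `L` and contradict `G ∣ F, q`. So
split off `F` from `q`; this uses up exactly one factor `G`, and induction finishes. -/
theorem pow_dvd_of_map_pow_dvd (hfix : ∀ a : L, σ a = a ↔ a ∈ Set.range (algebraMap K L))
    (hpos : 0 < orderOf σ) {F : K[X]} (hF : Irreducible F) (hFm : F.Monic) {G : L[X]}
    (hG : Irreducible G) (hGm : G.Monic) (hGF : G ∣ F.map (algebraMap K L)) {q : K[X]} {r : ℕ}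
    (h : G ^ r ∣ q.map (algebraMap K L)) : F ^ r ∣ q := by
  induction r generalizing q with
  | zero => simp
  | succ r ih =>
    have hFq : F ∣ q := by
      by_contra hc
      have hcop : IsCoprime F q := (hF.coprime_iff_not_dvd).mpr hc
      have hcop' := hcop.map (Polynomial.mapRingHom (algebraMap K L))
      exact hG.not_isUnit (hcop'.isUnit_of_dvd' hGF ((dvd_pow_self G r.succ_ne_zero).trans h))
    obtain ⟨q', rfl⟩ := hFq
    rw [pow_succ']
    refine mul_dvd_mul_left F (ih ?_)
    obtain ⟨H, hH⟩ := hGF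
    have hGH : ¬ G ∣ H := fun hd =>
      not_sq_dvd_map hfix hpos hF hFm hG hGm ⟨H, hH⟩ (hH ▸ mul_dvd_mul_left G hd)
    rw [Polynomial.map_mul, hH, pow_succ', mul_assoc] at h
    exact hG.prime.pow_dvd_of_dvd_mul_left r hGH ((mul_dvd_mul_iff_left hG.ne_zero).mp h)

end Squarefree

/-! ### Rank versus reduced norm -/

section RankNorm

variable {K L : Type*} [Field K] [Field L] [Algebra K L] {σ : L ≃ₐ[K] L}

/-- The rank of an element of `R_F ≅ M_n(E)` bounds the order of its reduced norm at `F`. -/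
theorem pow_dvd_redNorm_of_rank (hfix : ∀ a : L, σ a = a ↔ a ∈ Set.range (algebraMap K L))
    (hpos : 0 < orderOf σ) {F : K[X]} (hF : Irreducible F) (hFm : F.Monic)
    {E : Type*} [Field E] (φ : RF σ F ≃+* Matrix (Fin (orderOf σ)) (Fin (orderOf σ)) E)
    (a : SkewPoly σ) {r : ℕ} (hr : (φ (mk σ F a)).rank + r ≤ orderOf σ) :
    F ^ r ∣ redNorm hfix a := by
  have hFL : ¬ IsUnit (F.map (algebraMap K L)) := by
    rw [Polynomial.isUnit_map]
    exact hF.not_isUnit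
  obtain ⟨G, hGm, hG, hGF⟩ := exists_monic_irreducible_factor _ hFL
  have : Fact (Irreducible G) := ⟨hG⟩
  -- The regular representation over the residue field `L[y]/(G)`. It sends `F(x ^ n)` to the scalar
  -- `F`, which is zero modulo `G`, so it factors through `R_F`.
  set D : SkewPoly σ →+* Matrix (Fin (orderOf σ)) (Fin (orderOf σ)) (AdjoinRoot G) :=
    (AdjoinRoot.mk G).mapMatrix.comp (regRep σ).toRingHom with hD
  have hDF : ∀ c ∈ centralIdeal σ F, D c = 0 := by
    intro c hc
    obtain ⟨b, rfl⟩ := Ideal.mem_span_singleton'.mp hc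
    have : D (evalXPow σ F) = 0 := by
      change (AdjoinRoot.mk G).mapMatrix (regRep σ (evalXPow σ F)) = 0
      rw [regRep_evalXPow]
      ext1 i j
      rw [RingHom.mapMatrix_apply, Matrix.map_apply, Matrix.algebraMap_matrix_apply]
      split_ifs
      · exact AdjoinRoot.mk_eq_zero.mpr hGF
      · simp
    rw [map_mul, this, mul_zero]
  set T := (Ideal.Quotient.lift (centralIdeal σ F) D hDF).comp φ.symm.toRingHom
  obtain ⟨u, hu, hu0⟩ := exists_linearIndependent_ker T hpos hpos (φ (mk σ F a)) hr
  have hT : T (φ (mk σ F a)) = (regRep σ a).map (AdjoinRoot.mk G) := by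
    change Ideal.Quotient.lift (centralIdeal σ F) D hDF (φ.symm (φ (mk σ F a))) = _
    rw [φ.symm_apply_apply]
    rfl
  refine pow_dvd_of_map_pow_dvd hfix hpos hF hFm hG hGm hGF ?_
  rw [map_redNorm]
  refine pow_dvd_det_of_ker hG.prime (AdjoinRoot.mk G) AdjoinRoot.mk_surjective
    (fun _ => AdjoinRoot.mk_eq_zero) _ hu fun i => ?_
  rw [← hT]
  exact hu0 i

end RankNorm

/-! ### The codes `S_{n,s,k}(η,ρ,F)` -/

section CodeS

variable {K' K L : Type*} [Field K'] [Field K] [Field L]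
  [Algebra K L] [Algebra K' L] {σ : L ≃ₐ[K] L}

/-- The skew polynomials `a` with `deg a ≤ N` and `a_N = η a_0 ^ ρ`, for `N > 0`. -/
def codePoly (σ : L ≃ₐ[K] L) (η : L) (ρ : L ≃ₐ[K'] L) (N : ℕ) (v : Fin N → L) : SkewPoly σ :=
  ofVec σ N v + mon σ N (η * ρ (coeff (ofVec σ N v) 0))

theorem coeff_codePoly_lt {η : L} {ρ : L ≃ₐ[K'] L} {N : ℕ} (v : Fin N → L) {i : ℕ} (hi : i < N) :
    coeff (codePoly σ η ρ N v) i = v ⟨i, hi⟩ := by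
  rw [codePoly, coeff_add, coeff_ofVec, dif_pos hi, coeff_mon, if_neg hi.ne', add_zero]

theorem coeff_codePoly_self {η : L} {ρ : L ≃ₐ[K'] L} {N : ℕ} (hN : 0 < N) (v : Fin N → L) :
    coeff (codePoly σ η ρ N v) N = η * ρ (coeff (codePoly σ η ρ N v) 0) := by
  rw [coeff_codePoly_lt v hN, codePoly, coeff_add, coeff_ofVec, dif_neg (lt_irrefl N), coeff_mon,
    if_pos rfl, zero_add, coeff_ofVec, dif_pos hN]

theorem coeff_codePoly_gt {η : L} {ρ : L ≃ₐ[K'] L} {N : ℕ} (v : Fin N → L) {i : ℕ} (hi : N < i) :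
    coeff (codePoly σ η ρ N v) i = 0 := by
  rw [codePoly, coeff_add, coeff_ofVec, dif_neg (by omega), coeff_mon, if_neg hi.ne, add_zero]

theorem codePoly_add (η : L) (ρ : L ≃ₐ[K'] L) (N : ℕ) (v w : Fin N → L) :
    codePoly σ η ρ N (v + w) = codePoly σ η ρ N v + codePoly σ η ρ N w := by
  simp only [codePoly, map_add, coeff_add, mul_add]
  abel

theorem eq_codePoly {η : L} {ρ : L ≃ₐ[K'] L} {N : ℕ} (hN : 0 < N) {a : SkewPoly σ}
    (h1 : ∀ i, N < i → coeff a i = 0) (h2 : coeff a N = η * ρ (coeff a 0)) :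
    a = codePoly σ η ρ N fun i => coeff a i := by
  refine coeff_ext fun i => ?_
  rcases lt_trichotomy i N with h | rfl | h
  · rw [coeff_codePoly_lt _ h]
  · rw [coeff_codePoly_self hN, coeff_codePoly_lt _ hN, h2]
  · rw [coeff_codePoly_gt _ h, h1 i h]

theorem codeS_eq_range (k : ℕ) (η : L) (ρ : L ≃ₐ[K'] L) (F : K[X]) (hN : 0 < k * F.natDegree) :
    codeS σ k η ρ F = Set.range fun v => mk σ F (codePoly σ η ρ (k * F.natDegree) v) := by
  ext u
  constructor
  · rintro ⟨a, h1, h2, rfl⟩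
    exact ⟨_, congrArg (mk σ F) (eq_codePoly hN h1 h2).symm⟩
  · rintro ⟨v, rfl⟩
    exact ⟨_, fun i hi => coeff_codePoly_gt v hi, coeff_codePoly_self hN v, rfl⟩

theorem codePoly_injective (η : L) (ρ : L ≃ₐ[K'] L) (N : ℕ) :
    Function.Injective (codePoly σ η ρ N) := by
  intro v w h
  funext i
  have := congrArg (fun p => coeff p i) h
  simpa [coeff_codePoly_lt] using this

variable [Algebra K' K] [IsScalarTower K' K L]

theorem codePoly_smul (η : L) (ρ : L ≃ₐ[K'] L) (N : ℕ) (t : K') (v : Fin N → L) :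
    codePoly σ η ρ N (t • v) = algebraMap K' K t • codePoly σ η ρ N v := by
  have h : t • v = algebraMap K' K t • v := by
    funext i
    simp
  have h2 : ∀ a : L, η * ρ (algebraMap K' K t • a) = algebraMap K' K t • (η * ρ a) := by
    intro a
    rw [algebraMap_smul, map_smul, mul_smul_comm, algebraMap_smul]
  rw [h, codePoly, map_smul, coeff_smul, h2, map_smul, ← smul_add]
  rfl

/-- The parametrisation of the code by `L ^ (k s)`, in matrix form. -/
def codeLinearMap (k : ℕ) (η : L) (ρ : L ≃ₐ[K'] L) {F : K[X]} {n : ℕ}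
    (φ : RF σ F ≃ₐ[K] Matrix (Fin n) (Fin n) (AdjoinRoot F)) :
    (Fin (k * F.natDegree) → L) →ₗ[K'] Matrix (Fin n) (Fin n) (AdjoinRoot F) where
  toFun v := φ (mk σ F (codePoly σ η ρ (k * F.natDegree) v))
  map_add' v w := by
    rw [codePoly_add, ← mkₐ_apply, map_add, map_add]
    rfl
  map_smul' t v := by
    rw [codePoly_smul, ← mkₐ_apply, map_smul, map_smul, algebraMap_smul]
    rfl

theorem range_codeLinearMap (k : ℕ) (η : L) (ρ : L ≃ₐ[K'] L) {F : K[X]} {n : ℕ}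
    (φ : RF σ F ≃ₐ[K] Matrix (Fin n) (Fin n) (AdjoinRoot F)) (hN : 0 < k * F.natDegree) :
    (LinearMap.range (codeLinearMap k η ρ φ) : Set (Matrix (Fin n) (Fin n) (AdjoinRoot F))) =
      φ '' codeS σ k η ρ F := by
  rw [codeS_eq_range k η ρ F hN, ← Set.range_comp]
  rfl

variable [FiniteDimensional K' K]

theorem finiteDimensional_bot (K' : Type*) [Field K'] [Algebra K' K] [Algebra K' L]
    [IsScalarTower K' K L] [FiniteDimensional K' K]
    (hfix : ∀ a : L, σ a = a ↔ a ∈ Set.range (algebraMap K L)) (hpos : 0 < orderOf σ) :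
    FiniteDimensional K' L :=
  have := finiteDimensional_of_fixed hfix hpos
  FiniteDimensional.trans K' K L

/-- A nonzero element of the code has no unexpectedly large factor in common with `F(x ^ n)`. -/
theorem not_pow_dvd_redNorm (hfix : ∀ a : L, σ a = a ↔ a ∈ Set.range (algebraMap K L))
    (hpos : 0 < orderOf σ) {F : K[X]} (hFm : F.Monic) {k : ℕ} {η : L}
    {ρ : L ≃ₐ[K'] L} (hc : NormCond K' σ k η F) {a : SkewPoly σ} (ha : a ≠ 0)
    (h1 : ∀ i, k * F.natDegree < i → coeff a i = 0)
    (h2 : coeff a (k * F.natDegree) = η * ρ (coeff a 0)) : ¬ F ^ k ∣ redNorm hfix a := by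
  have := finiteDimensional_of_fixed hfix hpos
  have := finiteDimensional_bot K' hfix hpos
  rintro ⟨g, hg⟩
  have hne := redNorm_ne_zero hfix hpos ha
  have hg0 : g ≠ 0 := by rintro rfl; exact hne (by rw [hg, mul_zero])
  have hdeg := redNorm_natDegree_le hfix hpos h1
  rw [hg, natDegree_mul (pow_ne_zero _ hFm.ne_zero) hg0, natDegree_pow] at hdeg
  -- `deg N(a) ≤ k s = deg F ^ k` leaves only a constant cofactor, which is then computed from both
  -- ends of `N(a)`.
  have hgC := eq_C_of_natDegree_eq_zero (p := g) (by omega)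
  set c := g.coeff 0
  have htop : c = (-1) ^ (k * F.natDegree * (orderOf σ - 1)) *
      Algebra.norm K (coeff a (k * F.natDegree)) := by
    rw [← coeff_redNorm hfix hpos h1, hg, hgC, coeff_mul_C, ← natDegree_pow, coeff_natDegree,
      (hFm.pow k).leadingCoeff, one_mul]
  have hbot : Algebra.norm K (coeff a 0) = F.coeff 0 ^ k * c := by
    rw [← coeff_zero_redNorm hfix hpos, hg, hgC, coeff_mul_C, coeff_zero_eq_eval_zero, eval_pow,
      ← coeff_zero_eq_eval_zero]
  -- If `a_0 = 0`, the code equation kills the top coefficient as well, and `c = 0`.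
  have ha0 : coeff a 0 ≠ 0 := by
    intro h0
    rw [h2, h0, map_zero, mul_zero, Algebra.norm_zero, mul_zero] at htop
    exact hg0 (by rw [hgC, htop, C_0])
  have hN0 : Algebra.norm K' (coeff a 0) ≠ 0 := Algebra.norm_ne_zero_iff.mpr ha0
  -- `ρ` preserves the norm to `K'`, though in general not the norm to `K`; hence the comparison is
  -- made over `K'`, where `N(a_0)` cancels.
  have h3 := congrArg (Algebra.norm K') hbot
  rw [Algebra.norm_norm, htop, h2, ← mul_assoc, _root_.map_mul (Algebra.norm K'),
    Algebra.norm_norm, _root_.map_mul (Algebra.norm K') η, Algebra.norm_eq_of_algEquiv ρ,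
    ← mul_assoc] at h3
  refine hc (mul_right_cancel₀ hN0 ?_)
  rw [one_mul]
  nth_rewrite 2 [h3]
  rw [mul_comm (Algebra.norm K' η), mul_comm ((-1) ^ _) (F.coeff 0 ^ k),
    mul_comm F.natDegree k]

/-- By degrees, a nonzero multiple of `F(x ^ n)` of degree at most `k s` exists only for `k = n`,
and is then `c F(x ^ n)` with `c` constant. The code equation becomes `c = η (c F_0) ^ ρ`, and its
norm to `K'` contradicts the norm condition. -/
theorem eq_zero_of_mk_eq_zero (hfix : ∀ a : L, σ a = a ↔ a ∈ Set.range (algebraMap K L))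
    (hpos : 0 < orderOf σ) {F : K[X]} (hFm : F.Monic) (hFd : 0 < F.natDegree) {k : ℕ}
    (hk : k ≤ orderOf σ) {η : L}
    {ρ : L ≃ₐ[K'] L} (hc : NormCond K' σ k η F) {a : SkewPoly σ}
    (h1 : ∀ i, k * F.natDegree < i → coeff a i = 0)
    (h2 : coeff a (k * F.natDegree) = η * ρ (coeff a 0)) (h : mk σ F a = 0) : a = 0 := by
  have := finiteDimensional_of_fixed hfix hpos
  have := finiteDimensional_bot K' hfix hpos
  by_contra ha
  obtain ⟨c, rfl⟩ := mk_eq_zero_iff'.mp h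
  obtain ⟨m, hm⟩ := exists_hasDegree (left_ne_zero_of_mul ha)
  have hd := (hm.mul (hasDegree_evalXPow hpos hFm.ne_zero)).lt_of_mem
    (N := k * F.natDegree + 1) fun i hi => h1 i (by omega)
  have hkn : k = orderOf σ := by
    refine le_antisymm hk ?_
    by_contra hlt
    have := Nat.mul_le_mul_right F.natDegree (show k + 1 ≤ orderOf σ by omega)
    rw [Nat.succ_mul] at this
    omega
  have hm0 : m = 0 := by rw [hkn] at hd; omega
  subst hm0
  have htop := coeff_mul_add hm.2 (hasDegree_evalXPow hpos hFm.ne_zero).2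
  rw [zero_add, pow_zero, AlgEquiv.one_apply, coeff_evalXPow_mul hpos, coeff_natDegree,
    hFm.leadingCoeff, map_one, mul_one, ← hkn, h2, coeff_mul_zero, coeff_evalXPow_zero hpos] at htop
  have hN0 : Algebra.norm K' (coeff c 0) ≠ 0 := Algebra.norm_ne_zero_iff.mpr hm.1
  have h3 := congrArg (Algebra.norm K') htop
  rw [_root_.map_mul, Algebra.norm_eq_of_algEquiv ρ, _root_.map_mul, ← Algebra.norm_norm (S := K)
    (a := algebraMap K L (F.coeff 0)), Algebra.norm_algebraMap, finrank_of_fixed hfix, ← hkn] at h3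
  refine hc (mul_right_cancel₀ hN0 ?_)
  -- For `k = n` the sign in the norm condition is trivial, since `n (n - 1)` is even.
  have heven : Even (F.natDegree * k * (orderOf σ - 1)) := by
    rw [hkn, mul_assoc]
    exact (Nat.even_mul_pred_self _).mul_left _
  rw [heven.neg_one_pow, one_mul, one_mul]
  nth_rewrite 2 [← h3]
  ring

theorem mk_codePoly_injective (hfix : ∀ a : L, σ a = a ↔ a ∈ Set.range (algebraMap K L))
    (hpos : 0 < orderOf σ) {F : K[X]} (hFm : F.Monic) (hFd : 0 < F.natDegree) {k : ℕ}
    (hk1 : 1 ≤ k) (hk : k ≤ orderOf σ) {η : L} {ρ : L ≃ₐ[K'] L} (hc : NormCond K' σ k η F) :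
    Function.Injective fun v => mk σ F (codePoly σ η ρ (k * F.natDegree) v) := by
  have hN : 0 < k * F.natDegree := Nat.mul_pos hk1 hFd
  intro v w h
  have hsub : codePoly σ η ρ (k * F.natDegree) (v - w) =
      codePoly σ η ρ _ v - codePoly σ η ρ _ w := by
    rw [eq_sub_iff_add_eq, ← codePoly_add, sub_add_cancel]
  have h0 : mk σ F (codePoly σ η ρ (k * F.natDegree) (v - w)) = 0 := by
    rw [hsub]
    exact (map_sub (mkₐ σ F) _ _).trans (sub_eq_zero.mpr h)
  have := eq_zero_of_mk_eq_zero hfix hpos hFm hFd hk hc (fun i hi => coeff_codePoly_gt _ hi)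
    (coeff_codePoly_self hN _) h0
  rw [hsub] at this
  exact codePoly_injective η ρ _ (sub_eq_zero.mp this)

theorem ncard_codeS [Finite L] (hfix : ∀ a : L, σ a = a ↔ a ∈ Set.range (algebraMap K L))
    (hpos : 0 < orderOf σ) {F : K[X]} (hFm : F.Monic) (hFd : 0 < F.natDegree) {k : ℕ}
    (hk1 : 1 ≤ k) (hk : k ≤ orderOf σ) {η : L} {ρ : L ≃ₐ[K'] L} (hc : NormCond K' σ k η F) :
    (codeS σ k η ρ F).ncard = Nat.card K ^ (orderOf σ * F.natDegree * k) := by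
  have := finiteDimensional_of_fixed hfix hpos
  rw [codeS_eq_range k η ρ F (Nat.mul_pos hk1 hFd), ← Set.image_univ,
    Set.ncard_image_of_injective _ (mk_codePoly_injective hfix hpos hFm hFd hk1 hk hc),
    Set.ncard_univ, Nat.card_fun, Nat.card_eq_fintype_card (α := Fin _), Fintype.card_fin,
    Module.natCard_eq_pow_finrank (K := K) (V := L), finrank_of_fixed hfix, ← pow_mul]
  congr 1
  ring

theorem codeLinearMap_injective (hfix : ∀ a : L, σ a = a ↔ a ∈ Set.range (algebraMap K L))
    (hpos : 0 < orderOf σ) {F : K[X]} (hFm : F.Monic) (hFd : 0 < F.natDegree) {k : ℕ}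
    (hk1 : 1 ≤ k) (hk : k ≤ orderOf σ) {η : L} {ρ : L ≃ₐ[K'] L} (hc : NormCond K' σ k η F) {n : ℕ}
    (φ : RF σ F ≃ₐ[K] Matrix (Fin n) (Fin n) (AdjoinRoot F)) :
    Function.Injective (codeLinearMap k η ρ φ) :=
  φ.injective.comp (mk_codePoly_injective hfix hpos hFm hFd hk1 hk hc)

theorem finrank_adjoinRoot_bot (K' : Type*) [Field K'] [Algebra K' K] [FiniteDimensional K' K]
    {F : K[X]} (hFm : F.Monic) :
    Module.finrank K' (AdjoinRoot F) = Module.finrank K' K * F.natDegree := by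
  have h1 : Module.Free K (AdjoinRoot F) := hFm.free_adjoinRoot
  rw [← Module.finrank_mul_finrank K' K (AdjoinRoot F),
    (AdjoinRoot.powerBasis hFm.ne_zero).finrank, AdjoinRoot.powerBasis_dim]

theorem finrank_range_codeLinearMap
    (hfix : ∀ a : L, σ a = a ↔ a ∈ Set.range (algebraMap K L))
    (hpos : 0 < orderOf σ) {F : K[X]} (hFm : F.Monic) (hFd : 0 < F.natDegree) {k : ℕ}
    (hk1 : 1 ≤ k) (hk : k ≤ orderOf σ) {η : L} {ρ : L ≃ₐ[K'] L} (hc : NormCond K' σ k η F) {n : ℕ}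
    (φ : RF σ F ≃ₐ[K] Matrix (Fin n) (Fin n) (AdjoinRoot F)) :
    Module.finrank K' (LinearMap.range (codeLinearMap k η ρ φ)) =
      orderOf σ * k * Module.finrank K' (AdjoinRoot F) := by
  have := finiteDimensional_of_fixed hfix hpos
  have := finiteDimensional_bot K' hfix hpos
  rw [LinearMap.finrank_range_of_inj (codeLinearMap_injective hfix hpos hFm hFd hk1 hk hc φ),
    Module.finrank_pi_fintype, finrank_adjoinRoot_bot K' hFm]
  simp only [Finset.sum_const, Finset.card_univ, Fintype.card_fin, smul_eq_mul]
  rw [← Module.finrank_mul_finrank K' K L, finrank_of_fixed hfix]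
  ring

theorem lt_rank_of_ne_zero (hfix : ∀ a : L, σ a = a ↔ a ∈ Set.range (algebraMap K L))
    (hpos : 0 < orderOf σ) {F : K[X]} (hFm : F.Monic) (hF : Irreducible F) {k : ℕ}
    (hk1 : 1 ≤ k) {η : L} {ρ : L ≃ₐ[K'] L} (hc : NormCond K' σ k η F)
    (φ : RF σ F ≃ₐ[K] Matrix (Fin (orderOf σ)) (Fin (orderOf σ)) (AdjoinRoot F))
    {v : Fin (k * F.natDegree) → L} (hv : codeLinearMap k η ρ φ v ≠ 0) :
    orderOf σ < (codeLinearMap k η ρ φ v).rank + k := by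
  by_contra hle
  have : Fact (Irreducible F) := ⟨hF⟩
  have hN : 0 < k * F.natDegree := Nat.mul_pos hk1 hF.natDegree_pos
  refine not_pow_dvd_redNorm hfix hpos hFm hc (a := codePoly σ η ρ (k * F.natDegree) v) ?_
    (fun i hi => coeff_codePoly_gt _ hi) (coeff_codePoly_self hN _)
    (pow_dvd_redNorm_of_rank hfix hpos hF hFm φ.toRingEquiv _ (not_lt.mp hle))
  intro h0
  refine hv ?_
  change φ (mkₐ σ F (codePoly σ η ρ (k * F.natDegree) v)) = 0
  rw [h0, map_zero, map_zero]

/-- The Singleton bound: the vanishing of the first `k - 1` rows imposes `n (k - 1) [E : K']` linear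
conditions, fewer than the dimension of `W`, and a matrix with at most `n - k + 1` nonzero rows has
at most that rank. -/
theorem exists_rank_le {E : Type*} [Field E] [Algebra K' E] [FiniteDimensional K' E] {n k : ℕ}
    (hk1 : 1 ≤ k) (hk : k ≤ n) (W : Submodule K' (Matrix (Fin n) (Fin n) E))
    (hW : Module.finrank K' W = n * k * Module.finrank K' E) :
    ∃ A ∈ W, A ≠ 0 ∧ A.rank ≤ n - k + 1 := by
  let f : Matrix (Fin n) (Fin n) E →ₗ[K'] (Fin (k - 1) → Fin n → E) :=
    { toFun := fun A i => A (Fin.castLE (by omega) i)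
      map_add' := fun _ _ => rfl
      map_smul' := fun _ _ => rfl }
  have hpos : 0 < Module.finrank K' E := Module.finrank_pos
  have hlt : Module.finrank K' (Fin (k - 1) → Fin n → E) < Module.finrank K' W := by
    rw [hW, Module.finrank_pi_fintype]
    simp only [Module.finrank_pi_fintype, Finset.sum_const, Finset.card_univ, Fintype.card_fin,
      smul_eq_mul]
    rw [← mul_assoc, mul_comm (k - 1)]
    exact Nat.mul_lt_mul_of_pos_right (Nat.mul_lt_mul_of_pos_left (by omega) (by omega)) hpos
  obtain ⟨A, hA, hA0⟩ := (Submodule.ne_bot_iff _).mp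
    (LinearMap.ker_ne_bot_of_finrank_lt (f := f ∘ₗ W.subtype) hlt)
  refine ⟨A, A.2, fun h => hA0 (Subtype.ext h), ?_⟩
  have hrow : ∀ i : Fin n, (i : ℕ) < k - 1 → A.1 i = 0 := by
    intro i hi
    exact congrFun (LinearMap.mem_ker.mp hA) ⟨i, hi⟩
  classical
  set w : Fin n → E := fun i => if (i : ℕ) < k - 1 then 0 else 1 with hw
  have hmul : A.1 = Matrix.diagonal w * A.1 := by
    ext i j
    rw [Matrix.diagonal_mul, hw]
    dsimp only
    split_ifs with h
    · rw [hrow i h]; simp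
    · rw [one_mul]
  rw [hmul]
  refine (Matrix.rank_mul_le_left _ _).trans ?_
  rw [Matrix.rank_diagonal]
  have hcard : Fintype.card {i : Fin n // w i ≠ 0} ≤ (Finset.Ico (k - 1) n).card := by
    rw [← Fintype.card_coe]
    refine Fintype.card_le_of_injective
      (fun i => ⟨(i.1 : ℕ), Finset.mem_Ico.mpr ⟨?_, i.1.2⟩⟩) ?_
    · by_contra h
      exact i.2 (if_pos (not_le.mp h))
    · intro i j h
      exact Subtype.ext (Fin.ext (congrArg Subtype.val h))
  rw [Nat.card_Ico] at hcard
  omega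

theorem isLinearMRD_codeS (hfix : ∀ a : L, σ a = a ↔ a ∈ Set.range (algebraMap K L))
    (hpos : 0 < orderOf σ) {F : K[X]} (hFm : F.Monic) (hF : Irreducible F) {k : ℕ}
    (hk1 : 1 ≤ k) (hk : k ≤ orderOf σ) {η : L} (ρ : L ≃ₐ[K'] L) (hc : NormCond K' σ k η F)
    (φ : RF σ F ≃ₐ[K] Matrix (Fin (orderOf σ)) (Fin (orderOf σ)) (AdjoinRoot F)) :
    IsLinearMRD K' (φ '' codeS σ k η ρ F) (orderOf σ - k + 1) := by
  have : Fact (Irreducible F) := ⟨hF⟩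
  have hFd := hF.natDegree_pos
  have hN : 0 < k * F.natDegree := Nat.mul_pos hk1 hFd
  have hW := finrank_range_codeLinearMap hfix hpos hFm hFd hk1 hk (ρ := ρ) hc φ
  have hrank : ∀ A ∈ LinearMap.range (codeLinearMap k η ρ φ), A ≠ 0 →
      orderOf σ - k + 1 ≤ A.rank := by
    rintro A ⟨v, rfl⟩ hv
    have := lt_rank_of_ne_zero hfix hpos hFm hF hk1 hc φ hv
    omega
  rw [← range_codeLinearMap k η ρ φ hN]
  refine ⟨⟨_, rfl, ?_⟩, ⟨fun A hA B hB hAB => ?_, ?_⟩⟩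
  · rw [hW]
    -- With `1 ≤ k ≤ n` the truncated expression `n - (n - k + 1) + 1` is `k`.
    congr 2
    omega
  · exact hrank _ (Submodule.sub_mem _ hA hB) (sub_ne_zero.mpr hAB)
  · have : FiniteDimensional K' (AdjoinRoot F) :=
      have : FiniteDimensional K (AdjoinRoot F) := hFm.finite_adjoinRoot
      FiniteDimensional.trans K' K (AdjoinRoot F)
    obtain ⟨A, hA, hA0, hAr⟩ := exists_rank_le hk1 hk _ hW
    refine ⟨A, hA, 0, Submodule.zero_mem _, hA0, ?_⟩
    rw [sub_zero]
    exact le_antisymm hAr (hrank A hA hA0)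

end CodeS

/-! ### Presemifields -/

section Presemifields

/-- Kaplansky's trick: fix `e ≠ 0` and define a new product by `(a ∘ e) * (e ∘ b) = a ∘ b`, which
has identity `e ∘ e`. -/
theorem IsPresemifield.exists_isotopic_isSemifield {k V : Type*} [Field k] [AddCommGroup V]
    [Module k V] {mul : V → V → V} (h : IsPresemifield k mul) :
    ∃ mul' : V → V → V, IsSemifield k mul' ∧ Isotopic mul mul' := by
  have := h.nontrivial
  obtain ⟨e, he⟩ := exists_ne (0 : V)
  let Rₑ : V →ₗ[k] V :=
    { toFun := fun a => mul a e
      map_add' := fun a b => h.add_mul a b e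
      map_smul' := fun t a => h.smul_mul t a e }
  let Lₑ : V →ₗ[k] V :=
    { toFun := fun b => mul e b
      map_add' := fun a b => h.mul_add e a b
      map_smul' := fun t a => h.mul_smul t e a }
  let R : V ≃ₗ[k] V := LinearEquiv.ofBijective Rₑ
    (Function.bijective_iff_existsUnique _ |>.mpr fun b => h.right_div e he b)
  let S : V ≃ₗ[k] V := LinearEquiv.ofBijective Lₑ
    (Function.bijective_iff_existsUnique _ |>.mpr fun b => h.left_div e he b)
  have hR : ∀ a, mul a e = R a := fun _ => rfl
  have hS : ∀ b, mul e b = S b := fun _ => rfl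
  refine ⟨fun x y => mul (R.symm x) (S.symm y), ⟨⟨h.nontrivial, ?_, ?_, ?_, ?_, ?_, ?_⟩, ?_⟩, ?_⟩
  · intro a b c
    rw [map_add, h.add_mul]
  · intro a b c
    rw [map_add, h.mul_add]
  · intro t a b
    rw [map_smul, h.smul_mul]
  · intro t a b
    rw [map_smul, h.mul_smul]
  · intro a ha b
    exact (S.symm.bijective.existsUnique_iff
      (p := fun x => mul (R.symm a) x = b)).mp
        (h.left_div _ (R.symm.map_ne_zero_iff.mpr ha) b)
  · intro a ha b
    exact (R.symm.bijective.existsUnique_iff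
      (p := fun y => mul y (S.symm a) = b)).mp
        (h.right_div _ (S.symm.map_ne_zero_iff.mpr ha) b)
  · refine ⟨mul e e, fun a => ⟨?_, ?_⟩⟩
    · rw [hR, R.symm_apply_apply, hS, S.apply_symm_apply]
    · rw [hS, S.symm_apply_apply, hR, R.apply_symm_apply]
  · refine ⟨AddEquiv.refl V, R.toAddEquiv, S.toAddEquiv, fun a b => ?_⟩
    change mul a b = mul (R.symm (R a)) (S.symm (S b))
    rw [R.symm_apply_apply, S.symm_apply_apply]

theorem isPresemifield_of_isUnit {k E : Type*} [Field k] [Field E] [Algebra k E]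
    [FiniteDimensional k E] {n : ℕ} (hn : 0 < n) (ψ : (Fin n → E) →ₗ[k] Matrix (Fin n) (Fin n) E)
    (hψ : ∀ u, u ≠ 0 → IsUnit (ψ u)) : IsPresemifield k fun u v => (ψ u).mulVec v := by
  have hn' : NeZero n := ⟨hn.ne'⟩
  refine ⟨inferInstance, ?_, ?_, ?_, ?_, ?_, ?_⟩
  · intro a b c
    rw [map_add, Matrix.add_mulVec]
  · intro a b c
    rw [Matrix.mulVec_add]
  · intro t a b
    rw [map_smul, Matrix.smul_mulVec]
  · intro t a b
    rw [Matrix.mulVec_smul]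
  · intro a ha b
    exact (Function.bijective_iff_existsUnique _).mp
      ⟨Matrix.mulVec_injective_of_isUnit (hψ a ha), Matrix.mulVec_surjective_iff_isUnit.mpr (hψ a ha)⟩ b
  · intro a ha b
    let f : (Fin n → E) →ₗ[k] (Fin n → E) :=
      { toFun := fun u => (ψ u).mulVec a
        map_add' := fun u v => by rw [map_add, Matrix.add_mulVec]
        map_smul' := fun t u => by rw [map_smul, Matrix.smul_mulVec]; rfl }
    -- Right division: invertibility of each nonzero `ψ u` makes this `k`-linear map injective, and
    -- finite dimension makes it bijective.
    have hf : Function.Injective f := by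
      rw [← LinearMap.ker_eq_bot, LinearMap.ker_eq_bot']
      intro u hu
      by_contra hu0
      exact ha (Matrix.mulVec_injective_of_isUnit (hψ u hu0) (by
        rw [Matrix.mulVec_zero]; exact hu))
    exact (Function.bijective_iff_existsUnique _).mp ⟨hf, LinearMap.injective_iff_surjective.mp hf⟩ b

variable {K' K L : Type*} [Field K'] [Field K] [Field L]
  [Algebra K' K] [Algebra K L] [Algebra K' L] [IsScalarTower K' K L] [FiniteDimensional K' K]
  {σ : L ≃ₐ[K] L}

theorem definesSemifields_codeS (hfix : ∀ a : L, σ a = a ↔ a ∈ Set.range (algebraMap K L))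
    (hpos : 0 < orderOf σ) {F : K[X]} (hFm : F.Monic) (hF : Irreducible F)
    {η : L} (ρ : L ≃ₐ[K'] L) (hc : NormCond K' σ 1 η F)
    (φ : RF σ F ≃ₐ[K] Matrix (Fin (orderOf σ)) (Fin (orderOf σ)) (AdjoinRoot F)) :
    DefinesSemifields K' (φ '' codeS σ 1 η ρ F) := by
  have : Fact (Irreducible F) := ⟨hF⟩
  have hFd := hF.natDegree_pos
  have hN : 0 < 1 * F.natDegree := Nat.mul_pos one_pos hFd
  have : FiniteDimensional K' (AdjoinRoot F) :=
    have : FiniteDimensional K (AdjoinRoot F) := hFm.finite_adjoinRoot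
    FiniteDimensional.trans K' K (AdjoinRoot F)
  have hW := finrank_range_codeLinearMap hfix hpos hFm hFd le_rfl hpos (ρ := ρ) hc φ
  -- For `k = 1` the rank bound leaves only rank `n`.
  have hunit : ∀ A ∈ LinearMap.range (codeLinearMap 1 η ρ φ), A ≠ 0 → IsUnit A := by
    rintro A ⟨v, rfl⟩ hv
    have h1 := lt_rank_of_ne_zero hfix hpos hFm hF le_rfl hc φ hv
    have h2 := (codeLinearMap 1 η ρ φ v).rank_le_card_width
    rw [Fintype.card_fin] at h2
    rw [← Matrix.linearIndependent_cols_iff_isUnit, linearIndependent_iff_card_eq_finrank_span,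
      Fintype.card_fin]
    rw [Matrix.rank_eq_finrank_span_cols] at h1 h2
    exact le_antisymm (Nat.lt_succ_iff.mp h1) h2
  rw [← range_codeLinearMap 1 η ρ φ hN]
  refine ⟨?_, fun ψ hψ hr => ?_⟩
  -- Both spaces have dimension `n [E : K']` over `K'`, so any linear isomorphism serves as a
  -- parametrisation.
  · have heq : Module.finrank K' (Fin (orderOf σ) → AdjoinRoot F) =
        Module.finrank K' (LinearMap.range (codeLinearMap 1 η ρ φ)) := by
      rw [hW, Module.finrank_pi_fintype]
      simp
    let e := LinearEquiv.ofFinrankEq _ _ heq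
    refine ⟨(LinearMap.range (codeLinearMap 1 η ρ φ)).subtype ∘ₗ e.toLinearMap,
      Subtype.val_injective.comp e.injective, ?_⟩
    rw [LinearMap.coe_comp, Set.range_comp, LinearEquiv.coe_coe, e.surjective.range_eq,
      Set.image_univ]
    exact Subtype.range_coe
  · have hpre : IsPresemifield K' fun u v => (ψ u).mulVec v := by
      refine isPresemifield_of_isUnit hpos ψ fun u hu => hunit _ ?_ ?_
      · rw [← SetLike.mem_coe, ← hr]
        exact Set.mem_range_self u
      · exact fun h => hu (hψ (h.trans (map_zero ψ).symm))
    exact ⟨hpre, hpre.exists_isotopic_isSemifield⟩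

end Presemifields

/-! ### The quotient `R_F` is central simple -/

section CentralSimple

variable {K L : Type*} [Field K] [Field L] [Algebra K L] {σ : L ≃ₐ[K] L}

/-- A nonzero left ideal contains a monic element of least degree, which generates it. -/
theorem exists_monic_generator {J : Ideal (SkewPoly σ)} (hJ : J ≠ ⊥) :
    ∃ (f : SkewPoly σ) (m : ℕ), HasDegree f m ∧ coeff f m = 1 ∧ f ∈ J ∧
      (∀ p ∈ J, p ∈ degLT σ m → p = 0) ∧ J = Ideal.span {f} := by
  classical
  obtain ⟨p, hpJ, hp0⟩ := (Submodule.ne_bot_iff _).mp hJ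
  have hex : ∃ m, ∃ p ∈ J, HasDegree p m := by
    obtain ⟨m, hm⟩ := exists_hasDegree hp0
    exact ⟨m, p, hpJ, hm⟩
  obtain ⟨f, hfJ, hf⟩ := Nat.find_spec hex
  set m := Nat.find hex
  have hmin : ∀ p ∈ J, p ∈ degLT σ m → p = 0 := by
    intro p hp hpm
    by_contra h0
    obtain ⟨l, hl⟩ := exists_hasDegree h0
    exact Nat.find_min hex (hl.lt_of_mem hpm) ⟨p, hp, hl⟩
  set g := const σ (coeff f m)⁻¹ * f
  have hgJ : g ∈ J := J.mul_mem_left _ hfJ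
  have hg1 : coeff g m = 1 := by rw [coeff_const_mul, inv_mul_cancel₀ hf.1]
  have hg : HasDegree g m := by
    refine ⟨by rw [hg1]; exact one_ne_zero, fun i hi => ?_⟩
    rw [coeff_const_mul, hf.2 i hi, mul_zero]
  refine ⟨g, m, hg, hg1, hgJ, hmin, le_antisymm (fun p hp => ?_) ?_⟩
  · obtain ⟨r, hr⟩ := exists_remainder hg p
    have hrJ : (r : SkewPoly σ) ∈ J := by
      have h1 : p - r ∈ J := (Ideal.span_singleton_le_iff_mem J).mpr hgJ hr
      simpa using J.sub_mem hp h1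
    rw [hmin _ hrJ r.2, sub_zero] at hr
    exact hr
  · exact (Ideal.span_singleton_le_iff_mem J).mpr hgJ

/-- The centre of `R` is `K[x ^ n]`: commuting with constants leaves only exponents divisible by `n`
(`dvd_of_mul_const_eq`), and commuting with `x` puts the coefficients in `K`
(`apply_coeff_of_commute_X`). -/
theorem exists_evalXPow_eq (hfix : ∀ a : L, σ a = a ↔ a ∈ Set.range (algebraMap K L))
    {p : SkewPoly σ} (h1 : ∀ i, coeff p i ≠ 0 → orderOf σ ∣ i)
    (h2 : ∀ i, σ (coeff p i) = coeff p i) : ∃ g : K[X], evalXPow σ g = p := by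
  have hmon : ∀ i, ∃ g : K[X], evalXPow σ g = mon σ i (coeff p i) := by
    intro i
    by_cases h0 : coeff p i = 0
    · exact ⟨0, by rw [h0, map_zero]; exact map_zero _⟩
    · obtain ⟨j, hj⟩ := h1 i h0
      obtain ⟨t, ht⟩ := (hfix _).mp (h2 i)
      exact ⟨monomial j t, by rw [evalXPow_monomial, ht, hj]⟩
  choose g hg using hmon
  obtain ⟨N, hN⟩ := exists_mem_degLT p
  refine ⟨∑ i ∈ Finset.range N, g i, ?_⟩
  rw [eq_sum_mon hN, evalXPow, map_sum]
  exact Finset.sum_congr rfl fun i _ => hg i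

theorem dvd_of_mul_const_eq {p : SkewPoly σ}
    (h : ∀ a : L, ∀ i, coeff p i * (σ ^ i) a = a * coeff p i) {i : ℕ} (hi : coeff p i ≠ 0) :
    orderOf σ ∣ i := by
  refine orderOf_dvd_of_pow_eq_one (AlgEquiv.ext fun a => ?_)
  exact mul_left_cancel₀ hi ((h a i).trans (mul_comm _ _))

theorem coeff_zero_ne_zero_of_irreducible {F : K[X]} (hFm : F.Monic) (hF : Irreducible F)
    (hX : F ≠ X) : F.coeff 0 ≠ 0 := by
  intro h0
  exact hX (eq_of_monic_of_associated hFm monic_X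
    ((irreducible_X.associated_of_dvd hF (X_dvd_iff.mpr h0)).symm))

theorem apply_coeff_of_commute_X {p : SkewPoly σ}
    (h : SkewPolynomial.X * p = p * SkewPolynomial.X) (i : ℕ) : σ (coeff p i) = coeff p i := by
  rw [← coeff_X_mul, h, coeff_mul_X]

/-- A right divisible two-sided ideal containing `F(x ^ n)`, `F ≠ y`, is `R` or `R F(x ^ n)`. -/
theorem le_span_or_one_mem (hfix : ∀ a : L, σ a = a ↔ a ∈ Set.range (algebraMap K L))
    (hpos : 0 < orderOf σ) {F : K[X]} (hFm : F.Monic) (hF : Irreducible F) (hX : F ≠ X)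
    (J : Ideal (SkewPoly σ)) (hJr : ∀ a ∈ J, ∀ b, a * b ∈ J) (hFJ : evalXPow σ F ∈ J) :
    J ≤ Ideal.span {evalXPow σ F} ∨ (1 : SkewPoly σ) ∈ J := by
  have hF0 := coeff_zero_ne_zero_of_irreducible hFm hF hX
  have hJ : J ≠ ⊥ := fun h =>
    evalXPow_ne_zero hpos hFm.ne_zero ((Submodule.mem_bot _).mp (h ▸ hFJ))
  obtain ⟨f, m, hf, hf1, hfJ, hmin, hspan⟩ := exists_monic_generator hJ
  -- Otherwise `f = g x`. Since `F(x ^ n) = x w + F_0` with `F_0 ≠ 0`, the ideal contains `g F_0 = g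
  -- F(x ^ n) - f w`, hence `g`, of smaller degree than `f`.
  have hf0 : coeff f 0 ≠ 0 := by
    intro h0
    have hm0 : m ≠ 0 := by rintro rfl; exact hf.1 h0
    obtain ⟨l, rfl⟩ := Nat.exists_eq_succ_of_ne_zero hm0
    set g := ofVec σ (l + 1) fun i => coeff f (i + 1) with hg
    have hgX : g * SkewPolynomial.X = f := by
      refine coeff_ext fun i => ?_
      rcases i with _ | i
      · rw [coeff_mul_X_zero, h0]
      · rw [coeff_mul_X, hg, coeff_ofVec]
        split_ifs with hi
        · rfl
        · exact (hf.2 _ (by omega)).symm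
    obtain ⟨w, hw⟩ : ∃ w, evalXPow σ F =
        SkewPolynomial.X * w + const σ (algebraMap K L (F.coeff 0)) := by
      refine ⟨SkewPolynomial.X ^ (orderOf σ - 1) * evalXPow σ F.divX, ?_⟩
      rw [← mul_assoc, ← pow_succ', Nat.sub_add_cancel hpos, ← algebraMap_eq_const, evalXPow,
        evalXPow]
      conv_lhs => rw [← F.X_mul_divX_add, map_add, map_mul, aeval_X, aeval_C]
    have hgJ : g * const σ (algebraMap K L (F.coeff 0)) ∈ J := by
      have h1 : g * evalXPow σ F ∈ J := J.mul_mem_left _ hFJ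
      have h2 : g * SkewPolynomial.X * w ∈ J := hJr _ (hgX ▸ hfJ) w
      rw [hw, mul_add, ← mul_assoc] at h1
      simpa using J.sub_mem h1 h2
    have hgJ' : g ∈ J := by
      have := hJr _ hgJ (const σ (algebraMap K L (F.coeff 0))⁻¹)
      rwa [mul_assoc, ← const_mul, mul_inv_cancel₀, const_one, mul_one] at this
      simpa using hF0
    have hg0 : g = 0 := by
      refine hmin g hgJ' fun i hi => ?_
      exact ofVec_mem _ i hi
    rw [hg0, zero_mul] at hgX
    exact hf.ne_zero hgX.symm
  -- The top terms of `f a` and `σ ^ m (a) f` cancel, so the difference is an element of `J` of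
  -- degree less than `m`, hence zero. At `i = 0` this gives `σ ^ m = 1`, as `f_0 ≠ 0`.
  have hconst : ∀ a : L, ∀ i, coeff f i * (σ ^ i) a = (σ ^ m) a * coeff f i := by
    intro a i
    have h0 : f * const σ a - const σ ((σ ^ m) a) * f = 0 := by
      refine hmin _ (J.sub_mem (hJr _ hfJ _) (J.mul_mem_left _ hfJ)) fun j hj => ?_
      rw [coeff_sub, coeff_mul_const, coeff_const_mul]
      rcases hj.eq_or_lt with rfl | hj
      · ring
      · rw [hf.2 j hj]; ring
    have h1 := congrArg (fun q => coeff q i) h0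
    simp only [coeff_sub, coeff_mul_const, coeff_const_mul, coeff_zero] at h1
    exact sub_eq_zero.mp h1
  have hσm : ∀ a : L, (σ ^ m) a = a := by
    intro a
    have := hconst a 0
    rw [pow_zero, AlgEquiv.one_apply, mul_comm] at this
    exact (mul_right_cancel₀ hf0 this).symm
  simp only [hσm] at hconst
  -- As `f` is monic, the commutator has degree at most `m`, so by minimality it is a constant
  -- multiple of `f`; its constant term is zero and `f_0 ≠ 0`, so the multiple is zero.
  have hcomm : SkewPolynomial.X * f = f * SkewPolynomial.X := by
    set d := SkewPolynomial.X * f - f * SkewPolynomial.X with hd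
    have hdJ : d ∈ J := J.sub_mem (J.mul_mem_left _ hfJ) (hJr _ hfJ _)
    have hd0 : d - const σ (coeff d m) * f = 0 := by
      refine hmin _ (J.sub_mem hdJ (J.mul_mem_left _ hfJ)) fun j hj => ?_
      rw [coeff_sub, coeff_const_mul]
      rcases hj.eq_or_lt with rfl | hj
      · rw [hf1, mul_one, sub_self]
      · obtain ⟨l, rfl⟩ : ∃ l, j = l + 1 := ⟨j - 1, by omega⟩
        rw [hf.2 _ hj, mul_zero, sub_zero, hd, coeff_sub, coeff_X_mul, coeff_mul_X]
        rcases (show m = l ∨ m < l by omega) with rfl | hl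
        · rw [hf1, map_one, sub_self]
        · rw [hf.2 l hl, map_zero, sub_self]
    have h0 := congrArg (fun q => coeff q 0) hd0
    simp only [coeff_sub, coeff_const_mul, coeff_zero] at h0
    rw [hd, coeff_sub, coeff_X_mul_zero, coeff_mul_X_zero, sub_self, zero_sub, neg_eq_zero,
      ← hd] at h0
    rw [(mul_eq_zero.mp h0).resolve_right hf0, ← mon_zero, map_zero, zero_mul, sub_zero] at hd0
    exact sub_eq_zero.mp hd0
  obtain ⟨g, hg⟩ := exists_evalXPow_eq hfix (fun i hi => dvd_of_mul_const_eq hconst hi)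
    (apply_coeff_of_commute_X hcomm)
  -- The generator of `J` is now central, `f = g(x ^ n)`, and the dichotomy is that of the maximal
  -- ideal `(F)` in `K[y]`.
  by_cases hdvd : F ∣ g
  · left
    obtain ⟨h, rfl⟩ := hdvd
    rw [hspan, Ideal.span_singleton_le_iff_mem, ← hg, mul_comm, evalXPow_mul]
    exact Ideal.mem_span_singleton'.mpr ⟨_, rfl⟩
  · right
    obtain ⟨a, b, hab⟩ := (hF.coprime_iff_not_dvd).mpr hdvd
    have h1 : evalXPow σ (a * F + b * g) = evalXPow σ a * evalXPow σ F + evalXPow σ b * f := by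
      rw [← hg, ← evalXPow_mul, ← evalXPow_mul]
      exact map_add _ _ _
    rw [hab] at h1
    have h2 : evalXPow σ (1 : K[X]) = 1 := map_one _
    rw [← h2, h1]
    exact J.add_mem (J.mul_mem_left _ hFJ) (J.mul_mem_left _ hfJ)

theorem nontrivial_RF (hpos : 0 < orderOf σ) {F : K[X]} (hF : Irreducible F) :
    Nontrivial (RF σ F) := by
  refine ⟨⟨mk σ F 1, 0, fun h => ?_⟩⟩
  have h1 := mk_eq_zero_iff.mp h
  have h2 := eq_zero_of_mem_span (hasDegree_evalXPow hpos hF.ne_zero) (fun i hi => ?_) h1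
  · have := congrArg (fun p => coeff p 0) h2
    simp [coeff_one] at this
  · have := Nat.mul_pos hpos hF.natDegree_pos
    rw [coeff_one, if_neg (by omega)]

theorem isSimpleRing_RF (hfix : ∀ a : L, σ a = a ↔ a ∈ Set.range (algebraMap K L))
    (hpos : 0 < orderOf σ) {F : K[X]} (hFm : F.Monic) (hF : Irreducible F) (hX : F ≠ X) :
    IsSimpleRing (RF σ F) := by
  have := nontrivial_RF hpos hF
  refine IsSimpleRing.of_eq_bot_or_eq_top fun I => ?_
  let J : Ideal (SkewPoly σ) :=
    { carrier := {p | mkₐ σ F p ∈ I}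
      add_mem' := fun {p q} hp hq => by
        rw [Set.mem_ofPred_eq, map_add]
        exact I.add_mem hp hq
      zero_mem' := by
        rw [Set.mem_ofPred_eq, map_zero]
        exact I.zero_mem
      smul_mem' := fun c p hp => by
        rw [Set.mem_ofPred_eq, smul_eq_mul, map_mul]
        exact I.mul_mem_left _ _ hp }
  have hJ : ∀ p, p ∈ J ↔ mkₐ σ F p ∈ I := fun _ => Iff.rfl
  have hFJ : evalXPow σ F ∈ J := by
    rw [hJ, mkₐ_apply, mk_eq_zero_iff.mpr (Ideal.mem_span_singleton_self _)]
    exact I.zero_mem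
  rcases le_span_or_one_mem hfix hpos hFm hF hX J (fun a ha b => by
    rw [hJ, map_mul]
    exact I.mul_mem_right _ _ ha) hFJ with h | h
  · left
    refine TwoSidedIdeal.ext fun u => ⟨fun hu => ?_, fun hu => ?_⟩
    · obtain ⟨p, rfl⟩ := mk_surjective F u
      rw [TwoSidedIdeal.mem_bot]
      exact mk_eq_zero_iff.mpr (h hu)
    · rw [TwoSidedIdeal.mem_bot] at hu
      rw [hu]
      exact I.zero_mem
  · right
    rw [hJ, map_one] at h
    refine TwoSidedIdeal.ext fun u => ⟨fun _ => TwoSidedIdeal.mem_top _, fun _ => ?_⟩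
    simpa using I.mul_mem_left u 1 h

/-- The embedding of `E_F` in the center of `R_F`. -/
def centerEmbedding (σ : L ≃ₐ[K] L) (F : K[X]) : AdjoinRoot F →ₐ[K] RF σ F :=
  Ideal.Quotient.liftₐ (Ideal.span {F})
    ((mkₐ σ F).comp (aeval ((SkewPolynomial.X : SkewPoly σ) ^ orderOf σ))) (by
      intro g hg
      obtain ⟨h, rfl⟩ := Ideal.mem_span_singleton'.mp hg
      exact mk_eq_zero_iff'.mpr ⟨evalXPow σ h, evalXPow_mul h F⟩)

theorem centerEmbedding_mk (F g : K[X]) :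
    centerEmbedding σ F (AdjoinRoot.mk F g) = mk σ F (evalXPow σ g) :=
  rfl

theorem centerEmbedding_injective (hpos : 0 < orderOf σ) {F : K[X]} (hF : Irreducible F) :
    Function.Injective (centerEmbedding σ F) := by
  have : Fact (Irreducible F) := ⟨hF⟩
  have := nontrivial_RF hpos hF
  exact (centerEmbedding σ F).toRingHom.injective

/-- Represent a central class by `p` of degree less than `n s`. Commutators with constants stay
below degree `n s`, so they vanish in `R`. The commutator with `x` may reach degree `n s` and be `c
F(x ^ n)` with `c` constant, but its constant term is zero and `F_0 ≠ 0`. So `p` itself is central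
in `R`. -/
theorem range_centerEmbedding (hfix : ∀ a : L, σ a = a ↔ a ∈ Set.range (algebraMap K L))
    (hpos : 0 < orderOf σ) {F : K[X]} (hFm : F.Monic) (hF : Irreducible F) (hX : F ≠ X) :
    (centerEmbedding σ F).range = Subalgebra.center K (RF σ F) := by
  have hF0 := coeff_zero_ne_zero_of_irreducible hFm hF hX
  have hdeg := hasDegree_evalXPow hpos hFm.ne_zero (σ := σ)
  ext u
  rw [AlgHom.mem_range, Subalgebra.mem_center_iff]
  constructor
  · rintro ⟨e, rfl⟩ b
    obtain ⟨g, rfl⟩ := AdjoinRoot.mk_surjective e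
    obtain ⟨p, rfl⟩ := mk_surjective F b
    rw [centerEmbedding_mk, ← mkₐ_apply, ← mkₐ_apply, ← map_mul, ← map_mul, evalXPow_comm]
  · intro hu
    obtain ⟨v, hv⟩ := (mk_ofVec_bijective hpos hFm.ne_zero).2 u
    set p := ofVec σ (orderOf σ * F.natDegree) v
    have hp : p ∈ degLT σ (orderOf σ * F.natDegree) := ofVec_mem v
    have hpu : mkₐ σ F p = u := hv
    have hspan : ∀ b, b * p - p * b ∈ Ideal.span {evalXPow σ F} := by
      intro b
      rw [← mk_eq_zero_iff, ← mkₐ_apply, map_sub, map_mul, map_mul, hpu, hu, sub_self]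
    have hconst : ∀ a : L, ∀ i, coeff p i * (σ ^ i) a = a * coeff p i := by
      intro a i
      have h0 := eq_zero_of_mem_span hdeg (fun j hj => by
        rw [coeff_sub, coeff_const_mul, coeff_mul_const, hp j hj]; ring) (hspan (const σ a))
      have h1 := congrArg (fun q => coeff q i) h0
      simp only [coeff_sub, coeff_mul_const, coeff_const_mul, coeff_zero] at h1
      exact (sub_eq_zero.mp h1).symm
    have hcomm : SkewPolynomial.X * p = p * SkewPolynomial.X := by
      obtain ⟨c, hc⟩ := Ideal.mem_span_singleton'.mp (hspan SkewPolynomial.X)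
      have hc0 : coeff c 0 = 0 := by
        have h1 := congrArg (fun q => coeff q 0) hc
        simp only [coeff_sub, coeff_mul_zero c, coeff_X_mul_zero, coeff_mul_X_zero, sub_self,
          coeff_evalXPow_zero hpos] at h1
        exact (mul_eq_zero.mp h1).resolve_right (by simpa using hF0)
      have hcz : c = 0 := by
        by_contra hne
        obtain ⟨m, hm⟩ := exists_hasDegree hne
        have hlt := (hm.mul hdeg).lt_of_mem (N := orderOf σ * F.natDegree + 1) (fun j hj => by
          obtain ⟨l, rfl⟩ : ∃ l, j = l + 1 := ⟨j - 1, by omega⟩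
          rw [hc, coeff_sub, coeff_X_mul, coeff_mul_X, hp l (by omega), map_zero, sub_self])
        obtain rfl : m = 0 := by omega
        exact hm.1 hc0
      rw [hcz, zero_mul] at hc
      exact sub_eq_zero.mp hc.symm
    obtain ⟨g, hg⟩ := exists_evalXPow_eq hfix (fun i hi => dvd_of_mul_const_eq hconst hi)
      (apply_coeff_of_commute_X hcomm)
    exact ⟨AdjoinRoot.mk F g, by rw [centerEmbedding_mk, hg, ← mkₐ_apply, hpu]⟩

/-- Here `E_F` embeds in `R_F` with the same dimension over `K`, so they coincide; this also covers
`F = y`. -/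
theorem nonempty_algEquiv_of_orderOf_eq_one
    (hfix : ∀ a : L, σ a = a ↔ a ∈ Set.range (algebraMap K L)) {n : ℕ} (hn : orderOf σ = n)
    (hn1 : n = 1) {F : K[X]} (hFm : F.Monic) (hF : Irreducible F) :
    Nonempty (RF σ F ≃ₐ[K] Matrix (Fin n) (Fin n) (AdjoinRoot F)) := by
  subst hn1
  have hpos : 0 < orderOf σ := by omega
  have := finiteDimensional_RF hfix hpos hFm.ne_zero
  have : FiniteDimensional K (AdjoinRoot F) := hFm.finite_adjoinRoot
  have hinj := centerEmbedding_injective (σ := σ) hpos hF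
  have hfr : Module.finrank K (AdjoinRoot F) = Module.finrank K (RF σ F) := by
    rw [finrank_RF hfix hpos hFm.ne_zero, hn, (AdjoinRoot.powerBasis hFm.ne_zero).finrank,
      AdjoinRoot.powerBasis_dim]
    simp
  have hsurj : Function.Surjective (centerEmbedding σ F) :=
    (LinearMap.injective_iff_surjective_of_finrank_eq_finrank
      (f := (centerEmbedding σ F).toLinearMap) hfr).mp hinj
  have : Fact (Irreducible F) := ⟨hF⟩
  have hsc : Function.Bijective
      (IsScalarTower.toAlgHom K (AdjoinRoot F) (Matrix (Fin 1) (Fin 1) (AdjoinRoot F))) := by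
    refine ⟨RingHom.injective _, fun M => ⟨M 0 0, ?_⟩⟩
    ext i j
    rw [Subsingleton.elim i 0, Subsingleton.elim j 0, IsScalarTower.coe_toAlgHom',
      Matrix.algebraMap_matrix_apply, if_pos rfl]
    rfl
  exact ⟨(AlgEquiv.ofBijective _ ⟨hinj, hsurj⟩).symm.trans (AlgEquiv.ofBijective _ hsc)⟩

/-- Wedderburn–Artin gives `R_F ≅ M_m(D)`. The finite division ring `D` is a field, hence it is the
centre, which is `E_F`; counting dimensions over `K` gives `m = n`. -/
theorem nonempty_algEquiv_of_finite [Finite L]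
    (hfix : ∀ a : L, σ a = a ↔ a ∈ Set.range (algebraMap K L)) (hpos : 0 < orderOf σ)
    {F : K[X]} (hFm : F.Monic) (hF : Irreducible F) (hX : F ≠ X) :
    Nonempty (RF σ F ≃ₐ[K] Matrix (Fin (orderOf σ)) (Fin (orderOf σ)) (AdjoinRoot F)) := by
  have := finiteDimensional_of_fixed hfix hpos
  have := finiteDimensional_RF hfix hpos hFm.ne_zero
  have : Finite K := Finite.of_injective _ (algebraMap K L).injective
  have : IsArtinianRing (RF σ F) := IsArtinianRing.of_finite K (RF σ F)
  have := isSimpleRing_RF hfix hpos hFm hF hX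
  obtain ⟨m, hm, D, _, _, _, ⟨e⟩⟩ :=
    IsSimpleRing.exists_algEquiv_matrix_divisionRing_finite K (RF σ F)
  have hDfin : Finite D := Module.finite_of_finite K
  have hcommD : ∀ a b : D, a * b = b * a := (littleWedderburn D).mul_comm
  let g : D →ₐ[K] Matrix (Fin m) (Fin m) D :=
    { Matrix.scalar (Fin m) with
      commutes' := fun t => by
        ext1 i j
        simp [Matrix.algebraMap_matrix_apply, Matrix.diagonal_apply] }
  have hg : ∀ d, g d = Matrix.scalar (Fin m) d := fun _ => rfl
  have hginj : Function.Injective (e.symm.toAlgHom.comp g) := by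
    refine e.symm.injective.comp fun a b h => ?_
    have := congrFun (congrFun h 0) 0
    simpa [hg] using this
  have hrange : (centerEmbedding σ F).range = (e.symm.toAlgHom.comp g).range := by
    rw [range_centerEmbedding hfix hpos hFm hF hX]
    ext u
    rw [AlgHom.mem_range, Subalgebra.mem_center_iff]
    constructor
    · intro hu
      obtain ⟨d, hd⟩ := (Matrix.mem_range_scalar_iff_commute_single'
        (M := e u)).mpr fun i j => by
          have := hu (e.symm (Matrix.single i j 1))
          have := congrArg e this
          simpa [Commute, SemiconjBy] using this
      exact ⟨d, by
        change e.symm (g d) = u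
        rw [hg, hd, e.symm_apply_apply]⟩
    · rintro ⟨d, rfl⟩ b
      change b * e.symm (g d) = e.symm (g d) * b
      refine e.injective ?_
      rw [map_mul, map_mul, e.apply_symm_apply, hg]
      exact (Matrix.scalar_commute d (fun r => hcommD d r) (e b)).eq.symm
  let ε : D ≃ₐ[K] AdjoinRoot F := (AlgEquiv.ofInjective _ hginj).trans
    ((Subalgebra.equivOfEq _ _ hrange.symm).trans
      (AlgEquiv.ofInjective _ (centerEmbedding_injective hpos hF)).symm)
  let φ : RF σ F ≃ₐ[K] Matrix (Fin m) (Fin m) (AdjoinRoot F) := e.trans ε.mapMatrix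
  have hfr := φ.toLinearEquiv.finrank_eq
  have : FiniteDimensional K (AdjoinRoot F) := hFm.finite_adjoinRoot
  rw [finrank_RF hfix hpos hFm.ne_zero, Module.finrank_matrix, Fintype.card_fin,
    (AdjoinRoot.powerBasis hFm.ne_zero).finrank, AdjoinRoot.powerBasis_dim] at hfr
  obtain rfl : m = orderOf σ :=
    (Nat.mul_self_inj.mp (Nat.eq_of_mul_eq_mul_right hF.natDegree_pos hfr)).symm
  exact ⟨φ⟩

end CentralSimple

/-! ### Cyclic semifields -/

section Petit

/-- Matrices supported on one column form a left ideal isomorphic to `E ^ n`; applying them to a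
vector `w` not killed by a matrix unit maps `E ^ n` into `U`. A nonzero `v` is not killed, since
some matrix carries it to the basis vector. -/
theorem exists_equivariant_injective {K E U : Type*} [Field K] [Field E] [Algebra K E]
    [AddCommGroup U] [Module K U] [Nontrivial U] {n : ℕ} (hn : 0 < n)
    (T : Matrix (Fin n) (Fin n) E →ₐ[K] Module.End K U) :
    ∃ Θ : (Fin n → E) →ₗ[K] U, Function.Injective Θ ∧ ∀ M v, Θ (M.mulVec v) = T M (Θ v) := by
  have : NeZero n := ⟨hn.ne'⟩
  have hTe : T (colMatrix 0 (Pi.single 0 1)) ≠ 0 := fun h =>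
    colMatrix_single_ne_zero (E := E) (0 : Fin n)
      ((map_eq_zero_iff T T.toRingHom.injective).mp h)
  obtain ⟨w, hw⟩ : ∃ w, T (colMatrix 0 (Pi.single 0 1)) w ≠ 0 := by
    by_contra hc
    push Not at hc
    exact hTe (LinearMap.ext hc)
  refine ⟨{ toFun := fun v => T (colMatrix 0 v) w
            map_add' := fun v v' => by rw [colMatrix_add, map_add]; rfl
            map_smul' := fun t v => ?_ }, ?_, fun M v => ?_⟩
  · have : colMatrix (0 : Fin n) (t • v) = t • colMatrix 0 v := Matrix.smul_vecMulVec _ _ _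
    rw [this, map_smul]
    rfl
  · rw [← LinearMap.ker_eq_bot, LinearMap.ker_eq_bot']
    intro v hv
    by_contra hv0
    have hli : LinearIndependent E fun _ : Fin 1 => v := by
      simpa [linearIndependent_unique_iff] using hv0
    obtain ⟨N, hN⟩ := exists_mulVec_eq_single (0 : Fin n) hli
    have h1 := congrArg (T (N 0)) hv
    rw [map_zero] at h1
    change (T (N 0) * T (colMatrix 0 v)) w = 0 at h1
    rw [← map_mul, mul_colMatrix, hN, if_pos rfl] at h1
    exact hw h1
  · change T (colMatrix 0 (M.mulVec v)) w = (T M * T (colMatrix 0 v)) w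
    rw [← map_mul, mul_colMatrix]

variable {K' K L : Type*} [Field K'] [Field K] [Field L] [Algebra K L] [Algebra K' L]
  {σ : L ≃ₐ[K] L}

/-- `R / R f` as a representation of `R_F`, for `F(x ^ n) ∈ R f`. -/
def quotRep {F : K[X]} {f : SkewPoly σ} (hFf : evalXPow σ F ∈ Ideal.span {f}) :
    RF σ F →ₐ[K] Module.End K (SkewPoly σ ⧸ Submodule.span (SkewPoly σ) {f}) :=
  Ideal.Quotient.liftₐ (centralIdeal σ F) (Algebra.lsmul K K _) (by
    intro a ha
    obtain ⟨c, rfl⟩ := Ideal.mem_span_singleton'.mp ha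
    refine LinearMap.ext fun u => ?_
    obtain ⟨p, rfl⟩ := Submodule.mkQ_surjective _ u
    change Submodule.Quotient.mk (c * evalXPow σ F * p) = 0
    rw [Submodule.Quotient.mk_eq_zero, mul_assoc, evalXPow_comm, ← mul_assoc]
    exact Ideal.mul_mem_left _ _ hFf)

theorem quotRep_mk {F : K[X]} {f : SkewPoly σ} (hFf : evalXPow σ F ∈ Ideal.span {f})
    (a b : SkewPoly σ) :
    quotRep hFf (mk σ F a) (Submodule.Quotient.mk b) = Submodule.Quotient.mk (a * b) :=
  rfl

/-- The remainders modulo `f` represent the classes modulo `R f`. -/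
def degLTEquivQuot {f : SkewPoly σ} {s : ℕ} (hf : HasDegree f s) :
    degLT σ s ≃+ SkewPoly σ ⧸ Submodule.span (SkewPoly σ) {f} :=
  AddEquiv.ofBijective
    ((Submodule.span (SkewPoly σ) {f}).mkQ.toAddMonoidHom.comp (degLT σ s).subtype) (by
      constructor
      · rw [injective_iff_map_eq_zero]
        intro a ha
        exact Subtype.ext (eq_zero_of_mem_span hf a.2 ((Submodule.Quotient.mk_eq_zero _).mp ha))
      · intro u
        obtain ⟨p, rfl⟩ := Submodule.mkQ_surjective _ u
        obtain ⟨r, hr⟩ := exists_remainder hf p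
        exact ⟨r, ((Submodule.Quotient.eq _).mpr hr).symm⟩)

theorem degLTEquivQuot_apply {f : SkewPoly σ} {s : ℕ} (hf : HasDegree f s) (a : degLT σ s) :
    degLTEquivQuot hf a = Submodule.Quotient.mk (a : SkewPoly σ) :=
  rfl

theorem degLTEquivQuot_petitMul {f : SkewPoly σ} {s : ℕ} (hf : HasDegree f s)
    (a b : degLT σ s) :
    degLTEquivQuot hf (petitMul hf a b) = Submodule.Quotient.mk (a * b : SkewPoly σ) :=
  ((Submodule.Quotient.eq _).mpr (petitMul_spec hf a b)).symm

theorem petitMul_eq_of_mem {f : SkewPoly σ} {s : ℕ} (hf : HasDegree f s) {a b : degLT σ s}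
    (h : (a * b : SkewPoly σ) ∈ degLT σ s) : petitMul hf a b = ⟨a * b, h⟩ := by
  refine Subtype.ext (sub_eq_zero.mp ?_).symm
  exact eq_zero_of_mem_span hf ((degLT σ s).sub_mem h (petitMul hf a b).2) (petitMul_spec hf a b)

theorem codeS_one_zero (ρ : L ≃ₐ[K'] L) (F : K[X]) :
    codeS σ 1 0 ρ F = {u | ∃ a ∈ degLT σ F.natDegree, u = mk σ F a} := by
  ext u
  constructor
  · rintro ⟨a, h1, h2, rfl⟩
    refine ⟨a, fun i hi => ?_, rfl⟩
    rw [one_mul] at h1 h2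
    rcases hi.eq_or_lt with rfl | hi
    · rw [h2, zero_mul]
    · exact h1 i hi
  · rintro ⟨a, ha, rfl⟩
    refine ⟨a, fun i hi => ha i (by omega), ?_, rfl⟩
    rw [one_mul, ha _ le_rfl, zero_mul]

/-- `R / R f` and `E_F ^ n` both have dimension `n s` over `K`, so the equivariant embedding is an
isomorphism. Under it the matrix of `a` becomes left multiplication by `a` on `R / R f`, which is `a
∘ b` on remainders. -/
theorem isSpreadSetOf_petitMul (hfix : ∀ a : L, σ a = a ↔ a ∈ Set.range (algebraMap K L))
    (hpos : 0 < orderOf σ) (ρ : L ≃ₐ[K'] L) {F : K[X]} (hFm : F.Monic) (hF : Irreducible F)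
    {f : SkewPoly σ} {s : ℕ} (hs : F.natDegree = s) (hf : HasDegree f s)
    (hFf : evalXPow σ F ∈ Ideal.span {f})
    (φ : RF σ F ≃ₐ[K] Matrix (Fin (orderOf σ)) (Fin (orderOf σ)) (AdjoinRoot F)) :
    IsSpreadSetOf (φ '' codeS σ 1 0 ρ F) (petitMul hf) := by
  subst hs
  have : Fact (Irreducible F) := ⟨hF⟩
  have := finiteDimensional_of_fixed hfix hpos
  have : FiniteDimensional K (AdjoinRoot F) := hFm.finite_adjoinRoot
  have : Nonempty (Fin F.natDegree) := ⟨⟨0, hF.natDegree_pos⟩⟩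
  have : Nontrivial (SkewPoly σ ⧸ Submodule.span (SkewPoly σ) {f}) :=
    (vecEquivQuot (K := K) hf).symm.toEquiv.nontrivial
  have : FiniteDimensional K (SkewPoly σ ⧸ Submodule.span (SkewPoly σ) {f}) :=
    (vecEquivQuot (K := K) hf).finiteDimensional
  obtain ⟨Θ, hΘ, hΘM⟩ := exists_equivariant_injective hpos
    ((quotRep hFf).comp φ.symm.toAlgHom)
  have hfr : Module.finrank K (Fin (orderOf σ) → AdjoinRoot F) =
      Module.finrank K (SkewPoly σ ⧸ Submodule.span (SkewPoly σ) {f}) := by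
    rw [← (vecEquivQuot (K := K) hf).finrank_eq, Module.finrank_pi_fintype,
      Module.finrank_pi_fintype, (AdjoinRoot.powerBasis hFm.ne_zero).finrank,
      AdjoinRoot.powerBasis_dim, finrank_of_fixed hfix]
    simp [mul_comm]
  let Θ' := LinearEquiv.ofBijective Θ
    ⟨hΘ, (LinearMap.injective_iff_surjective_of_finrank_eq_finrank hfr).mp hΘ⟩
  let B : degLT σ F.natDegree ≃+ (Fin (orderOf σ) → AdjoinRoot F) :=
    (degLTEquivQuot hf).trans Θ'.symm.toAddEquiv
  have hΘB : ∀ b, Θ (B b) = degLTEquivQuot hf b := fun b => Θ'.apply_symm_apply _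
  have key : ∀ a b : degLT σ F.natDegree,
      (φ (mk σ F a)).mulVec (B b) = B (petitMul hf a b) := by
    intro a b
    refine hΘ ?_
    rw [hΘM, hΘB, hΘB, degLTEquivQuot_petitMul]
    change quotRep hFf (φ.symm (φ (mk σ F a))) _ = _
    rw [φ.symm_apply_apply, degLTEquivQuot_apply, quotRep_mk]
  rw [codeS_one_zero]
  refine ⟨B, fun a => ⟨_, ⟨_, ⟨a, a.2, rfl⟩, rfl⟩, key a⟩, ?_⟩
  rintro _ ⟨_, ⟨a, ha, rfl⟩, rfl⟩
  exact ⟨⟨a, ha⟩, key ⟨a, ha⟩⟩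

/-- An irreducible skew polynomial generates a maximal left ideal. -/
theorem eq_span_or_eq_top_of_irreducible {f : SkewPoly σ} (hirr : Irreducible f)
    {N : Ideal (SkewPoly σ)} (hN : f ∈ N) : N = Ideal.span {f} ∨ N = ⊤ := by
  have hN0 : N ≠ ⊥ := fun h => hirr.ne_zero ((Submodule.mem_bot _).mp (h ▸ hN))
  obtain ⟨g, m, _, _, hgN, _, hspan⟩ := exists_monic_generator hN0
  rw [hspan] at hN
  obtain ⟨c, hc⟩ := Ideal.mem_span_singleton'.mp hN
  rcases hirr.isUnit_or_isUnit hc.symm with hu | hu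
  · left
    refine le_antisymm ?_ ?_
    · rw [hspan, Ideal.span_singleton_le_iff_mem, Ideal.mem_span_singleton']
      obtain ⟨u, rfl⟩ := hu
      exact ⟨(u⁻¹ : (SkewPoly σ)ˣ), by rw [← hc, ← mul_assoc, Units.inv_mul, one_mul]⟩
    · rw [Ideal.span_singleton_le_iff_mem, hspan]
      exact hN
  · right
    exact Ideal.eq_top_of_isUnit_mem _ hgN hu

theorem one_notMem_span_of_irreducible {f : SkewPoly σ} (hirr : Irreducible f) :
    (1 : SkewPoly σ) ∉ Ideal.span {f} := by
  intro h
  obtain ⟨c, hc⟩ := Ideal.mem_span_singleton'.mp h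
  have hc0 : c ≠ 0 := by
    rintro rfl
    rw [zero_mul] at hc
    have := congrArg (fun p => coeff p 0) hc
    simp [coeff_one] at this
  obtain ⟨m, hm⟩ := exists_hasDegree hc0
  obtain ⟨s, hf⟩ := exists_hasDegree hirr.ne_zero
  have := (hm.mul hf).lt_of_mem (N := 1) (fun i hi => by rw [hc, coeff_one, if_neg (by omega)])
  obtain rfl : s = 0 := by omega
  exact hirr.not_isUnit hf.isUnit

/-- If `x ^ (e+1) = c f` with `f_0 ≠ 0`, then `c_0 = 0`, so `c = x c'` and cancelling `x` gives `x ^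
e = c' f`. -/
theorem X_pow_notMem_span {f : SkewPoly σ} (hirr : Irreducible f) (hf0 : coeff f 0 ≠ 0) (e : ℕ) :
    (SkewPolynomial.X : SkewPoly σ) ^ e ∉ Ideal.span {f} := by
  induction e with
  | zero =>
    rw [pow_zero]
    exact one_notMem_span_of_irreducible hirr
  | succ e ih =>
    intro h
    obtain ⟨c, hc⟩ := Ideal.mem_span_singleton'.mp h
    have hc0 : coeff c 0 = 0 := by
      have h1 := congrArg (fun p => coeff p 0) hc
      simp only [coeff_mul_zero c, pow_succ', coeff_X_mul_zero] at h1
      exact (mul_eq_zero.mp h1).resolve_right hf0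
    obtain ⟨N, hN⟩ := exists_mem_degLT c
    -- Moving `x` to the left of a coefficient costs `σ⁻¹`.
    set c' := ofVec σ N fun i => σ.symm (coeff c (i + 1)) with hc'
    have hXc : SkewPolynomial.X * c' = c := by
      refine coeff_ext fun i => ?_
      rcases i with _ | i
      · rw [coeff_X_mul_zero, hc0]
      · rw [coeff_X_mul, hc', coeff_ofVec]
        split_ifs with hi
        · rw [σ.apply_symm_apply]
        · rw [map_zero, hN _ (by omega)]
    rw [← hXc, pow_succ', mul_assoc] at hc
    have hX0 : (SkewPolynomial.X : SkewPoly σ) ≠ 0 := SkewPolynomial.X_ne_zero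
    exact ih (Ideal.mem_span_singleton'.mpr ⟨c', mul_left_cancel₀ hX0 hc⟩)

/-- The polynomials `g` with `g(x ^ n) ∈ R f` form an ideal of `K[y]`. It is prime because `R f` is
a maximal left ideal and the `g(x ^ n)` are central, and nonzero because `R / R f` is
finite-dimensional while `K[y]` is not. -/
theorem exists_irreducible_evalXPow_mem [FiniteDimensional K L] {f : SkewPoly σ}
    (hirr : Irreducible f) :
    ∃ F : K[X], F.Monic ∧ Irreducible F ∧ evalXPow σ F ∈ Ideal.span {f} := by
  obtain ⟨s, hf⟩ := exists_hasDegree hirr.ne_zero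
  let I : Ideal K[X] :=
    { carrier := {g | evalXPow σ g ∈ Ideal.span {f}}
      add_mem' := fun {g h} hg hh => by
        have : evalXPow σ (g + h) = evalXPow σ g + evalXPow σ h := map_add _ _ _
        rw [Set.mem_ofPred_eq, this]
        exact Ideal.add_mem _ hg hh
      zero_mem' := by
        have : evalXPow σ (0 : K[X]) = 0 := map_zero _
        rw [Set.mem_ofPred_eq, this]
        exact Ideal.zero_mem _
      smul_mem' := fun c g hg => by
        rw [Set.mem_ofPred_eq, smul_eq_mul, evalXPow_mul]
        exact Ideal.mul_mem_left _ _ hg }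
  have hI : ∀ g, g ∈ I ↔ evalXPow σ g ∈ Ideal.span {f} := fun _ => Iff.rfl
  have hprime : I.IsPrime := by
    rw [Ideal.isPrime_iff]
    refine ⟨fun h => ?_, fun {g h} hgh => ?_⟩
    · have h1 := (Ideal.eq_top_iff_one I).mp h
      have h2 : evalXPow σ (1 : K[X]) = 1 := map_one _
      rw [hI, h2] at h1
      exact one_notMem_span_of_irreducible hirr h1
    · by_contra hc
      push Not at hc
      rw [hI, hI] at hc
      have hmem : f ∈ Ideal.span {f} ⊔ Ideal.span {evalXPow σ g} :=
        Ideal.mem_sup_left (Ideal.mem_span_singleton_self f)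
      have hg : evalXPow σ g ∈ Ideal.span {f} ⊔ Ideal.span {evalXPow σ g} :=
        Ideal.mem_sup_right (Ideal.mem_span_singleton_self _)
      rcases eq_span_or_eq_top_of_irreducible hirr hmem with h0 | h0
      · rw [h0] at hg
        exact hc.1 hg
      -- Write `1 = u f + v g(x ^ n)` and multiply on the right by the central `h(x ^ n)`: both
      -- terms land in `R f`.
      · obtain ⟨a, ha, b, hb, hab⟩ := Submodule.mem_sup.mp ((Ideal.eq_top_iff_one _).mp h0)
        obtain ⟨u, rfl⟩ := Ideal.mem_span_singleton'.mp ha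
        obtain ⟨v, rfl⟩ := Ideal.mem_span_singleton'.mp hb
        refine hc.2 ?_
        rw [← one_mul (evalXPow σ h), ← hab, add_mul, mul_assoc, mul_assoc, ← evalXPow_mul,
          ← evalXPow_comm h f, ← mul_assoc]
        exact Ideal.add_mem _ (Ideal.mul_mem_left _ _ (Ideal.mem_span_singleton_self f))
          (Ideal.mul_mem_left _ _ hgh)
  have hne : I ≠ ⊥ := by
    intro hbot
    have : FiniteDimensional K (SkewPoly σ ⧸ Submodule.span (SkewPoly σ) {f}) :=
      (vecEquivQuot (K := K) hf).finiteDimensional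
    let ev : K[X] →ₗ[K] SkewPoly σ ⧸ Submodule.span (SkewPoly σ) {f} :=
      ((Submodule.span (SkewPoly σ) {f}).mkQ.restrictScalars K) ∘ₗ
        (aeval ((SkewPolynomial.X : SkewPoly σ) ^ orderOf σ)).toLinearMap
    have hinj : Function.Injective ev := by
      rw [← LinearMap.ker_eq_bot, LinearMap.ker_eq_bot']
      intro g hg
      have : g ∈ I := (hI g).mpr ((Submodule.Quotient.mk_eq_zero _).mp hg)
      rwa [hbot] at this
    exact Polynomial.not_finite (Module.Finite.of_injective ev hinj)
  have hgen := Submodule.IsPrincipal.prime_generator_of_isPrime I hne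
  set g := Submodule.IsPrincipal.generator I
  have hg0 : g ≠ 0 := hgen.ne_zero
  refine ⟨g * C g.leadingCoeff⁻¹, monic_mul_leadingCoeff_inv hg0,
    irreducible_mul_leadingCoeff_inv.mpr hgen.irreducible, ?_⟩
  rw [← hI]
  exact I.mul_mem_right _ (Submodule.IsPrincipal.generator_mem I)

/-- `R / R f` is a simple module, so the nonzero image of `E_F ^ n` in it is everything; comparing
dimensions gives `n deg F = n s`. -/
theorem natDegree_eq_of_algEquiv (hfix : ∀ a : L, σ a = a ↔ a ∈ Set.range (algebraMap K L))
    (hpos : 0 < orderOf σ) {F : K[X]} (hFm : F.Monic) (hF : Irreducible F)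
    {f : SkewPoly σ} {s : ℕ} (hf : HasDegree f s) (hirr : Irreducible f)
    (hFf : evalXPow σ F ∈ Ideal.span {f})
    (φ : RF σ F ≃ₐ[K] Matrix (Fin (orderOf σ)) (Fin (orderOf σ)) (AdjoinRoot F)) :
    F.natDegree = s := by
  have : Fact (Irreducible F) := ⟨hF⟩
  have := finiteDimensional_of_fixed hfix hpos
  have : FiniteDimensional K (AdjoinRoot F) := hFm.finite_adjoinRoot
  have hspos : 0 < s := by
    by_contra h0
    obtain rfl : s = 0 := by omega
    exact hirr.not_isUnit hf.isUnit
  have : Nonempty (Fin s) := ⟨⟨0, hspos⟩⟩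
  have : Nontrivial (SkewPoly σ ⧸ Submodule.span (SkewPoly σ) {f}) :=
    (vecEquivQuot (K := K) hf).symm.toEquiv.nontrivial
  obtain ⟨Θ, hΘ, hΘM⟩ := exists_equivariant_injective hpos
    ((quotRep hFf).comp φ.symm.toAlgHom)
  let N : Ideal (SkewPoly σ) :=
    { carrier := {p | Submodule.Quotient.mk p ∈ LinearMap.range Θ}
      add_mem' := fun {p q} hp hq => by
        rw [Set.mem_ofPred_eq, Submodule.Quotient.mk_add]
        exact Submodule.add_mem _ hp hq
      zero_mem' := by
        rw [Set.mem_ofPred_eq, Submodule.Quotient.mk_zero]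
        exact Submodule.zero_mem _
      smul_mem' := fun c p hp => by
        obtain ⟨v, hv⟩ := hp
        refine ⟨(φ (mk σ F c)).mulVec v, ?_⟩
        rw [hΘM, hv]
        change quotRep hFf (φ.symm (φ (mk σ F c))) _ = _
        rw [φ.symm_apply_apply, quotRep_mk]
        rfl }
  have hN : ∀ p, p ∈ N ↔ Submodule.Quotient.mk p ∈ LinearMap.range Θ := fun _ => Iff.rfl
  have hfN : f ∈ N := by
    rw [hN, (Submodule.Quotient.mk_eq_zero _).mpr (Submodule.mem_span_singleton_self f)]
    exact Submodule.zero_mem _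
  have hsurj : Function.Surjective Θ := by
    rcases eq_span_or_eq_top_of_irreducible hirr hfN with h | h
    · exfalso
      have : NeZero (orderOf σ) := ⟨hpos.ne'⟩
      obtain ⟨v, hv⟩ := exists_ne (0 : Fin (orderOf σ) → AdjoinRoot F)
      obtain ⟨p, hp⟩ := Submodule.mkQ_surjective _ (Θ v)
      have hpN : p ∈ N := ⟨v, hp.symm⟩
      rw [h] at hpN
      have h0 : Θ v = 0 := hp.symm.trans ((Submodule.Quotient.mk_eq_zero _).mpr hpN)
      exact hv (hΘ (h0.trans (map_zero Θ).symm))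
    · intro u
      obtain ⟨p, rfl⟩ := Submodule.mkQ_surjective _ u
      have hpN : p ∈ N := h ▸ Submodule.mem_top
      exact hpN
  have hfr := (LinearEquiv.ofBijective Θ ⟨hΘ, hsurj⟩).finrank_eq
  rw [← (vecEquivQuot (K := K) hf).finrank_eq, Module.finrank_pi_fintype,
    Module.finrank_pi_fintype, (AdjoinRoot.powerBasis hFm.ne_zero).finrank,
    AdjoinRoot.powerBasis_dim, finrank_of_fixed hfix] at hfr
  simp only [Finset.sum_const, Finset.card_univ, Fintype.card_fin, smul_eq_mul] at hfr
  rw [mul_comm s] at hfr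
  exact Nat.eq_of_mul_eq_mul_left hpos hfr

theorem eq_one_of_irreducible_of_coeff_zero {f : SkewPoly σ} {s : ℕ} (hf : HasDegree f s)
    (hirr : Irreducible f) (hf0 : coeff f 0 = 0) : s = 1 := by
  set g := ofVec σ s fun i => coeff f (i + 1) with hg
  have hgX : f = g * SkewPolynomial.X := by
    refine coeff_ext fun i => ?_
    rcases i with _ | i
    · rw [coeff_mul_X_zero, hf0]
    · rw [coeff_mul_X, hg, coeff_ofVec]
      split_ifs with hi
      · rfl
      · exact hf.2 _ (by omega)
  have hX : HasDegree (SkewPolynomial.X : SkewPoly σ) 1 := by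
    rw [← pow_one SkewPolynomial.X, ← mon_one]
    exact ⟨by simp [coeff_mon], fun i hi => by rw [coeff_mon, if_neg hi.ne]⟩
  have hgu := (hirr.isUnit_or_isUnit hgX).resolve_right fun hu =>
    one_ne_zero (hX.eq_zero_of_isUnit hu)
  obtain ⟨m, hm⟩ := exists_hasDegree (p := g) (by
    rintro h
    rw [h, zero_mul] at hgX
    exact hirr.ne_zero hgX)
  obtain rfl := hm.eq_zero_of_isUnit hgu
  have hd := hm.mul hX
  rw [← hgX, zero_add] at hd
  have h1 := hd.lt_of_mem (N := s + 1) fun i hi => hf.2 i (by omega)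
  have h2 := hf.lt_of_mem (N := 1 + 1) fun i hi => hd.2 i (by omega)
  omega

/-- If `f_0 ≠ 0`, no power of `x` lies in `R f`, so the `F` attached to `f` is not `y`. If `f_0 =
0`, then `f` has degree one and `𝕊_f` lives on constants, where no reduction takes place; `f` may
therefore be replaced by `x - 1`, with `F = y - 1`. -/
theorem exists_isSpreadSetOf_petitMul [Finite L]
    (hfix : ∀ a : L, σ a = a ↔ a ∈ Set.range (algebraMap K L)) (hpos : 0 < orderOf σ)
    (ρ : L ≃ₐ[K'] L) {s : ℕ} {f : SkewPoly σ} (hf : HasDegree f s) (hirr : Irreducible f) :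
    ∃ F : K[X], F.Monic ∧ Irreducible F ∧ F.natDegree = s ∧ F ≠ X ∧
      ∀ φ : RF σ F ≃ₐ[K] Matrix (Fin (orderOf σ)) (Fin (orderOf σ)) (AdjoinRoot F),
        IsSpreadSetOf (φ '' codeS σ 1 0 ρ F) (petitMul hf) := by
  have := finiteDimensional_of_fixed hfix hpos
  by_cases hf0 : coeff f 0 = 0
  · obtain rfl := eq_one_of_irreducible_of_coeff_zero hf hirr hf0
    have hmonic : (X - 1 : K[X]).Monic := monic_X_sub_C 1
    have hirrF : Irreducible (X - 1 : K[X]) := irreducible_X_sub_C 1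
    have hdeg : (X - 1 : K[X]).natDegree = 1 := natDegree_X_sub_C 1
    refine ⟨X - 1, hmonic, hirrF, hdeg, ?_, fun φ => ?_⟩
    · intro h
      have := congrArg (fun p => p.coeff 0) h
      simp at this
    · set f' : SkewPoly σ := SkewPolynomial.X - 1 with hf'
      have hdf' : HasDegree f' 1 := by
        rw [hf', ← pow_one SkewPolynomial.X, ← mon_one]
        refine ⟨by simp [coeff_mon, coeff_one], fun i hi => ?_⟩
        rw [coeff_sub, coeff_mon, coeff_one, if_neg hi.ne, if_neg (by omega), sub_zero]
      have hmem : evalXPow σ (X - 1 : K[X]) ∈ Ideal.span {f'} := by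
        refine Ideal.mem_span_singleton'.mpr ⟨∑ i ∈ Finset.range (orderOf σ),
          SkewPolynomial.X ^ i, ?_⟩
        rw [hf', geom_sum_mul]
        simp [evalXPow]
      have hmul : petitMul hf = petitMul hdf' := by
        funext a b
        have hab : (a * b : SkewPoly σ) ∈ degLT σ 1 := fun i hi =>
          coeff_mul_eq_zero (m := 0) (l := 0) (fun j hj => a.2 j (by omega))
            (fun j hj => b.2 j (by omega)) (by omega)
        rw [petitMul_eq_of_mem hf hab, petitMul_eq_of_mem hdf' hab]
      rw [hmul]
      exact isSpreadSetOf_petitMul hfix hpos ρ hmonic hirrF hdeg hdf' hmem φ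
  · obtain ⟨F, hFm, hF, hFf⟩ := exists_irreducible_evalXPow_mem hirr
    have hFX : F ≠ X := by
      rintro rfl
      refine X_pow_notMem_span hirr hf0 (orderOf σ) ?_
      simpa [evalXPow] using hFf
    obtain ⟨φ₀⟩ := nonempty_algEquiv_of_finite hfix hpos hFm hF hFX
    have hdeg := natDegree_eq_of_algEquiv hfix hpos hFm hF hf hirr hFf φ₀
    exact ⟨F, hFm, hF, hdeg, hFX, fun φ =>
      isSpreadSetOf_petitMul hfix hpos ρ hFm hF hdeg hf hFf φ⟩

end Petit

/-! ### Twisted Gabidulin codes and generalised twisted fields -/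

section Gabidulin

variable {K L : Type*} [Field K] [Field L] [Algebra K L] {σ : L ≃ₐ[K] L}

/-- The action of `L[x;σ]` on `L` by linearized polynomials. -/
def linearizedAction (σ : L ≃ₐ[K] L) : SkewPoly σ →ₐ[K] Module.End K L :=
  skewLift (Algebra.lmul K L) (σ : L →ₐ[K] L).toLinearMap (by
    intro a
    refine LinearMap.ext fun b => ?_
    exact map_mul σ a b)

theorem toLinearMap_pow_apply (i : ℕ) (b : L) :
    ((σ : L →ₐ[K] L).toLinearMap ^ i : Module.End K L) b = (σ ^ i) b := by
  induction i generalizing b with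
  | zero => rfl
  | succ i ih =>
    rw [pow_succ, pow_succ]
    exact ih (σ b)

theorem linearizedAction_apply {N : ℕ} {p : SkewPoly σ} (hp : p ∈ degLT σ N) (b : L) :
    linearizedAction σ p b = ∑ i ∈ Finset.range N, coeff p i * (σ ^ i) b := by
  rw [linearizedAction, skewLift_eq_sum hp, LinearMap.sum_apply]
  refine Finset.sum_congr rfl fun i _ => ?_
  rw [Module.End.mul_apply, toLinearMap_pow_apply]
  rfl

theorem linearizedAction_evalXPow : linearizedAction σ (evalXPow σ (X - 1 : K[X])) = 0 := by
  have h : evalXPow σ (X - 1 : K[X]) = SkewPolynomial.X ^ orderOf σ - 1 := by simp [evalXPow]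
  rw [h, map_sub, map_pow, map_one, linearizedAction, skewLift_X, sub_eq_zero]
  refine LinearMap.ext fun b => ?_
  rw [toLinearMap_pow_apply, pow_orderOf_eq_one]
  rfl

/-- Dedekind's independence of characters, applied to the distinct powers of `σ` below its order. -/
theorem eq_zero_of_forall_sum_pow {v : Fin (orderOf σ) → L}
    (h : ∀ b, ∑ i : Fin (orderOf σ), v i * (σ ^ (i : ℕ)) b = 0) : v = 0 := by
  have hli := (linearIndependent_monoidHom L L).comp
    (fun i : Fin (orderOf σ) => ((σ ^ (i : ℕ) : L ≃ₐ[K] L) : L →* L)) (by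
      intro i j hij
      refine Fin.ext (pow_injOn_Iio_orderOf i.2 j.2 (AlgEquiv.ext fun a => ?_))
      exact DFunLike.congr_fun hij a)
  rw [Fintype.linearIndependent_iff] at hli
  refine funext fun i => hli v (funext fun b => ?_) i
  rw [Finset.sum_apply]
  exact h b

/-- The map `R_{y-1} → End_K(L)` induced by the action on `L`. -/
def linearizedMap (σ : L ≃ₐ[K] L) : RF σ (X - 1 : K[X]) →ₐ[K] Module.End K L :=
  Ideal.Quotient.liftₐ (centralIdeal σ (X - 1)) (linearizedAction σ) (by
    intro a ha
    obtain ⟨c, rfl⟩ := Ideal.mem_span_singleton'.mp ha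
    rw [map_mul, linearizedAction_evalXPow, mul_zero])

/-- Classes modulo `x ^ n - 1` have representatives of degree less than `n`, which act faithfully by
Dedekind; both sides have dimension `n ^ 2` over `K`. -/
theorem linearizedMap_bijective (hfix : ∀ a : L, σ a = a ↔ a ∈ Set.range (algebraMap K L))
    (hpos : 0 < orderOf σ) : Function.Bijective (linearizedMap σ) := by
  have hmonic : (X - 1 : K[X]).Monic := monic_X_sub_C 1
  have hdeg : (X - 1 : K[X]).natDegree = 1 := natDegree_X_sub_C 1
  have := finiteDimensional_of_fixed hfix hpos
  have := finiteDimensional_RF hfix hpos hmonic.ne_zero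
  have hinj : Function.Injective (linearizedMap σ).toLinearMap := by
    rw [← LinearMap.ker_eq_bot, LinearMap.ker_eq_bot']
    intro u hu
    obtain ⟨p, rfl⟩ := mk_surjective _ u
    obtain ⟨r, hr⟩ := exists_remainder (hasDegree_evalXPow hpos hmonic.ne_zero) p
    have hpr : mk σ (X - 1 : K[X]) p = mk σ (X - 1 : K[X]) r := by
      have : mk σ (X - 1 : K[X]) (p - r) = 0 := mk_eq_zero_iff.mpr hr
      exact sub_eq_zero.mp ((map_sub (mkₐ σ (X - 1)) _ _).symm.trans this)
    have hrmem : (r : SkewPoly σ) ∈ degLT σ (orderOf σ) := by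
      have hle : orderOf σ * (X - 1 : K[X]).natDegree ≤ orderOf σ := by rw [hdeg, mul_one]
      exact degLT_mono hle r.2
    rw [hpr] at hu ⊢
    have hv : (fun i : Fin (orderOf σ) => coeff (r : SkewPoly σ) i) = 0 := by
      refine eq_zero_of_forall_sum_pow fun b => ?_
      have h1 := LinearMap.congr_fun hu b
      change linearizedAction σ r b = 0 at h1
      rw [linearizedAction_apply hrmem, Finset.sum_range] at h1
      exact h1
    have hr0 : (r : SkewPoly σ) = 0 := by
      rw [← ofVec_coeff hrmem, hv, map_zero]
    rw [hr0]
    exact map_zero (mkₐ σ (X - 1))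
  have hfr : Module.finrank K (RF σ (X - 1 : K[X])) = Module.finrank K (Module.End K L) := by
    rw [finrank_RF hfix hpos hmonic.ne_zero, hdeg, Module.finrank_linearMap,
      finrank_of_fixed hfix, mul_one]
  exact ⟨hinj, (LinearMap.injective_iff_surjective_of_finrank_eq_finrank hfr).mp hinj⟩

/-- The isomorphism `R_{y-1} ≅ End_K(L)`. -/
def linearizedEquiv (hfix : ∀ a : L, σ a = a ↔ a ∈ Set.range (algebraMap K L))
    (hpos : 0 < orderOf σ) : RF σ (X - 1 : K[X]) ≃ₐ[K] Module.End K L :=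
  AlgEquiv.ofBijective (linearizedMap σ) (linearizedMap_bijective hfix hpos)

theorem linearizedEquiv_mk (hfix : ∀ a : L, σ a = a ↔ a ∈ Set.range (algebraMap K L))
    (hpos : 0 < orderOf σ) (a : SkewPoly σ) :
    linearizedEquiv hfix hpos (mk σ (X - 1) a) = linearizedAction σ a :=
  rfl

theorem isLinearizedCorrespondence_linearizedEquiv
    (hfix : ∀ a : L, σ a = a ↔ a ∈ Set.range (algebraMap K L)) (hpos : 0 < orderOf σ) :
    IsLinearizedCorrespondence σ (linearizedEquiv hfix hpos) := by
  intro a b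
  obtain ⟨N, hN⟩ := exists_mem_degLT a
  rw [linearizedEquiv_mk, linearizedAction_apply hN]
  refine (Finset.sum_subset (fun i hi => ?_) fun i _ hi => ?_).symm
  · rw [Finset.mem_range]
    by_contra h
    exact SkewPolynomial.mem_support_iff.mp hi (hN i (by omega))
  · have : coeff a i = 0 := SkewPolynomial.notMem_support_iff.mp hi
    rw [this, zero_mul]

variable {K' : Type*} [Field K'] [Algebra K' L]

theorem image_codeS_eq_twistedGabidulin
    (hfix : ∀ a : L, σ a = a ↔ a ∈ Set.range (algebraMap K L)) (hpos : 0 < orderOf σ)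
    (ρ : L ≃ₐ[K'] L) {k : ℕ} (hk : 1 ≤ k) (η : L) :
    linearizedEquiv hfix hpos '' codeS σ k η ρ (X - 1) = twistedGabidulin σ k η ρ := by
  have hdeg : (X - 1 : K[X]).natDegree = 1 := natDegree_X_sub_C 1
  ext g
  constructor
  · rintro ⟨_, ⟨a, h1, h2, rfl⟩, rfl⟩
    rw [hdeg, mul_one] at h1 h2
    refine ⟨coeff a, fun b => ?_⟩
    rw [linearizedEquiv_mk, linearizedAction_apply (N := k + 1) fun i hi => h1 i (by omega),
      Finset.sum_range_succ, h2]
  · rintro ⟨c, hc⟩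
    refine ⟨_, ⟨codePoly σ η ρ k fun i => c i, ?_, ?_, rfl⟩, ?_⟩
    · intro i hi
      exact coeff_codePoly_gt _ (by rwa [hdeg, mul_one] at hi)
    · rw [hdeg, mul_one]
      exact coeff_codePoly_self hk _
    · refine LinearMap.ext fun b => ?_
      rw [linearizedEquiv_mk, linearizedAction_apply (N := k + 1) fun i hi =>
        coeff_codePoly_gt _ (by omega), Finset.sum_range_succ, coeff_codePoly_self hk,
        coeff_codePoly_lt _ hk, hc]
      congr 1
      refine Finset.sum_congr rfl fun i hi => ?_
      rw [coeff_codePoly_lt _ (Finset.mem_range.mp hi)]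

theorem twistedGabidulin_one (ρ : L ≃ₐ[K'] L) (η : L) :
    twistedGabidulin σ 1 η ρ = spreadSetEnd K (twistedMul ρ σ (-η)) := by
  ext g
  constructor
  · rintro ⟨c, hc⟩
    refine ⟨c 0, fun b => ?_⟩
    rw [hc, twistedMul]
    simp
  · rintro ⟨a, ha⟩
    refine ⟨fun _ => a, fun b => ?_⟩
    rw [ha, twistedMul]
    simp

variable [Algebra K' K] [FiniteDimensional K' K]

/-- With `s = 1` and `F_0 = -1` the sign is `(-1) ^ (k (n-1) + k) = (-1) ^ (n k)`, and its norm to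
`K'` is its `[K : K']`-th power. Being a sign, it can be moved across. -/
theorem normCond_X_sub_one_iff (hpos : 0 < orderOf σ) (k : ℕ) (η : L) :
    NormCond K' σ k η (X - 1 : K[X]) ↔
      Algebra.norm K' η ≠ (-1) ^ (orderOf σ * k * Module.finrank K' K) := by
  have hdeg : (X - 1 : K[X]).natDegree = 1 := natDegree_X_sub_C 1
  have hc0 : (X - 1 : K[X]).coeff 0 = -1 := by simp
  have hexp : 1 * k * (orderOf σ - 1) + k = orderOf σ * k := by
    obtain ⟨m, hm⟩ := Nat.exists_eq_succ_of_ne_zero hpos.ne'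
    rw [hm, Nat.succ_sub_one, Nat.succ_eq_add_one]
    ring
  have hN : Algebra.norm K' ((-1 : K) ^ (orderOf σ * k)) =
      (-1) ^ (orderOf σ * k * Module.finrank K' K) := by
    have : (-1 : K) ^ (orderOf σ * k) = algebraMap K' K ((-1) ^ (orderOf σ * k)) := by simp
    rw [this, Algebra.norm_algebraMap, ← pow_mul]
  rw [NormCond, hdeg, hc0, ← pow_add, hexp, hN, not_iff_not]
  rcases neg_one_pow_eq_or K' (orderOf σ * k * Module.finrank K' K) with h | h
  · rw [h, mul_one]
  · rw [h, mul_neg_one, neg_eq_iff_eq_neg]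

variable [IsScalarTower K' K L]

/-- For `k = 1` the sign is `(-1) ^ [L : K']`, the norm of `-1`, so it merges with `η`. -/
theorem normCond_X_sub_one_one_iff (hfix : ∀ a : L, σ a = a ↔ a ∈ Set.range (algebraMap K L))
    (hpos : 0 < orderOf σ) (η : L) :
    NormCond K' σ 1 η (X - 1 : K[X]) ↔ Algebra.norm K' (-η) ≠ 1 := by
  have hN : Algebra.norm K' (-η) = (-1) ^ (orderOf σ * 1 * Module.finrank K' K) *
      Algebra.norm K' η := by
    have : -η = algebraMap K' L (-1) * η := by simp
    rw [this, map_mul, Algebra.norm_algebraMap, ← Module.finrank_mul_finrank K' K L,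
      finrank_of_fixed hfix, mul_one, mul_comm (orderOf σ)]
  rw [normCond_X_sub_one_iff hpos, hN, not_iff_not]
  rcases neg_one_pow_eq_or K' (orderOf σ * 1 * Module.finrank K' K) with h | h
  · rw [h, one_mul]
  · rw [h, neg_one_mul, neg_eq_iff_eq_neg]

/-- The second exponent becomes the defining automorphism: `τ = σ ^ j` over its own fixed field
`K₁`, with `K` as the small field, over which `σ ^ i` is linear. The choice `η = -c` turns the norm
condition into `N_{L:K}(c) ≠ 1`. -/
theorem exists_twistedField (hfix : ∀ a : L, σ a = a ↔ a ∈ Set.range (algebraMap K L))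
    (hpos : 0 < orderOf σ) (i j : ℕ) (c : L) (hc : Algebra.norm K c ≠ 1) :
    ∃ (K₁ : IntermediateField K L) (τ : L ≃ₐ[K₁] L),
      (∀ a, τ a = (σ ^ j) a) ∧ (∀ a, τ a = a ↔ a ∈ K₁) ∧
      NormCond K τ 1 (-c) (X - 1 : K₁[X]) ∧
      ∃ Φ : RF τ (X - 1 : K₁[X]) ≃ₐ[K₁] Module.End K₁ L,
        IsLinearizedCorrespondence τ Φ ∧
        Φ '' codeS τ 1 (-c) (σ ^ i) (X - 1) =
          spreadSetEnd K₁ (twistedMul (fun a => (σ ^ i) a) (fun a => (σ ^ j) a) c) := by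
  have := finiteDimensional_of_fixed hfix hpos
  let K₁ : IntermediateField K L := IntermediateField.fixedField (Subgroup.zpowers (σ ^ j))
  have hmem : ∀ a, a ∈ K₁ ↔ (σ ^ j) a = a := by
    intro a
    rw [IntermediateField.mem_fixedField_iff]
    constructor
    · intro h
      exact h _ (Subgroup.mem_zpowers _)
    · intro h g hg
      have : Subgroup.zpowers (σ ^ j) ≤ MulAction.stabilizer (L ≃ₐ[K] L) a :=
        (Subgroup.zpowers_le).mpr h
      exact this hg
  let τ : L ≃ₐ[K₁] L := AlgEquiv.ofRingEquiv (f := (σ ^ j : L ≃ₐ[K] L).toRingEquiv)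
    fun x => (hmem x).mp x.2
  have hτ : ∀ a, τ a = (σ ^ j) a := fun _ => rfl
  have hfixτ : ∀ a : L, τ a = a ↔ a ∈ Set.range (algebraMap K₁ L) := by
    intro a
    rw [hτ, ← hmem]
    exact ⟨fun h => ⟨⟨a, h⟩, rfl⟩, by rintro ⟨x, rfl⟩; exact x.2⟩
  have hposτ : 0 < orderOf τ := by
    have hpow : ∀ m a, (τ ^ m) a = ((σ ^ j) ^ m) a := by
      intro m
      induction m with
      | zero => intro a; rfl
      | succ m ih =>
        intro a
        rw [pow_succ, pow_succ]
        exact ih _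
    refine orderOf_pos_iff.mpr (isOfFinOrder_iff_pow_eq_one.mpr ⟨orderOf σ, hpos, ?_⟩)
    refine AlgEquiv.ext fun a => ?_
    rw [hpow, ← pow_mul, mul_comm, pow_mul, pow_orderOf_eq_one, one_pow]
    rfl
  refine ⟨K₁, τ, hτ, fun a => by rw [hτ, hmem], ?_, linearizedEquiv hfixτ hposτ,
    isLinearizedCorrespondence_linearizedEquiv hfixτ hposτ, ?_⟩
  · rw [normCond_X_sub_one_one_iff hfixτ hposτ, neg_neg]
    exact hc
  · rw [image_codeS_eq_twistedGabidulin hfixτ hposτ _ le_rfl, twistedGabidulin_one, neg_neg]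
    rfl

end Gabidulin

section NormCond

variable {K' K L : Type*} [Field K'] [Field K] [Field L]
  [Algebra K' K] [Algebra K L] [Algebra K' L] [IsScalarTower K' K L] [FiniteDimensional K' K]
  {σ : L ≃ₐ[K] L}

theorem normCond_zero (hfix : ∀ a : L, σ a = a ↔ a ∈ Set.range (algebraMap K L))
    (hpos : 0 < orderOf σ) (k : ℕ) (F : K[X]) : NormCond K' σ k 0 F := by
  -- Finiteness of `L` over `K'` matters: `Algebra.norm` takes the default value `1` without a
  -- finite basis.
  have := finiteDimensional_bot K' hfix hpos
  rw [NormCond, Algebra.norm_zero, zero_mul]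
  exact zero_ne_one

end NormCond

end SkewMRD

end

/-! ### Assembly of the main theorem -/

theorem mainTheorem1 {K' K L : Type*} [Field K'] [Field K] [Field L]
    [Algebra K' K] [Algebra K L] [Algebra K' L] [IsScalarTower K' K L] [FiniteDimensional K' K]
    -- `K` is the fixed field of the automorphism `σ` of `L`, of finite order `n`
    (σ : L ≃ₐ[K] L) (hfix : ∀ a : L, σ a = a ↔ a ∈ Set.range (algebraMap K L))
    (n : ℕ) (hn : orderOf σ = n) (hpos : 0 < n) (ρ : L ≃ₐ[K'] L) :
    -- the code is a `K'`-linear MRD code with minimum distance `n - k + 1`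
    (∀ F : K[X], F.Monic → Irreducible F → ∀ k, 1 ≤ k → k ≤ n →
      ∀ η : L, SkewMRD.NormCond K' σ k η F →
      ∀ φ : SkewMRD.RF σ F ≃ₐ[K] Matrix (Fin n) (Fin n) (AdjoinRoot F),
        SkewMRD.IsLinearMRD K' (φ '' SkewMRD.codeS σ k η ρ F) (n - k + 1)) ∧
    -- over finite fields: the quotient is a matrix ring, and the size of the code
    (Finite L → ∀ F : K[X], F.Monic → Irreducible F →
      (F ≠ X ∨ n = 1 → Nonempty (SkewMRD.RF σ F ≃ₐ[K] Matrix (Fin n) (Fin n) (AdjoinRoot F))) ∧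
      ∀ k, 1 ≤ k → k ≤ n → ∀ η : L, SkewMRD.NormCond K' σ k η F →
        (SkewMRD.codeS σ k η ρ F).ncard = Nat.card K ^ (n * F.natDegree * k)) ∧
    -- `k = 1`: semifields
    (∀ F : K[X], F.Monic → Irreducible F → ∀ η : L, SkewMRD.NormCond K' σ 1 η F →
      ∀ φ : SkewMRD.RF σ F ≃ₐ[K] Matrix (Fin n) (Fin n) (AdjoinRoot F),
        SkewMRD.DefinesSemifields K' (φ '' SkewMRD.codeS σ 1 η ρ F)) ∧
    -- `k = 1`, `η = 0`: the cyclic semifields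
    (∀ F : K[X], F.Monic → Irreducible F → SkewMRD.NormCond K' σ 1 0 F ∧
      ∀ (f : SkewMRD.SkewPoly σ) (hf : SkewMRD.HasDegree f F.natDegree), Irreducible f →
      SkewMRD.evalXPow σ F ∈ Ideal.span {f} →
      ∀ φ : SkewMRD.RF σ F ≃ₐ[K] Matrix (Fin n) (Fin n) (AdjoinRoot F),
        SkewMRD.IsSpreadSetOf (φ '' SkewMRD.codeS σ 1 0 ρ F) (SkewMRD.petitMul hf)) ∧
    -- over finite fields every cyclic semifield arises
    (Finite L → ∀ (s : ℕ) (f : SkewMRD.SkewPoly σ) (hf : SkewMRD.HasDegree f s), Irreducible f →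
      ∃ F : K[X], F.Monic ∧ Irreducible F ∧ F.natDegree = s ∧ F ≠ X ∧
        ∀ φ : SkewMRD.RF σ F ≃ₐ[K] Matrix (Fin n) (Fin n) (AdjoinRoot F),
          SkewMRD.IsSpreadSetOf (φ '' SkewMRD.codeS σ 1 0 ρ F) (SkewMRD.petitMul hf)) ∧
    -- `s = 1`, `F = y - 1`: the twisted Gabidulin codes, and the generalised twisted fields
    -- (`k = 1`) with the exponents `ρ` and `σ`
    (∃ Φ : SkewMRD.RF σ (X - 1 : K[X]) ≃ₐ[K] Module.End K L,
      SkewMRD.IsLinearizedCorrespondence σ Φ ∧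
      (∀ k, 1 ≤ k → k ≤ n → ∀ η : L,
        Φ '' SkewMRD.codeS σ k η ρ (X - 1) = SkewMRD.twistedGabidulin σ k η ρ ∧
        (SkewMRD.NormCond K' σ k η (X - 1 : K[X]) ↔
          Algebra.norm K' η ≠ (-1) ^ (n * k * Module.finrank K' K))) ∧
      ∀ η : L,
        Φ '' SkewMRD.codeS σ 1 η ρ (X - 1) =
          SkewMRD.spreadSetEnd K (SkewMRD.twistedMul ρ σ (-η)) ∧
        (SkewMRD.NormCond K' σ 1 η (X - 1 : K[X]) ↔ Algebra.norm K' (-η) ≠ 1)) ∧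
    -- every generalised twisted field `a b - c a ^ (σ ^ i) b ^ (σ ^ j)` with `N(c) ≠ 1` arises,
    -- from the automorphism `τ = σ ^ j`, its fixed field `K₁`, and `ρ = σ ^ i`
    (∀ (i j : ℕ) (c : L), Algebra.norm K c ≠ 1 →
      ∃ (K₁ : IntermediateField K L) (τ : L ≃ₐ[K₁] L),
        (∀ a, τ a = (σ ^ j) a) ∧ (∀ a, τ a = a ↔ a ∈ K₁) ∧
        SkewMRD.NormCond K τ 1 (-c) (X - 1 : K₁[X]) ∧
        ∃ Φ : SkewMRD.RF τ (X - 1 : K₁[X]) ≃ₐ[K₁] Module.End K₁ L,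
          SkewMRD.IsLinearizedCorrespondence τ Φ ∧
          Φ '' SkewMRD.codeS τ 1 (-c) (σ ^ i) (X - 1) =
            SkewMRD.spreadSetEnd K₁ (SkewMRD.twistedMul (fun a => (σ ^ i) a) (fun a => (σ ^ j) a) c)) := by
  subst hn
  refine ⟨fun F hFm hF k hk1 hk η hc φ =>
      SkewMRD.isLinearMRD_codeS hfix hpos hFm hF hk1 hk ρ hc φ,
    fun hL F hFm hF => ⟨fun hX => ?_, fun k hk1 hk η hc =>
      SkewMRD.ncard_codeS hfix hpos hFm hF.natDegree_pos hk1 hk hc⟩,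
    fun F hFm hF η hc φ => SkewMRD.definesSemifields_codeS hfix hpos hFm hF ρ hc φ,
    fun F hFm hF => ⟨SkewMRD.normCond_zero hfix hpos 1 F, fun f hf _ hFf φ =>
      SkewMRD.isSpreadSetOf_petitMul hfix hpos ρ hFm hF rfl hf hFf φ⟩,
    fun hL s f hf hirr => SkewMRD.exists_isSpreadSetOf_petitMul hfix hpos ρ hf hirr,
    ⟨SkewMRD.linearizedEquiv hfix hpos,
      SkewMRD.isLinearizedCorrespondence_linearizedEquiv hfix hpos,
      fun k hk1 _ η => ⟨SkewMRD.image_codeS_eq_twistedGabidulin hfix hpos ρ hk1 η,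
        SkewMRD.normCond_X_sub_one_iff hpos k η⟩,
      fun η => ⟨(SkewMRD.image_codeS_eq_twistedGabidulin hfix hpos ρ le_rfl η).trans
          (SkewMRD.twistedGabidulin_one ρ η),
        SkewMRD.normCond_X_sub_one_one_iff hfix hpos η⟩⟩,
    fun i j c hc => SkewMRD.exists_twistedField hfix hpos i j c hc⟩
  -- `F = y` remains only with `n = 1`, where the argument does not need simplicity of `R_F`.
  rcases eq_or_ne F X with h | h
  · exact SkewMRD.nonempty_algEquiv_of_orderOf_eq_one hfix rfl (hX.resolve_left (not_not.mpr h))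
      hFm hF
  · exact SkewMRD.nonempty_algEquiv_of_finite hfix hpos hFm hF h
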